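/- **Definitions.** A *positively supported classical symbol* of order $\alpha\in\mathbb C$ is a smooth function $\sigma:\mathbb R\to\mathbb C$ with closed support in $]0,\infty[$ such that, for some $a_0,a_1,\dots\in\mathbb C$, one has $\partial_\xi^d\big(\sigma(\xi)-\sum_{j<J}a_j\xi^{\alpha-j}\big)=O(\xi^{\operatorname{Re}\alpha-J-d})$ on $[1,\infty[$ for all integers $J,d\ge 0$ (the leading coefficient may vanish). A *simple holomorphic family* of such symbols on an open set $W\subset\mathbb C$, with holomorphic order $\alpha:W\to\mathbb C$, is a holomorphic map $z\mapsto\sigma(z)$ from $W$ to $C^\infty(\mathbb R)$ such that $\sigma(z)$ is a positively supported classical symbol of order $\alpha(z)$, with coefficients $a_j(z)$ holomorphic in $z$ and with the above estimates uniform for $z$ in compact subsets of $W$. The *cut-off nested sums* $\mathrm{fp}\!\sum^{\rm Chen}_{<}\sigma_1\otimes\cdots\otimes\sigma_k$ and $\mathrm{fp}\!\sum^{\rm Chen}_{\le}\sigma_1\otimes\cdots\otimes\sigma_k$ are the finite parts, as $N\to\infty$ through the integers, of $$\sum_{0<n_k<\cdots<n_1\le N}\sigma_1(n_1)\cdots\sigma_k(n_k),\qquad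 \sum_{0<n_k\le\cdots\le n_1\le N}\sigma_1(n_1)\cdots\sigma_k(n_k),$$ that is, the constant terms of their asymptotic expansions in terms $N^s(\log N)^l$ ($s\in\mathbb C$, $l\in\mathbb N$). The ordinary nested sums $\sum^{\rm Chen}_{<}$, $\sum^{\rm Chen}_{\le}$ are the corresponding sums without the bound $N$. **Theorem.** Let $W\subset\mathbb C$ be an open neighbourhood of $0$ and let $\sigma_1(z),\dots,\sigma_k(z)$, $z\in W$, be simple holomorphic families of positively supported classical symbols with holomorphic orders $\alpha_1(z),\dots,\alpha_k(z)$ such that $\operatorname{Re}(\alpha_1'(z)+\cdots+\alpha_m'(z))<0$ for all $m\in\{1,\dots,k\}$ and $z\in W$. Put $\sigma_i=\sigma_i(0)$. The following holds for both versions $<$ and $\le$. 1. The cut-off nested sum $G(z_1,\dots,z_k)=\mathrm{fp}\!\sum^{\rm Chen}\sigma_1(z_1)\otimes\cdots\otimes\sigma_k(z_k)$ is well defined for all $(z_1,\dots,z_k)\in W^k$ (the finite part exists and is unique). The union $Z$ of the countably many hypersurfaces $$\alpha_1(z_1)+\cdots+\alpha_j(z_j)=-j+m,\qquad j\in\{1,\dots,k\},\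 m\in\mathbb N=\{0,1,2,\dots\},$$ has dense complement in $W^k$, and on $W^k\setminus Z$ the function $G$ coincides with a meromorphic function on $W^k$ whose poles lie on these hypersurfaces, with multiplicity at most $j$. Precisely, for each $p\in W^k$ there are integers $0\le e_j\le j$, with $e_j=0$ unless $p$ lies on a hypersurface of index $j$, and with $\sum_j e_j$ at most the largest $j$ such that $e_j>0$, and a holomorphic function $g$ near $p$ such that, near $p$ and off $Z$, $$G(z)=g(z)\prod_{j=1}^k\Big(\sum_{i\le j}\alpha_i(z_i)-\sum_{i\le j}\alpha_i(p_i)\Big)^{-e_j}.$$ 2. The map $z\mapsto\mathrm{fp}\!\sum^{\rm Chen}\sigma_1(z)\otimes\cdots\otimes\sigma_k(z)$ is meromorphic on $W$ (i.e. it coincides near each point, possibly except at that point, with a meromorphic function), with poles of order at most $k$. 3. Suppose $\operatorname{Re}(\alpha_1(0)+\cdots+\alpha_j(0))<-j$ for all $j\in\{1,\dots,k\}$. Then the nested sum $\sum^{\rm Chen}\sigma_1\otimes\cdots\otimes\sigma_k$ converges (absolutely, and as the limit of the truncated sums), and it is equal to the cut-off nested sum of $\sigma_1\otimes\cdots\otimes\sigma_k$,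 to the finite part (constant Laurent coefficient) at $z=0$ of $z\mapsto\mathrm{fp}\!\sum^{\rm Chen}\sigma_1(z)\otimes\cdots\otimes\sigma_k(z)$, and to the limit of that map as $z\to0$; in particular it does not depend on the perturbation. Let moreover $\tau_1,\dots,\tau_l$ be positively supported classical symbols of orders $\beta_1,\dots,\beta_l$ with $\operatorname{Re}(\beta_1+\cdots+\beta_j)<-j$ for all $j\in\{1,\dots,l\}$. Then, with $\sigma=\sigma_1\otimes\cdots\otimes\sigma_k$ and $\tau=\tau_1\otimes\cdots\otimes\tau_l$, the stuffle relation $$\sum\nolimits^{\rm Chen}\sigma\star_\bullet\tau=\Big(\sum\nolimits^{\rm Chen}\sigma\Big)\Big(\sum\nolimits^{\rm Chen}\tau\Big)$$ holds, all the nested sums in it being convergent. Here $\bullet$ is the ordinary product of functions for the version $<$ and its opposite $v\bullet w=-vw$ for the version $\le$, and, writing $(v_1,\dots,v_{k+l})=(\sigma_1,\dots,\sigma_k,\tau_1,\dots,\tau_l)$, $\sigma\star_\bullet\tau=\sum_\pi w^\pi_1\otimes\cdots\otimes w^\pi_m$, the sum being over all $m$ and all surjections $\pi:\{1,\dots,k+l\}\to\{1,\dots,m\}$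 that are increasing on $\{1,\dots,k\}$ and on $\{k+1,\dots,k+l\}$, with $w^\pi_j$ the $\bullet$-product of the one or two $v_i$ with $\pi(i)=j$. -/

import Mathlib

open Filter Topology
open scoped ContDiff

noncomputable section

namespace NestedSums

/-! ### Positively supported classical symbols on the real line -/

/-- `σ` is a positively supported classical symbol in `P^{α,0}`: a smooth function on `ℝ` with
(closed) support in `]0,∞[` and `σ(ξ) ∼ ∑_j a_j ξ^(α-j)` as `ξ → +∞`, together with all its
derivatives. -/
structure IsClassicalSymbol (α : ℂ) (σ : ℝ → ℂ) : Prop where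
  smooth : ContDiff ℝ ∞ σ
  support_pos : tsupport σ ⊆ Set.Ioi 0
  expansion : ∃ a : ℕ → ℂ, ∀ J d : ℕ, ∃ C : ℝ, ∀ ξ : ℝ, 1 ≤ ξ →
    ‖iteratedDeriv d (fun x : ℝ => σ x - ∑ j ∈ Finset.range J, a j * (x : ℂ) ^ (α - j)) ξ‖
      ≤ C * ξ ^ (α.re - J - d)

/-- `f` is a simple holomorphic family, parametrised by `W`, of positively supported classical
symbols, with holomorphic order `α`.  The fields `hol` and `cont` say that `z ↦ f z` is holomorphic
with values in the Fréchet space `C^∞(ℝ)`; `expansion` says that the homogeneous components are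
holomorphic in `z` and that the remainders satisfy the symbol estimates locally uniformly in `z`
(the estimates for the `z`-derivatives of the remainders then follow from Cauchy's formula). -/
structure IsSimpleHolomorphicFamily (W : Set ℂ) (α : ℂ → ℂ) (f : ℂ → ℝ → ℂ) : Prop where
  order_hol : DifferentiableOn ℂ α W
  symbol : ∀ z ∈ W, IsClassicalSymbol (α z) (f z)
  hol : ∀ (d : ℕ) (ξ : ℝ), DifferentiableOn ℂ (fun z => iteratedDeriv d (f z) ξ) W
  cont : ∀ d : ℕ, ContinuousOn (fun p : ℂ × ℝ => iteratedDeriv d (f p.1) p.2) (W ×ˢ Set.univ)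
  expansion : ∃ a : ℕ → ℂ → ℂ, (∀ j, DifferentiableOn ℂ (a j) W) ∧
    ∀ (J d : ℕ) (K : Set ℂ), K ⊆ W → IsCompact K → ∃ C : ℝ, ∀ z ∈ K, ∀ ξ : ℝ, 1 ≤ ξ →
      ‖iteratedDeriv d
          (fun x : ℝ => f z x - ∑ j ∈ Finset.range J, a j z * (x : ℂ) ^ (α z - j)) ξ‖
        ≤ C * ξ ^ ((α z).re - J - d)

/-! ### Finite parts -/

/-- The sequence `u` has an asymptotic expansion, up to `o(1)`, in finitely many terms
`N^s (log N)^l`, in which the constant term (the coefficient of `N^0 (log N)^0`) is `c`. -/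
def IsFinitePart (u : ℕ → ℂ) (c : ℂ) : Prop :=
  ∃ (S : Finset (ℂ × ℕ)) (a : ℂ × ℕ → ℂ), (0, 0) ∉ S ∧
    Tendsto (fun N : ℕ =>
      u N - (c + ∑ p ∈ S, a p * ((N : ℂ) ^ p.1 * (Real.log N : ℂ) ^ p.2))) atTop (𝓝 0)

open Classical in
/-- The finite part `fp_{N → ∞} u(N)` (`0` if there is none). -/
def finitePart (u : ℕ → ℂ) : ℂ :=
  if h : ∃ c, IsFinitePart u c then h.choose else 0

/-- Near `z₀`, off `z₀`, `f` has a Laurent expansion with finite principal part and with constant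
term `c`. -/
def IsLaurentFinitePart (f : ℂ → ℂ) (z₀ c : ℂ) : Prop :=
  ∃ (n : ℕ) (b : ℕ → ℂ) (g : ℂ → ℂ), AnalyticAt ℂ g z₀ ∧ g z₀ = c ∧
    ∀ᶠ z in 𝓝[≠] z₀, f z = (∑ i ∈ Finset.range n, b i / (z - z₀) ^ (i + 1)) + g z

open Classical in
/-- The finite part `fp_{z = z₀} f(z)` of a meromorphic function (`0` if there is none). -/
def laurentFinitePart (f : ℂ → ℂ) (z₀ : ℂ) : ℂ :=
  if h : ∃ c, IsLaurentFinitePart f z₀ c then h.choose else 0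

/-! ### Nested sums -/

/-- The two versions of nested sums: with strict or with weak inequalities. -/
inductive Version
  | strict
  | weak

/-- `n_k < ⋯ < n_1`, respectively `n_k ≤ ⋯ ≤ n_1`.  (`n_i` is `n (i - 1)`.) -/
def Version.Chain {k : ℕ} : Version → (Fin k → ℕ) → Prop
  | .strict, n => StrictAnti n
  | .weak, n => Antitone n

/-- `v • w = ε v w`, where `ε = 1` in the strict version and `ε = -1` in the weak version. -/
def Version.sign : Version → ℂ
  | .strict => 1
  | .weak => -1

open Classical in
/-- The truncated nested sum of `σ_1 ⊗ ⋯ ⊗ σ_k`: the sum of `σ_1(n_1) ⋯ σ_k(n_k)` over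
`0 < n_k < ⋯ < n_1 ≤ N`, respectively `0 < n_k ≤ ⋯ ≤ n_1 ≤ N`. -/
def truncatedNestedSum (s : Version) {k : ℕ} (σ : Fin k → ℝ → ℂ) (N : ℕ) : ℂ :=
  ∑ n ∈ (Fintype.piFinset fun _ : Fin k => Finset.Icc 1 N).filter (fun n => s.Chain n),
    ∏ i, σ i (n i)

/-- The cut-off nested sum of `σ_1 ⊗ ⋯ ⊗ σ_k`. -/
def cutoffNestedSum (s : Version) {k : ℕ} (σ : Fin k → ℝ → ℂ) : ℂ :=
  finitePart (truncatedNestedSum s σ)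

/-- The regularised cut-off nested sum `fp_{z = 0}` of the cut-off nested sums of
`f_1(z) ⊗ ⋯ ⊗ f_k(z)`. -/
def regularisedNestedSum (s : Version) {k : ℕ} (f : Fin k → ℂ → ℝ → ℂ) : ℂ :=
  laurentFinitePart (fun z => cutoffNestedSum s (fun i => f i z)) 0

/-- Index set of the ordinary nested sums: `0 < n_k < ⋯ < n_1`, resp. `0 < n_k ≤ ⋯ ≤ n_1`. -/
def NestedIndex (s : Version) (k : ℕ) : Type :=
  {n : Fin k → ℕ // (∀ i, 0 < n i) ∧ s.Chain n}

/-- The ordinary nested sum. -/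
def nestedSum (s : Version) {k : ℕ} (σ : Fin k → ℝ → ℂ) : ℂ :=
  ∑' n : NestedIndex s k, ∏ i, σ i (n.1 i)

/-- The ordinary nested sum converges: absolutely, and as the limit of the truncated sums. -/
def NestedSumConverges (s : Version) {k : ℕ} (σ : Fin k → ℝ → ℂ) : Prop :=
  Summable (fun n : NestedIndex s k => ∏ i, σ i (n.1 i)) ∧
    Tendsto (truncatedNestedSum s σ) atTop (𝓝 (nestedSum s σ))

/-! ### Stuffle product -/

/-- A pure tensor `σ_1 ⊗ ⋯ ⊗ σ_m` of functions. -/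
abbrev PureTensor : Type := Σ m : ℕ, Fin m → ℝ → ℂ

open Classical in
/-- The `(k,l)`-quasi-shuffles with target of cardinality `m` (type `r = k + l - m`): surjections of
`{1, …, k + l}` onto `{1, …, m}` which are increasing on the first `k` and on the last `l`
elements. -/
def quasiShuffles (k l m : ℕ) : Finset (Fin k ⊕ Fin l → Fin m) :=
  Finset.univ.filter fun π => Function.Surjective π ∧
    StrictMono (fun i => π (Sum.inl i)) ∧ StrictMono (fun i => π (Sum.inr i))

open Classical in
/-- `w^π_j`, the `•`-product of the one or two factors `v_i` with `π(i) = j`. -/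
def stuffleWord (s : Version) {k l m : ℕ} (σ : Fin k → ℝ → ℂ) (τ : Fin l → ℝ → ℂ)
    (π : Fin k ⊕ Fin l → Fin m) : Fin m → ℝ → ℂ := fun j x =>
  s.sign ^ ((Finset.univ.filter fun i => π i = j).card - 1) *
    ∏ i ∈ Finset.univ.filter (fun i => π i = j), Sum.elim σ τ i x

/-- The stuffle product `(σ_1 ⊗ ⋯ ⊗ σ_k) ⋆_• (τ_1 ⊗ ⋯ ⊗ τ_l)`, as a formal linear combination of
pure tensors. -/
def stuffle (s : Version) {k l : ℕ} (σ : Fin k → ℝ → ℂ) (τ : Fin l → ℝ → ℂ) : PureTensor →₀ ℂ :=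
  ∑ m ∈ Finset.range (k + l + 1), ∑ π ∈ quasiShuffles k l m,
    Finsupp.single (⟨m, stuffleWord s σ τ π⟩ : PureTensor) 1

/-- Linear extension of the ordinary nested sum to linear combinations of pure tensors. -/
def nestedSumLinear (s : Version) (x : PureTensor →₀ ℂ) : ℂ :=
  x.sum fun w c => c * nestedSum s w.2

/-! ### Orders and polar hypersurfaces -/

/-- `α_1(z_1) + ⋯ + α_j(z_j)`.  (`Fin k` counts from `0`, so the `j`-th sum is the one indexed by `j - 1`.) -/
def partialOrderSum {k : ℕ} (α : Fin k → ℂ → ℂ) (j : Fin k) (z : Fin k → ℂ) : ℂ :=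
  ∑ i ∈ Finset.Iic j, α i (z i)

/-- The hypersurface `α_1(z_1) + ⋯ + α_j(z_j) = -j + m`. -/
def polarHypersurface {k : ℕ} (α : Fin k → ℂ → ℂ) (j : Fin k) (m : ℕ) : Set (Fin k → ℂ) :=
  {z | partialOrderSum α j z = -((j : ℂ) + 1) + m}

/-- The union of the hypersurfaces `α_1(z_1) + ⋯ + α_j(z_j) ∈ -j + ℕ`, `j = 1, …, k`. -/
def polarSet {k : ℕ} (α : Fin k → ℂ → ℂ) : Set (Fin k → ℂ) :=
  ⋃ (j : Fin k) (m : ℕ), polarHypersurface α j m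

/-- `G`, considered off the polar set, is meromorphic on `Ω` with poles on the hypersurfaces
`α_1(z_1) + ⋯ + α_j(z_j) ∈ -j + ℕ` of multiplicity at most `j`: the polar set has dense complement
in `Ω`, and near each `p ∈ Ω` the function `G` is, off the polar set, a quotient of a holomorphic
function by a product of powers, with exponents `e_j ≤ j`, of the equations of the hypersurfaces
through `p`. Where several hypersurfaces meet or coincide, the total multiplicity `∑ e_j` is at most
the largest `j` involved. -/
def IsMeromorphicWithPoles {k : ℕ} (α : Fin k → ℂ → ℂ) (Ω : Set (Fin k → ℂ))
    (G : (Fin k → ℂ) → ℂ) : Prop :=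
  Ω ⊆ closure (Ω \ polarSet α) ∧
  ∀ p ∈ Ω, ∃ e : Fin k → ℕ,
    (∀ j, e j ≤ (j : ℕ) + 1) ∧
    (∀ j, (∀ m : ℕ, p ∉ polarHypersurface α j m) → e j = 0) ∧
    (∀ M : ℕ, (∀ j, e j ≠ 0 → (j : ℕ) + 1 ≤ M) → ∑ j, e j ≤ M) ∧
    ∃ g : (Fin k → ℂ) → ℂ, AnalyticAt ℂ g p ∧
      ∀ᶠ z in 𝓝 p, z ∉ polarSet α →
        G z = g z / ∏ j, (partialOrderSum α j z - partialOrderSum α j p) ^ e j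

/-- `Re (α_1 + ⋯ + α_j) < -j` for every `j ∈ {1, …, k}`. -/
def ConvergentOrders {k : ℕ} (α : Fin k → ℂ) : Prop :=
  ∀ j : Fin k, (∑ i ∈ Finset.Iic j, α i).re < -((j : ℝ) + 1)

end NestedSums

end

open NestedSums

/-! The engine is discrete integration. Up to lower powers, n^β is the difference of n^(β+1)/(β+1).
Peeling off leading terms therefore turns a sequence u with an expansion in n^(β-j) into
differences, plus a remainder that decays fast enough to be summed from infinity. The result is a
regularised tail v with v(n) - v(n+1) = u(n+1) and an expansion in n^(β+1-j). It is holomorphic in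
the parameters while all β+1-m, m ∈ ℕ, stay away from 0. If a single one of them may vanish,
multiplying by it keeps the tail holomorphic (`exists_sum_of_nonresonant`,
`exists_sum_of_resonant`).

Iterating over the letters gives regularised tails r_j, which stand for the possibly divergent sums
over N < n_j < ⋯ < n_1 (with ≤ between the indices in the weak version). Sorting chains by the
number of indices exceeding N suggests that the sum over j of r_j(N) times the truncated sum of
σ_(j+1) ⊗ ⋯ ⊗ σ_k at N equals r_k(0). This identity follows from the difference equations alone
(`sum_tail_mul_nest`). Its term j = 0 is the truncated nested sum. The other terms expand in powers
with exponents α_1+⋯+α_i+i minus naturals, i ≥ 1. Off the polar hypersurfaces none of these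
exponents is 0, so these terms have no constant part and the finite part is r_k(0)
(`isFinitePart_nest`). Near a given point each j contributes at most one vanishing divisor, to the
first power. Hence the finite part is locally a holomorphic function over a product of such divisors
(`cutoffNestedSum_local`).

At resonant points finite parts still exist, because expansions with logarithms are stable under
products and summation (`LogExp.sum`, `logExp_nest`). They are unique by a dilation argument
(`eq_zero_of_tendsto_sum`). On the diagonal the condition on the derivatives makes each divisor
vanish to exactly first order. For convergent orders no hypersurface passes nearby, so the diagonal
function is analytic at 0 and its value there is the ordinary limit.

The stuffle relation holds already for truncated sums: a square is two triangles and a diagonal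
(`truncatedNestedSum_mul`). It passes to the limit because every word of the product converges again
(`nestedSumConverges_stuffleWord`). -/

noncomputable section

namespace NestedSums

/-! ### Holomorphic functions of several variables -/

open Metric Function in
/-- Cauchy's integral formula on a polydisc. -/
theorem torusIntegral_cauchy (n : ℕ) : ∀ (c : Fin n → ℂ) (R : ℝ) (f : (Fin n → ℂ) → ℂ), 0 < R →
    ContinuousOn f (closedBall c R) →
    (∀ i, ∀ w ∈ closedBall c R, DifferentiableOn ℂ (fun t => f (update w i t)) (ball (c i) R)) →
    ∀ z ∈ ball c R,
      (∯ ζ in T(c, fun _ => R), (∏ i, (ζ i - z i)⁻¹) • f ζ) = (2 * Real.pi * Complex.I) ^ n • f z := by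
  induction n with
  | zero =>
    intro c R f hR hc hd z hz
    simp [torusIntegral_dim0, Subsingleton.elim z c]
  | succ n ih =>
    intro c R f hR hc hd z hz
    have hsub : ∀ (x : ℂ) (y : Fin n → ℂ), x ∈ closedBall (c 0) R → y ∈ closedBall (c ∘ Fin.succ) R →
        (Fin.cons x y : Fin (n + 1) → ℂ) ∈ closedBall c R := by
      intro x y hx hy
      rw [mem_closedBall, dist_pi_le_iff hR.le] at hy ⊢
      intro i
      refine Fin.cases ?_ (fun i => ?_) i
      · simpa using hx
      · simpa using hy i
    have hz' : ∀ i, z i ∈ ball (c i) R := by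
      intro i
      rw [mem_ball, dist_pi_lt_iff hR] at hz
      exact hz i
    have htz : (z ∘ Fin.succ) ∈ ball (c ∘ Fin.succ) R := by
      rw [mem_ball, dist_pi_lt_iff hR]
      exact fun i => hz' i.succ
    have hmap : ∀ θ, torusMap c (fun _ => R) θ ∈ closedBall c R := by
      intro θ
      rw [mem_closedBall, dist_pi_le_iff hR.le]
      intro i
      simp [torusMap, dist_eq_norm, abs_of_pos hR]
    have hne : ∀ θ i, torusMap c (fun _ => R) θ i - z i ≠ 0 := by
      intro θ i h
      have h1 := hz' i
      rw [sub_eq_zero] at h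
      rw [← h, mem_ball, dist_eq_norm] at h1
      simp [torusMap, abs_of_pos hR] at h1
    have hmapc : Continuous (torusMap c fun _ => R) := by
      unfold torusMap; fun_prop
    have hint : TorusIntegrable (fun ζ => (∏ i, (ζ i - z i)⁻¹) • f ζ) c (fun _ => R) := by
      refine Continuous.integrableOn_Icc ?_
      have hp : Continuous fun θ => ∏ i, (torusMap c (fun _ => R) θ i - z i)⁻¹ :=
        continuous_finsetProd _ fun i _ =>
          Continuous.inv₀ (((continuous_apply i).comp hmapc).sub continuous_const)
            (fun θ => hne θ i)
      exact hp.smul (hc.comp_continuous hmapc hmap)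
    -- Fubini splits off the first circle. The induction hypothesis evaluates the other n circles,
    -- and the one-variable Cauchy formula the remaining one.
    rw [torusIntegral_succ hint]
    have hinner : ∀ x ∈ sphere (c 0) R,
        (∯ y in T(c ∘ Fin.succ, (fun _ => R) ∘ Fin.succ),
          (∏ i, ((Fin.cons x y : Fin (n + 1) → ℂ) i - z i)⁻¹) • f (Fin.cons x y)) =
        (2 * Real.pi * Complex.I) ^ n • ((x - z 0)⁻¹ • f (Fin.cons x (z ∘ Fin.succ))) := by
      intro x hx
      have hx' : x ∈ closedBall (c 0) R := sphere_subset_closedBall hx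
      have := ih (c ∘ Fin.succ) R (fun y => f (Fin.cons x y)) hR ?_ ?_ (z ∘ Fin.succ) htz
      · rw [smul_comm, ← this, ← torusIntegral_smul]
        congr 1
        funext y
        simp [Fin.prod_univ_succ]
        ring
      · refine hc.comp (Continuous.continuousOn ?_) (fun y hy => hsub x y hx' hy)
        exact Continuous.finCons continuous_const continuous_id
      · intro i w hw
        have := hd i.succ (Fin.cons x w) (hsub x w hx' hw)
        simpa [Fin.cons_update] using this
    rw [circleIntegral.integral_congr hR.le hinner, circleIntegral.integral_smul]
    have hcc : ContinuousOn (fun x => f (Fin.cons x (z ∘ Fin.succ))) (closedBall (c 0) R) := by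
      refine hc.comp (Continuous.continuousOn ?_)
        (fun y hy => hsub y _ hy (ball_subset_closedBall htz))
      exact Continuous.finCons continuous_id continuous_const
    have hdd : DifferentiableOn ℂ (fun x => f (Fin.cons x (z ∘ Fin.succ))) (ball (c 0) R) := by
      have := hd 0 z (ball_subset_closedBall hz)
      refine this.congr fun t _ => ?_
      congr 1
      funext i
      refine Fin.cases ?_ (fun i => ?_) i <;> simp
    have hcl : DiffContOnCl ℂ (fun x => f (Fin.cons x (z ∘ Fin.succ))) (ball (c 0) R) :=
      ⟨hdd, by rwa [closure_ball _ hR.ne']⟩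
    rw [hcl.circleIntegral_sub_inv_smul (hz' 0), pow_succ]
    have : (Fin.cons (z 0) (z ∘ Fin.succ) : Fin (n + 1) → ℂ) = z := by
      funext i
      refine Fin.cases ?_ (fun i => ?_) i <;> simp
    rw [this]
    simp only [smul_eq_mul]
    ring

open Metric Function in
/-- **Osgood's lemma**: a continuous, separately holomorphic function is analytic. -/
theorem analyticAt_of_separately {n : ℕ} {c : Fin n → ℂ} {R : ℝ} {f : (Fin n → ℂ) → ℂ} (hR : 0 < R)
    (hc : ContinuousOn f (closedBall c R))
    (hd : ∀ i, ∀ w ∈ closedBall c R,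
      DifferentiableOn ℂ (fun t => f (update w i t)) (ball (c i) R)) :
    AnalyticAt ℂ f c := by
  classical
  -- The kernel (ζ_i - z_i)⁻¹ is the inverse of an element, affine in z, of the Banach algebra of
  -- bounded continuous functions of the angles. Inversion is analytic near a unit, and integration
  -- against f is a continuous linear functional, so Cauchy's formula writes f as a composite of
  -- analytic maps.
  let e : Fin n → BoundedContinuousFunction (Fin n → ℝ) ℂ := fun i =>
    BoundedContinuousFunction.ofNormedAddCommGroup
      (fun θ => torusMap c (fun _ => R) θ i - c i) (by unfold torusMap; fun_prop) R
      (by intro θ; simp [torusMap, abs_of_pos hR])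
  let e' : Fin n → BoundedContinuousFunction (Fin n → ℝ) ℂ := fun i =>
    BoundedContinuousFunction.ofNormedAddCommGroup
      (fun θ => (torusMap c (fun _ => R) θ i - c i)⁻¹)
      (by
        refine Continuous.inv₀ (by unfold torusMap; fun_prop) fun θ h => ?_
        have : ‖torusMap c (fun _ => R) θ i - c i‖ = R := by simp [torusMap, abs_of_pos hR]
        rw [h, norm_zero] at this
        exact hR.ne this) R⁻¹
      (by intro θ; simp [torusMap, abs_of_pos hR])
  have hne : ∀ θ i, torusMap c (fun _ => R) θ i - c i ≠ 0 := by
    intro θ i h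
    have : ‖torusMap c (fun _ => R) θ i - c i‖ = R := by simp [torusMap, abs_of_pos hR]
    rw [h, norm_zero] at this
    exact hR.ne this
  let un : Fin n → (BoundedContinuousFunction (Fin n → ℝ) ℂ)ˣ := fun i =>
    ⟨e i, e' i, by ext θ; exact mul_inv_cancel₀ (hne θ i), by ext θ; exact inv_mul_cancel₀ (hne θ i)⟩
  let E : (Fin n → ℂ) → Fin n → BoundedContinuousFunction (Fin n → ℝ) ℂ :=
    fun z i => e i - (z i - c i) • (1 : BoundedContinuousFunction (Fin n → ℝ) ℂ)
  have hE : ∀ i, AnalyticAt ℂ (fun z => E z i) c := by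
    intro i
    have : AnalyticAt ℂ (fun z : Fin n → ℂ => z i) c :=
      (ContinuousLinearMap.proj (R := ℂ) (φ := fun _ : Fin n => ℂ) i).analyticAt c
    exact analyticAt_const.sub ((this.sub analyticAt_const).smul analyticAt_const)
  have hEc : ∀ i, E c i = un i := by intro i; simp [E, un]
  have hinv : ∀ i, AnalyticAt ℂ (fun z => Ring.inverse (E z i)) c := by
    intro i
    have h1 : AnalyticAt ℂ Ring.inverse (E c i) := by
      rw [hEc i]; exact analyticAt_inverse (un i)
    exact AnalyticAt.fun_comp (g := Ring.inverse) (f := fun z => E z i) h1 (hE i)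
  have hprod : AnalyticAt ℂ (fun z => ∏ i, Ring.inverse (E z i)) c :=
    Finset.analyticAt_fun_prod _ fun i _ => hinv i
  have hmap : ∀ θ, torusMap c (fun _ => R) θ ∈ closedBall c R := by
    intro θ
    rw [mem_closedBall, dist_pi_le_iff hR.le]
    intro i
    simp [torusMap, dist_eq_norm, abs_of_pos hR]
  have hmapc : Continuous (torusMap c fun _ => R) := by
    unfold torusMap; fun_prop
  have hfc : Continuous fun θ => f (torusMap c (fun _ => R) θ) := hc.comp_continuous hmapc hmap
  let m : (Fin n → ℝ) → ℂ := fun θ =>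
    (∏ i : Fin n, R * Complex.exp (θ i * Complex.I) * Complex.I : ℂ) * f (torusMap c (fun _ => R) θ)
  have hm : Continuous m := by
    refine Continuous.mul ?_ hfc
    fun_prop
  let S : Set (Fin n → ℝ) := Set.Icc (0 : Fin n → ℝ) fun _ => 2 * Real.pi
  obtain ⟨M, hM⟩ := (isCompact_Icc (a := (0 : Fin n → ℝ)) (b := fun _ => 2 * Real.pi)).exists_bound_of_continuousOn
    hm.continuousOn
  have hint : ∀ h : BoundedContinuousFunction (Fin n → ℝ) ℂ,
      MeasureTheory.IntegrableOn (fun θ => m θ * h θ) S := fun h =>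
    (hm.mul h.continuous).integrableOn_Icc
  let Φ : BoundedContinuousFunction (Fin n → ℝ) ℂ →ₗ[ℂ] ℂ :=
    { toFun := fun h => ∫ θ in S, m θ * h θ
      map_add' := by
        intro h1 h2
        rw [← MeasureTheory.integral_add (hint h1) (hint h2)]
        simp [mul_add]
      map_smul' := by
        intro a h
        simp only [BoundedContinuousFunction.coe_smul, smul_eq_mul, RingHom.id_apply]
        rw [← MeasureTheory.integral_const_mul]
        congr 1
        funext θ
        ring }
  let Ψ : BoundedContinuousFunction (Fin n → ℝ) ℂ →L[ℂ] ℂ :=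
    Φ.mkContinuous (|M| * MeasureTheory.volume.real S) (by
      intro h
      have := MeasureTheory.norm_setIntegral_le_of_norm_le_const (μ := MeasureTheory.volume) (s := S)
        (f := fun θ => m θ * h θ) (C := |M| * ‖h‖) isCompact_Icc.measure_lt_top (by
          intro θ hθ
          rw [norm_mul]
          exact mul_le_mul ((hM θ hθ).trans (le_abs_self M)) (h.norm_coe_le_norm θ)
            (norm_nonneg _) (abs_nonneg _))
      calc ‖Φ h‖ ≤ |M| * ‖h‖ * MeasureTheory.volume.real S := this
        _ = _ := by ring)
  have hΨ : AnalyticAt ℂ (fun z => ((2 * Real.pi * Complex.I) ^ n)⁻¹ *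
      Ψ (∏ i, Ring.inverse (E z i))) c :=
    analyticAt_const.mul (AnalyticAt.fun_comp (g := Ψ) (Ψ.analyticAt _) hprod)
  refine hΨ.congr ?_
  have hunit : ∀ᶠ z in 𝓝 c, ∀ i, IsUnit (E z i) := by
    rw [eventually_all]
    intro i
    have h1 : {x : BoundedContinuousFunction (Fin n → ℝ) ℂ | IsUnit x} ∈ 𝓝 (E c i) := by
      rw [hEc i]; exact Units.isOpen.mem_nhds (un i).isUnit
    exact (hE i).continuousAt h1
  filter_upwards [hunit, ball_mem_nhds c hR] with z hz hzb
  have hcau := torusIntegral_cauchy n c R f hR hc hd z hzb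
  have : Ψ (∏ i, Ring.inverse (E z i)) =
      ∯ ζ in T(c, fun _ => R), (∏ i, (ζ i - z i)⁻¹) • f ζ := by
    change (∫ θ in S, m θ * (∏ i, Ring.inverse (E z i)) θ) = _
    unfold torusIntegral
    refine MeasureTheory.integral_congr_ae (Filter.Eventually.of_forall fun θ => ?_)
    have hp : (∏ i, Ring.inverse (E z i)) θ = ∏ i, (torusMap c (fun _ => R) θ i - z i)⁻¹ := by
      have h1 : ∀ s : Finset (Fin n), (∏ i ∈ s, Ring.inverse (E z i)) θ =
          ∏ i ∈ s, (torusMap c (fun _ => R) θ i - z i)⁻¹ := by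
        intro s
        induction s using Finset.induction_on with
        | empty => simp
        | insert a s ha ihs =>
          rw [Finset.prod_insert ha, Finset.prod_insert ha, BoundedContinuousFunction.mul_apply, ihs]
          congr 1
          have h2 : (E z a) θ = torusMap c (fun _ => R) θ a - z a := by
            simp [E, e]
          have h3 : (E z a) θ * (Ring.inverse (E z a)) θ = 1 := by
            rw [← BoundedContinuousFunction.mul_apply, Ring.mul_inverse_cancel _ (hz a)]; rfl
          rw [← h2]
          exact eq_inv_of_mul_eq_one_right h3
      exact h1 _
    simp only [hp, m, smul_eq_mul]
    ring
  rw [this, hcau, smul_eq_mul]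
  rw [inv_mul_cancel_left₀]
  simp [Real.pi_ne_zero]

open Metric Function in
theorem differentiableOn_update {n : ℕ} {U : Set (Fin n → ℂ)} {f : (Fin n → ℂ) → ℂ}
    (hf : DifferentiableOn ℂ f U) (i : Fin n) (w : Fin n → ℂ) {V : Set ℂ}
    (hV : ∀ t ∈ V, update w i t ∈ U) : DifferentiableOn ℂ (fun t => f (update w i t)) V := by
  refine DifferentiableOn.comp (g := f) (f := fun t => update w i t) (t := U) hf ?_ hV
  exact fun t _ => (hasDerivAt_update w i t).differentiableAt.differentiableWithinAt

open Metric Function in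
theorem update_mem_ball {n : ℕ} {c w : Fin n → ℂ} {R : ℝ} (hR : 0 < R) (hw : w ∈ ball c R) {i : Fin n}
    {t : ℂ} (ht : t ∈ ball (c i) R) : update w i t ∈ ball c R := by
  rw [mem_ball, dist_pi_lt_iff hR] at hw ⊢
  intro j
  by_cases h : j = i
  · subst h; simpa using ht
  · simpa [h] using hw j

open Metric Function in
theorem analyticAt_of_differentiableOn {n : ℕ} {U : Set (Fin n → ℂ)} (hU : IsOpen U)
    {f : (Fin n → ℂ) → ℂ} (hf : DifferentiableOn ℂ f U) {c : Fin n → ℂ} (hcU : c ∈ U) :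
    AnalyticAt ℂ f c := by
  obtain ⟨R, hR, hRU⟩ := Metric.isOpen_iff.1 hU c hcU
  have hs : closedBall c (R / 2) ⊆ ball c R := closedBall_subset_ball (by linarith)
  refine analyticAt_of_separately (half_pos hR) (hf.continuousOn.mono (hs.trans hRU)) ?_
  intro i w hw
  refine differentiableOn_update hf i w fun t ht => hRU (update_mem_ball hR (hs hw) ?_)
  exact ball_subset_ball (by linarith) ht

-- Weierstrass' theorem in several variables: the uniform limit is continuous, and holomorphic in
-- each variable by the one-variable theorem, so Osgood's lemma applies.
open Metric Function in
theorem differentiableOn_of_tendstoUniformlyOn {n : ℕ} {U : Set (Fin n → ℂ)} (hU : IsOpen U)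
    {F : ℕ → (Fin n → ℂ) → ℂ} {f : (Fin n → ℂ) → ℂ} (hF : ∀ m, DifferentiableOn ℂ (F m) U)
    (h : TendstoUniformlyOn F f atTop U) : DifferentiableOn ℂ f U := by
  have hcont : ContinuousOn f U := h.continuousOn (Frequently.of_forall fun m => (hF m).continuousOn)
  intro c hcU
  refine (AnalyticAt.differentiableAt ?_).differentiableWithinAt
  obtain ⟨R, hR, hRU⟩ := Metric.isOpen_iff.1 hU c hcU
  have hs : closedBall c (R / 2) ⊆ ball c R := closedBall_subset_ball (by linarith)
  refine analyticAt_of_separately (half_pos hR) (hcont.mono (hs.trans hRU)) ?_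
  intro i w hw
  have hmem : ∀ t ∈ ball (c i) (R / 2), update w i t ∈ U := fun t ht =>
    hRU (update_mem_ball hR (hs hw) (ball_subset_ball (by linarith) ht))
  have h1 : TendstoUniformlyOn (fun m t => F m (update w i t)) (fun t => f (update w i t)) atTop
      (ball (c i) (R / 2)) := (h.comp (fun t => update w i t)).mono hmem
  exact h1.tendstoLocallyUniformlyOn.differentiableOn
    (Eventually.of_forall fun m => differentiableOn_update (hF m) i w hmem) isOpen_ball

/-! ### Powers of integers -/

/-- The power `n ^ t`, with the value `1` at `n = 0`. -/
def pw (t : ℂ) (n : ℕ) : ℂ := Complex.exp (t * (Real.log n : ℂ))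

/-- The real power `n ^ b`, with the value `1` at `n = 0`. -/
def epw (b : ℝ) (n : ℕ) : ℝ := Real.exp (b * Real.log n)

theorem pw_add (s t : ℂ) (n : ℕ) : pw (s + t) n = pw s n * pw t n := by
  simp [pw, add_mul, Complex.exp_add]

@[simp] theorem pw_zero (n : ℕ) : pw 0 n = 1 := by simp [pw]

@[simp] theorem pw_at_zero (t : ℂ) : pw t 0 = 1 := by simp [pw]

@[simp] theorem pw_at_one (t : ℂ) : pw t 1 = 1 := by simp [pw]

theorem pw_ne_zero (t : ℂ) (n : ℕ) : pw t n ≠ 0 := Complex.exp_ne_zero _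

theorem pw_eq_cpow (t : ℂ) {n : ℕ} (hn : n ≠ 0) : pw t n = (n : ℂ) ^ t := by
  rw [Complex.cpow_def_of_ne_zero (by exact_mod_cast hn), pw, Complex.natCast_log, mul_comm]

theorem pw_neg_natCast (i : ℕ) {n : ℕ} (hn : n ≠ 0) : pw (-(i : ℂ)) n = ((n : ℂ)⁻¹) ^ i := by
  rw [pw_eq_cpow _ hn, Complex.cpow_neg, Complex.cpow_natCast, inv_pow]

theorem norm_pw (t : ℂ) (n : ℕ) : ‖pw t n‖ = epw t.re n := by
  rw [pw, epw, Complex.norm_exp, Complex.re_mul_ofReal]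

theorem epw_pos (b : ℝ) (n : ℕ) : 0 < epw b n := Real.exp_pos _

theorem epw_add (a b : ℝ) (n : ℕ) : epw (a + b) n = epw a n * epw b n := by
  simp [epw, add_mul, Real.exp_add]

@[simp] theorem epw_zero (n : ℕ) : epw 0 n = 1 := by simp [epw]

@[simp] theorem epw_at_zero (b : ℝ) : epw b 0 = 1 := by simp [epw]

@[simp] theorem epw_at_one (b : ℝ) : epw b 1 = 1 := by simp [epw]

theorem epw_mono {a b : ℝ} (h : a ≤ b) (n : ℕ) : epw a n ≤ epw b n :=
  Real.exp_le_exp.2 (mul_le_mul_of_nonneg_right h (Real.log_natCast_nonneg n))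

theorem epw_eq_rpow (b : ℝ) {n : ℕ} (hn : n ≠ 0) : epw b n = (n : ℝ) ^ b := by
  rw [Real.rpow_def_of_pos (by positivity), epw, mul_comm]

theorem epw_neg_natCast (i : ℕ) {n : ℕ} (hn : n ≠ 0) : epw (-(i : ℝ)) n = ((n : ℝ)⁻¹) ^ i := by
  rw [epw_eq_rpow _ hn, Real.rpow_neg (by positivity), Real.rpow_natCast, inv_pow]

theorem epw_mono_right {b : ℝ} (hb : 0 ≤ b) {m n : ℕ} (h : m ≤ n) : epw b m ≤ epw b n := by
  refine Real.exp_le_exp.2 (mul_le_mul_of_nonneg_left ?_ hb)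
  rcases Nat.eq_zero_or_pos m with rfl | hm
  · simpa using Real.log_natCast_nonneg n
  · exact Real.log_le_log (by positivity) (by exact_mod_cast h)

theorem summable_epw {b : ℝ} (hb : b < -1) : Summable (epw b) := by
  have h := (Real.summable_nat_rpow (p := b)).2 hb
  rw [← summable_nat_add_iff 1] at h ⊢
  exact h.congr fun n => (epw_eq_rpow b (Nat.succ_ne_zero n)).symm

/-- Comparison of a power with the difference of powers of exponent one higher. -/
theorem epw_le_sub {b : ℝ} (hb : b < -1) (n : ℕ) (hn : n ≠ 0) :
    (-(b + 1)) * epw b (n + 1) ≤ epw (b + 1) n - epw (b + 1) (n + 1) := by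
  have hn0 : (0 : ℝ) < n := by positivity
  have h1 : epw (b + 1) n = epw (b + 1) (n + 1) *
      Real.exp ((b + 1) * (Real.log n - Real.log (n + 1 : ℕ))) := by
    simp only [epw, ← Real.exp_add]
    congr 1
    ring
  have h2 : Real.log n - Real.log (n + 1 : ℕ) ≤ -((n : ℝ) + 1)⁻¹ := by
    have : Real.log ((n : ℝ) / (n + 1 : ℕ)) ≤ (n : ℝ) / (n + 1 : ℕ) - 1 :=
      Real.log_le_sub_one_of_pos (by positivity)
    rw [Real.log_div (by positivity) (by positivity)] at this
    refine this.trans (le_of_eq ?_)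
    push_cast
    field_simp
    ring
  have h3 : 1 + (-(b + 1)) * ((n : ℝ) + 1)⁻¹ ≤
      Real.exp ((b + 1) * (Real.log n - Real.log (n + 1 : ℕ))) := by
    refine le_trans ?_ (Real.add_one_le_exp _)
    nlinarith
  have h4 : epw b (n + 1) = epw (b + 1) (n + 1) * ((n : ℝ) + 1)⁻¹ := by
    have : epw (-((1 : ℕ) : ℝ)) (n + 1) = ((n : ℝ) + 1)⁻¹ := by
      rw [epw_neg_natCast 1 (Nat.succ_ne_zero n)]; push_cast; simp
    rw [← this, ← epw_add]
    congr 1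
    push_cast
    ring
  rw [h1, h4]
  have := mul_le_mul_of_nonneg_left h3 (epw_pos (b + 1) (n + 1)).le
  linarith

/-- The differences in `epw_le_sub` telescope. The constant is explicit, hence uniform while b stays
away from -1. -/
theorem tsum_epw_tail_le {b : ℝ} (hb : b < -1) (n : ℕ) (hn : n ≠ 0) :
    ∑' m, epw b (n + 1 + m) ≤ epw (b + 1) n / (-(b + 1)) := by
  have hs : Summable fun m => epw b (n + 1 + m) := by
    simpa [add_comm] using (summable_nat_add_iff (n + 1)).2 (summable_epw hb)
  refine hs.tsum_le_of_sum_range_le fun M => ?_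
  rw [le_div_iff₀ (by linarith)]
  have key : (∑ m ∈ Finset.range M, epw b (n + 1 + m)) * (-(b + 1)) ≤
      epw (b + 1) n - epw (b + 1) (n + M) := by
    induction M with
    | zero => simp
    | succ M ih =>
      have h := epw_le_sub hb (n + M) (by omega)
      rw [Finset.sum_range_succ, add_mul]
      have e : n + 1 + M = n + M + 1 := by ring
      rw [e, ← add_assoc]
      linarith
  linarith [epw_pos (b + 1) (n + M)]

/-! ### Bounded holomorphic functions and uniform estimates -/

section

set_option linter.unusedSectionVars false

variable {E : Type*} [NormedAddCommGroup E] [NormedSpace ℂ E]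

/-- Bounded holomorphic functions on `U`. -/
def HolBdd (U : Set E) (a : E → ℂ) : Prop :=
  DifferentiableOn ℂ a U ∧ ∃ C : ℝ, ∀ z ∈ U, ‖a z‖ ≤ C

variable {U : Set E} {a b : E → ℂ}

theorem HolBdd.const (c : ℂ) : HolBdd U (fun _ => c) :=
  ⟨differentiableOn_const c, ‖c‖, fun _ _ => le_rfl⟩

theorem HolBdd.add (ha : HolBdd U a) (hb : HolBdd U b) : HolBdd U (fun z => a z + b z) := by
  obtain ⟨A, hA⟩ := ha.2
  obtain ⟨B, hB⟩ := hb.2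
  exact ⟨ha.1.add hb.1, A + B, fun z hz =>
    (norm_add_le _ _).trans (add_le_add (hA z hz) (hB z hz))⟩

theorem HolBdd.mul (ha : HolBdd U a) (hb : HolBdd U b) : HolBdd U (fun z => a z * b z) := by
  obtain ⟨A, hA⟩ := ha.2
  obtain ⟨B, hB⟩ := hb.2
  refine ⟨ha.1.mul hb.1, A * B, fun z hz => ?_⟩
  rw [norm_mul]
  exact mul_le_mul (hA z hz) (hB z hz) (norm_nonneg _) ((norm_nonneg _).trans (hA z hz))

theorem HolBdd.neg (ha : HolBdd U a) : HolBdd U (fun z => -a z) := by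
  simpa using (HolBdd.const (U := U) (-1)).mul ha

theorem HolBdd.sub (ha : HolBdd U a) (hb : HolBdd U b) : HolBdd U (fun z => a z - b z) := by
  simpa [sub_eq_add_neg] using ha.add hb.neg

theorem HolBdd.inv (ha : DifferentiableOn ℂ a U) {δ : ℝ} (hδ : 0 < δ) (h : ∀ z ∈ U, δ ≤ ‖a z‖) :
    HolBdd U (fun z => (a z)⁻¹) := by
  refine ⟨ha.inv fun z hz => norm_pos_iff.1 (hδ.trans_le (h z hz)), δ⁻¹, fun z hz => ?_⟩
  rw [norm_inv]
  exact inv_anti₀ hδ (h z hz)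

theorem HolBdd.sum {ι : Type*} {s : Finset ι} {a : ι → E → ℂ} (h : ∀ i ∈ s, HolBdd U (a i)) :
    HolBdd U (fun z => ∑ i ∈ s, a i z) := by
  classical
  induction s using Finset.induction_on with
  | empty => simpa using HolBdd.const (U := U) 0
  | insert i s hi ih =>
    simp only [Finset.sum_insert hi]
    exact (h i (by simp)).add (ih fun j hj => h j (by simp [hj]))

/-- `u z n = O(n ^ b z)`, uniformly for `z ∈ U`. -/
def UnifO (U : Set E) (b : E → ℝ) (u : E → ℕ → ℂ) : Prop :=
  ∃ C : ℝ, 0 ≤ C ∧ ∀ z ∈ U, ∀ n, ‖u z n‖ ≤ C * epw (b z) n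

variable {β γ : E → ℂ} {u v : E → ℕ → ℂ} {r s : E → ℝ}

theorem UnifO.mono (h : UnifO U r u) (hrs : ∀ z ∈ U, r z ≤ s z) : UnifO U s u := by
  obtain ⟨C, hC, h⟩ := h
  exact ⟨C, hC, fun z hz n => (h z hz n).trans
    (mul_le_mul_of_nonneg_left (epw_mono (hrs z hz) n) hC)⟩

theorem UnifO.add (hu : UnifO U r u) (hv : UnifO U r v) :
    UnifO U r (fun z n => u z n + v z n) := by
  obtain ⟨C, hC, hu⟩ := hu
  obtain ⟨D, hD, hv⟩ := hv
  refine ⟨C + D, add_nonneg hC hD, fun z hz n => (norm_add_le _ _).trans ?_⟩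
  rw [add_mul]
  exact add_le_add (hu z hz n) (hv z hz n)

theorem UnifO.mul (hu : UnifO U r u) (hv : UnifO U s v) :
    UnifO U (fun z => r z + s z) (fun z n => u z n * v z n) := by
  obtain ⟨C, hC, hu⟩ := hu
  obtain ⟨D, hD, hv⟩ := hv
  refine ⟨C * D, mul_nonneg hC hD, fun z hz n => ?_⟩
  rw [norm_mul, epw_add, mul_mul_mul_comm]
  exact mul_le_mul (hu z hz n) (hv z hz n) (norm_nonneg _) (mul_nonneg hC (epw_pos _ _).le)

theorem UnifO.pw_mul (ha : HolBdd U a) (β : E → ℂ) :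
    UnifO U (fun z => (β z).re) (fun z n => a z * pw (β z) n) := by
  obtain ⟨A, hA⟩ := ha.2
  refine ⟨|A|, abs_nonneg A, fun z hz n => ?_⟩
  rw [norm_mul, norm_pw]
  exact mul_le_mul_of_nonneg_right ((hA z hz).trans (le_abs_self A)) (epw_pos _ _).le

/-! ### Holomorphic families of sequences with asymptotic expansions -/

/-- `u z n` has an expansion `∑_{j < L} a_j(z) n ^ (β z - j) + O(n ^ (β z - L))`, with bounded
holomorphic coefficients, uniformly for `z ∈ U`. -/
def UnifExp (U : Set E) : ℕ → (E → ℂ) → (E → ℕ → ℂ) → Prop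
  | 0, β, u => (∀ n, DifferentiableOn ℂ (fun z => u z n) U) ∧ UnifO U (fun z => (β z).re) u
  | L + 1, β, u => (∀ n, DifferentiableOn ℂ (fun z => u z n) U) ∧ ∃ a, HolBdd U a ∧
      UnifExp U L (fun z => β z - 1) (fun z n => u z n - a z * pw (β z) n)

variable {L : ℕ}

theorem UnifExp.hol (h : UnifExp U L β u) (n : ℕ) : DifferentiableOn ℂ (fun z => u z n) U := by
  cases L with
  | zero => exact h.1 n
  | succ L => exact h.1 n

theorem UnifExp.congr (h : UnifExp U L β u) (huv : ∀ z ∈ U, ∀ n, v z n = u z n)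
    (hβ : ∀ z ∈ U, γ z = β z) : UnifExp U L γ v := by
  induction L generalizing β γ u v with
  | zero =>
    obtain ⟨h1, C, hC, h2⟩ := h
    refine ⟨fun n => (h1 n).congr fun z hz => huv z hz n, C, hC, fun z hz n => ?_⟩
    simp only [huv z hz n, hβ z hz]
    exact h2 z hz n
  | succ L ih =>
    obtain ⟨h1, a, ha, h2⟩ := h
    refine ⟨fun n => (h1 n).congr fun z hz => huv z hz n, a, ha, ih h2 ?_ ?_⟩
    · intro z hz n; rw [huv z hz n, hβ z hz]
    · intro z hz; rw [hβ z hz]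

theorem differentiableOn_pw (hβ : DifferentiableOn ℂ β U) (n : ℕ) :
    DifferentiableOn ℂ (fun z => pw (β z) n) U :=
  (hβ.mul_const _).cexp

theorem UnifExp.zero (β : E → ℂ) : UnifExp U L β (fun _ _ => 0) := by
  induction L generalizing β with
  | zero =>
    exact ⟨fun n => differentiableOn_const 0, 0, le_rfl, fun z _ n => by simp⟩
  | succ L ih =>
    refine ⟨fun n => differentiableOn_const 0, fun _ => 0, HolBdd.const 0, ?_⟩
    simpa using ih fun z => β z - 1

theorem UnifExp.add (hu : UnifExp U L β u) (hv : UnifExp U L β v) :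
    UnifExp U L β (fun z n => u z n + v z n) := by
  induction L generalizing β u v with
  | zero => exact ⟨fun n => (hu.1 n).add (hv.1 n), hu.2.add hv.2⟩
  | succ L ih =>
    obtain ⟨h1, a, ha, h2⟩ := hu
    obtain ⟨h3, b, hb, h4⟩ := hv
    refine ⟨fun n => (h1 n).add (h3 n), _, ha.add hb, (ih h2 h4).congr ?_ fun _ _ => rfl⟩
    intro z hz n
    ring

theorem UnifExp.pw_mul (hβ : DifferentiableOn ℂ β U) (ha : HolBdd U a) (hu : UnifExp U L γ u) :
    UnifExp U L (fun z => β z + γ z) (fun z n => a z * pw (β z) n * u z n) := by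
  have hhol : ∀ n, DifferentiableOn ℂ (fun z => a z * pw (β z) n * u z n) U := fun n =>
    (ha.1.mul (differentiableOn_pw hβ n)).mul (hu.hol n)
  induction L generalizing γ u with
  | zero => exact ⟨hhol, ((UnifO.pw_mul ha β).mul hu.2).mono fun z _ => le_of_eq (by simp)⟩
  | succ L ih =>
    obtain ⟨h1, b, hb, h2⟩ := hu
    refine ⟨hhol, _, ha.mul hb, (ih h2 fun n => ?_).congr ?_ ?_⟩
    · exact (ha.1.mul (differentiableOn_pw hβ n)).mul (h2.hol n)
    · intro z hz n
      rw [pw_add]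
      ring
    · intro z hz
      ring

theorem UnifExp.const_mul (ha : HolBdd U a) (hu : UnifExp U L γ u) :
    UnifExp U L γ (fun z n => a z * u z n) :=
  (UnifExp.pw_mul (differentiableOn_const 0) ha hu).congr (fun z _ n => by simp)
    (fun z _ => by simp)

theorem UnifExp.neg (hu : UnifExp U L β u) : UnifExp U L β (fun z n => -u z n) := by
  simpa using hu.const_mul (HolBdd.const (-1))

theorem UnifExp.sub (hu : UnifExp U L β u) (hv : UnifExp U L β v) :
    UnifExp U L β (fun z n => u z n - v z n) := by
  simpa [sub_eq_add_neg] using hu.add hv.neg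

theorem UnifExp.trunc (hu : UnifExp U (L + 1) β u) : UnifExp U L β u := by
  induction L generalizing β u with
  | zero =>
    obtain ⟨h1, a, ha, h2⟩ := hu
    refine ⟨h1, ?_⟩
    have h3 := (UnifO.pw_mul ha β).add (h2.2.mono (s := fun z => (β z).re) fun z _ => by simp)
    simpa using h3
  | succ L ih =>
    obtain ⟨h1, a, ha, h2⟩ := hu
    exact ⟨h1, a, ha, ih h2⟩

theorem UnifExp.bound (hu : UnifExp U L β u) : UnifO U (fun z => (β z).re) u := by
  induction L with
  | zero => exact hu.2
  | succ L ih => exact ih hu.trunc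

/-- A zero leading coefficient is prepended, so that terms of lower order can be added to an
expansion of order β + 1. -/
theorem UnifExp.raise (hu : UnifExp U L β u) : UnifExp U (L + 1) (fun z => β z + 1) u := by
  refine ⟨hu.hol, fun _ => 0, HolBdd.const 0, hu.congr ?_ ?_⟩
  · intro z hz n; simp
  · intro z hz; ring

theorem UnifExp.mul (hβ : DifferentiableOn ℂ β U) (hγ : DifferentiableOn ℂ γ U)
    (hu : UnifExp U L β u) (hv : UnifExp U L γ v) :
    UnifExp U L (fun z => β z + γ z) (fun z n => u z n * v z n) := by
  induction L generalizing β γ u v with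
  | zero =>
    exact ⟨fun n => (hu.1 n).mul (hv.1 n), (hu.2.mul hv.2).mono fun z _ => le_of_eq (by simp)⟩
  | succ L ih =>
    -- The product without its leading term is a n^β (v - b n^γ) + (u - a n^β) v. In the second
    -- product v is needed only to the length of the shortened first factor.
    have hv' := hv.trunc
    obtain ⟨h1, a, ha, h2⟩ := hu
    obtain ⟨h3, b, hb, h4⟩ := hv
    refine ⟨fun n => (h1 n).mul (h3 n), _, ha.mul hb, ?_⟩
    have h5 := (h4.pw_mul hβ ha).congr (γ := fun z => β z + γ z - 1) (fun _ _ _ => rfl)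
      (fun z _ => by ring)
    have h6 := (ih (hβ.sub_const 1) hγ h2 hv').congr (γ := fun z => β z + γ z - 1)
      (fun _ _ _ => rfl) (fun z _ => by ring)
    refine (h5.add h6).congr ?_ fun _ _ => rfl
    intro z hz n
    rw [pw_add]
    ring

theorem UnifExp.of_pw (hβ : DifferentiableOn ℂ β U) (ha : HolBdd U a) :
    UnifExp U L β (fun z n => a z * pw (β z) n) := by
  have hhol : ∀ n, DifferentiableOn ℂ (fun z => a z * pw (β z) n) U := fun n =>
    ha.1.mul (differentiableOn_pw hβ n)
  cases L with
  | zero => exact ⟨hhol, UnifO.pw_mul ha β⟩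
  | succ L =>
    refine ⟨hhol, a, ha, ?_⟩
    simpa using UnifExp.zero (U := U) (L := L) fun z => β z - 1

/-- The entrance for explicit estimates, such as symbol estimates and Taylor remainders, into the
recursive form of expansions. -/
theorem UnifExp.of_sum {a : ℕ → E → ℂ} (hβ : DifferentiableOn ℂ β U) (ha : ∀ j, HolBdd U (a j))
    (hu : ∀ n, DifferentiableOn ℂ (fun z => u z n) U)
    (h : UnifO U (fun z => (β z).re - L)
      (fun z n => u z n - ∑ j ∈ Finset.range L, a j z * pw (β z - j) n)) :
    UnifExp U L β u := by
  induction L generalizing β u a with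
  | zero => exact ⟨hu, by simpa using h⟩
  | succ L ih =>
    refine ⟨hu, a 0, ha 0, ih (a := fun j => a (j + 1)) (hβ.sub_const 1) (fun j => ha (j + 1))
      (fun n => (hu n).sub ((ha 0).1.mul (differentiableOn_pw hβ n))) ?_⟩
    obtain ⟨C, hC, h⟩ := h
    refine ⟨C, hC, fun z hz n => ?_⟩
    have := h z hz n
    simp only [Finset.sum_range_succ'] at this
    convert this using 2
    · simp only [Nat.cast_zero, sub_zero, Nat.cast_add, Nat.cast_one]
      rw [add_comm, ← sub_sub]
      congr 1
      refine Finset.sum_congr rfl fun j _ => ?_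
      congr 2
      ring
    · simp only [Complex.sub_re, Complex.one_re]
      congr 1
      push_cast
      ring

/-- At each parameter, the expansion is one by finitely many powers. -/
theorem UnifExp.exists_sum (h : UnifExp U L β u) {z : E} (hz : z ∈ U) :
    ∃ c : ℕ → ℂ, ∃ C : ℝ, ∀ n,
      ‖u z n - ∑ j ∈ Finset.range L, c j * pw (β z - j) n‖ ≤ C * epw ((β z).re - L) n := by
  induction L generalizing β u with
  | zero =>
    obtain ⟨C, _, h⟩ := h.2
    exact ⟨fun _ => 0, C, fun n => by simpa using h z hz n⟩
  | succ L ih =>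
    obtain ⟨_, a, _, h2⟩ := h
    obtain ⟨c, C, hc⟩ := ih h2
    refine ⟨fun j => Nat.casesOn j (a z) c, C, fun n => ?_⟩
    convert hc n using 2
    · rw [Finset.sum_range_succ', add_comm, ← sub_sub]
      simp only [Nat.cast_zero, sub_zero, Nat.cast_add, Nat.cast_one]
      congr 1
      refine Finset.sum_congr rfl fun j _ => ?_
      congr 2
      ring
    · simp only [Complex.sub_re, Complex.one_re]
      congr 1
      push_cast
      ring

end

/-! ### Differences of powers -/

/-- The coefficients of the expansion of `(1 - x) ^ t` in powers of `x`. -/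
def binomCoeff : ℕ → ℂ → ℂ
  | 0, _ => 1
  | i + 1, t => -t * binomCoeff i (t - 1) / (i + 1)

/-- Taylor's formula by induction on the length. The remainder of length L + 1 for t vanishes at 0,
and its derivative is -t times the remainder of length L for t - 1, which is the recursion defining
`binomCoeff`. The shift of t is the reason why B has to vary in the induction. -/
theorem norm_one_sub_pow_sub_le (L : ℕ) (B : ℝ) : ∃ C : ℝ, 0 ≤ C ∧ ∀ t : ℂ, ‖t‖ ≤ B →
    ∀ x ∈ Set.Icc (0 : ℝ) (1 / 2),
      ‖Complex.exp (t * (Real.log (1 - x) : ℂ)) -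
        ∑ i ∈ Finset.range L, binomCoeff i t * (x : ℂ) ^ i‖ ≤ C * x ^ L := by
  induction L generalizing B with
  | zero =>
    refine ⟨Real.exp (B * Real.log 2), (Real.exp_pos _).le, fun t ht x hx => ?_⟩
    have h1 : |Real.log (1 - x)| ≤ Real.log 2 := by
      have h2 : Real.log (1 - x) ≤ 0 := Real.log_nonpos (by linarith [hx.2]) (by linarith [hx.1])
      rw [abs_of_nonpos h2, ← Real.log_inv]
      refine Real.log_le_log (inv_pos.2 (by linarith [hx.2])) ?_
      rw [inv_le_comm₀ (by linarith [hx.2]) (by norm_num)]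
      linarith [hx.2]
    simp only [Finset.range_zero, Finset.sum_empty, sub_zero, pow_zero, mul_one]
    rw [Complex.norm_exp, Complex.re_mul_ofReal]
    refine Real.exp_le_exp.2 ((le_abs_self _).trans ?_)
    rw [abs_mul]
    exact mul_le_mul ((Complex.abs_re_le_norm t).trans ht) h1 (abs_nonneg _)
      ((norm_nonneg _).trans ht)
  | succ L ih =>
    obtain ⟨C, hC, h⟩ := ih (B + 1)
    refine ⟨|B| * C, by positivity, fun t ht x hx => ?_⟩
    have ht' : ‖t - 1‖ ≤ B + 1 := (norm_sub_le _ _).trans (by simpa using ht)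
    have hd : ∀ y ∈ Set.Icc (0 : ℝ) x, HasDerivWithinAt
        (fun y : ℝ => Complex.exp (t * (Real.log (1 - y) : ℂ)) -
          ∑ i ∈ Finset.range (L + 1), binomCoeff i t * (y : ℂ) ^ i)
        (-t * (Complex.exp ((t - 1) * (Real.log (1 - y) : ℂ)) -
          ∑ i ∈ Finset.range L, binomCoeff i (t - 1) * (y : ℂ) ^ i)) (Set.Icc 0 x) y := by
      intro y hy
      have hy1 : 0 < 1 - y := by linarith [hy.2, hx.2]
      have e1 : HasDerivAt (fun y : ℝ => Real.log (1 - y)) (-1 / (1 - y)) y :=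
        ((hasDerivAt_id y).const_sub 1).log hy1.ne'
      have e2 : HasDerivAt (fun y : ℝ => Complex.exp (t * (Real.log (1 - y) : ℂ)))
          (Complex.exp (t * (Real.log (1 - y) : ℂ)) * (t * ((-1 / (1 - y) : ℝ) : ℂ))) y :=
        (e1.ofReal_comp.const_mul t).cexp
      have e3 : HasDerivAt (fun y : ℝ => ∑ i ∈ Finset.range (L + 1), binomCoeff i t * (y : ℂ) ^ i)
          (∑ i ∈ Finset.range L, binomCoeff (i + 1) t * ((i + 1 : ℕ) * (y : ℂ) ^ i)) y := by
        simp only [Finset.sum_range_succ', pow_zero, mul_one]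
        refine HasDerivAt.add_const _ (HasDerivAt.fun_sum fun i _ => ?_)
        refine HasDerivAt.const_mul _ ?_
        have := (hasDerivAt_pow (i + 1) (y : ℂ)).comp_ofReal
        simpa using this
      have e4 := (e2.sub e3).hasDerivWithinAt (s := Set.Icc 0 x)
      refine e4.congr_deriv ?_
      have e5 : Complex.exp ((t - 1) * (Real.log (1 - y) : ℂ)) =
          Complex.exp (t * (Real.log (1 - y) : ℂ)) / ((1 - y : ℝ) : ℂ) := by
        rw [sub_mul, one_mul, Complex.exp_sub, ← Complex.ofReal_exp, Real.exp_log hy1]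
      rw [e5, mul_sub, Finset.mul_sum]
      congr 1
      · push_cast
        ring
      · refine Finset.sum_congr rfl fun i _ => ?_
        have : ((i : ℂ) + 1) ≠ 0 := by exact_mod_cast Nat.succ_ne_zero i
        simp only [binomCoeff]
        push_cast
        field_simp
    have hb : ∀ y ∈ Set.Ico (0 : ℝ) x, ‖-t * (Complex.exp ((t - 1) * (Real.log (1 - y) : ℂ)) -
          ∑ i ∈ Finset.range L, binomCoeff i (t - 1) * (y : ℂ) ^ i)‖ ≤ |B| * (C * x ^ L) := by
      intro y hy
      rw [norm_mul, norm_neg]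
      refine mul_le_mul (ht.trans (le_abs_self B)) ?_ (norm_nonneg _) (abs_nonneg _)
      refine (h (t - 1) ht' y ⟨hy.1, hy.2.le.trans hx.2⟩).trans ?_
      exact mul_le_mul_of_nonneg_left (pow_le_pow_left₀ hy.1 hy.2.le L) hC
    have := norm_image_sub_le_of_norm_deriv_le_segment' hd hb x ⟨hx.1, le_rfl⟩
    have h0 : Complex.exp (t * (Real.log (1 - 0) : ℂ)) -
          ∑ i ∈ Finset.range (L + 1), binomCoeff i t * ((0 : ℝ) : ℂ) ^ i = 0 := by
      simp [Finset.sum_range_succ', binomCoeff]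
    rw [h0, sub_zero, sub_zero] at this
    refine this.trans (le_of_eq ?_)
    ring

section

variable {E : Type*} [NormedAddCommGroup E] [NormedSpace ℂ E]
variable {U : Set E} {a β : E → ℂ} {u : E → ℕ → ℂ} {L : ℕ}

theorem HolBdd.binomCoeff (hβ : HolBdd U β) (i : ℕ) :
    HolBdd U (fun z => binomCoeff i (β z)) := by
  induction i generalizing β with
  | zero => exact HolBdd.const 1
  | succ i ih =>
    have := ((hβ.neg).mul (ih (hβ.sub (HolBdd.const 1)))).mul (HolBdd.const ((i : ℂ) + 1)⁻¹)
    simpa [NestedSums.binomCoeff, div_eq_mul_inv] using this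

theorem pw_pred (t : ℂ) {n : ℕ} (hn : 2 ≤ n) :
    pw t (n - 1) = pw t n * Complex.exp (t * (Real.log (1 - (n : ℝ)⁻¹) : ℂ)) := by
  have hn0 : (0 : ℝ) < n := by positivity
  have hn1 : (0 : ℝ) < (n - 1 : ℕ) := by
    have : 0 < n - 1 := by omega
    exact_mod_cast this
  rw [pw, pw, ← Complex.exp_add, ← mul_add, ← Complex.ofReal_add, ← Real.log_mul hn0.ne']
  · congr 4
    rw [Nat.cast_sub (by omega)]
    field_simp
    simp
  · rw [Nat.cast_sub (by omega)] at hn1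
    have : 1 - (n : ℝ)⁻¹ = (n - (1 : ℕ)) / n := by field_simp; simp
    rw [this]
    positivity

/-- This is the binomial expansion of (1 - x)^β at x = 1/n, with its terms of degree 0 and 1
removed. -/
theorem UnifExp.one_sub_ratio (hβ : HolBdd U β) :
    UnifExp U L (fun _ => -2)
      (fun z n => 1 - pw (β z) (n - 1) * pw (-β z) n - β z * pw (-1) n) := by
  have hd : ∀ n, HolBdd U (fun z => pw (β z) n) := by
    intro n
    refine ⟨differentiableOn_pw hβ.1 n, ?_⟩
    obtain ⟨B, hB⟩ := hβ.2
    refine ⟨epw B n, fun z hz => ?_⟩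
    rw [norm_pw]
    exact epw_mono ((Complex.re_le_norm _).trans (hB z hz)) n
  have hhol : ∀ n, DifferentiableOn ℂ
      (fun z => 1 - pw (β z) (n - 1) * pw (-β z) n - β z * pw (-1) n) U := fun n =>
    (((hd (n - 1)).1.mul (differentiableOn_pw hβ.neg.1 n)).const_sub 1).sub (hβ.1.mul_const _)
  have ha : ∀ j, HolBdd U (fun z => -binomCoeff (j + 2) (β z)) := fun j => (hβ.binomCoeff (j + 2)).neg
  refine UnifExp.of_sum (a := fun j z => -binomCoeff (j + 2) (β z)) (differentiableOn_const _) ha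
    hhol ?_
  obtain ⟨B, hB⟩ := hβ.2
  obtain ⟨C, hC, h⟩ := norm_one_sub_pow_sub_le (L + 2) B
  have hsmall : HolBdd U (fun z => 1 - 1 - β z - ∑ j ∈ Finset.range L, -binomCoeff (j + 2) (β z)) :=
    ((HolBdd.const (1 - 1)).sub hβ).sub (HolBdd.sum fun j _ => ha j)
  obtain ⟨D, hD⟩ := hsmall.2
  refine ⟨max C D, le_max_of_le_left hC, fun z hz n => ?_⟩
  -- For n = 0 and n = 1 the argument n - 1 is 0 and all powers have the value 1, so only the
  -- boundedness of the coefficients matters.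
  rcases Nat.lt_or_ge n 2 with hn | hn
  · have e : n - 1 = 0 := by omega
    have e1 : ∀ t, pw t n = 1 := by intro t; interval_cases n <;> simp
    have e2 : ∀ t, epw t n = 1 := by intro t; interval_cases n <;> simp
    simp only [e, e1, e2, pw_at_zero, mul_one]
    exact (hD z hz).trans (le_max_right _ _)
  · have hn0 : n ≠ 0 := by omega
    have hx : (n : ℝ)⁻¹ ∈ Set.Icc (0 : ℝ) (1 / 2) := by
      refine ⟨by positivity, ?_⟩
      rw [inv_le_comm₀ (by positivity) (by norm_num)]
      norm_num
      exact_mod_cast hn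
    have hr := h (β z) (hB z hz) _ hx
    have e1 : epw ((-2 : ℂ).re - L) n = ((n : ℝ)⁻¹) ^ (L + 2) := by
      rw [← epw_neg_natCast _ hn0]
      congr 1
      push_cast
      simp
      ring
    have e2 : ∀ j : ℕ, pw (-2 - j : ℂ) n = ((n : ℂ)⁻¹) ^ (j + 2) := by
      intro j
      rw [← pw_neg_natCast _ hn0]
      congr 1
      push_cast
      ring
    have e3 : pw (-1 : ℂ) n = (n : ℂ)⁻¹ := by
      have := pw_neg_natCast 1 hn0
      simpa using this
    rw [e1]
    refine le_trans (le_of_eq ?_) (hr.trans (mul_le_mul_of_nonneg_right (le_max_left _ _)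
      (by positivity)))
    rw [← norm_neg]
    congr 1
    simp only [pw_pred _ hn, Finset.sum_range_succ' _ (L + 1), Finset.sum_range_succ' _ L]
    have e4 : pw (β z) n * pw (-β z) n = 1 := by rw [← pw_add, add_neg_cancel, pw_zero]
    rw [mul_right_comm, e4, e3]
    simp only [e2, neg_mul, Finset.sum_neg_distrib, binomCoeff]
    push_cast
    simp
    ring

/-- The preceding expansion times n^β: the discrete counterpart of the derivative of a power, with
an error two orders below n^β. -/
theorem UnifExp.pw_diff (hβ : HolBdd U β) :
    UnifExp U L (fun z => β z - 2)
      (fun z n => pw (β z) n - pw (β z) (n - 1) - β z * pw (β z - 1) n) := by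
  refine ((UnifExp.one_sub_ratio hβ).pw_mul hβ.1 (HolBdd.const 1)).congr ?_ ?_
  · intro z _ n
    have e4 : pw (β z) n * pw (-β z) n = 1 := by rw [← pw_add, add_neg_cancel, pw_zero]
    rw [sub_eq_add_neg (β z) 1, pw_add]
    linear_combination pw (β z) (n - 1) * e4
  · intro z _
    ring

end

/-! ### Summation of families -/

section

variable {d : ℕ} {U : Set (Fin d → ℂ)} {β : (Fin d → ℂ) → ℂ} {u : (Fin d → ℂ) → ℕ → ℂ} {L : ℕ}

/-- The actual tail, the sum of u m over m > n, solves the difference equation. The margin c makes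
the series uniformly convergent in z, hence holomorphic, and bounds the constant of
`tsum_epw_tail_le` by 1/c. -/
theorem exists_tail (hU : IsOpen U) (hu : UnifExp U 0 β u) {c : ℝ} (hc : 0 < c)
    (hβ : ∀ z ∈ U, (β z).re ≤ -1 - c) :
    ∃ v, UnifExp U 0 (fun z => β z + 1) v ∧
      ∀ z ∈ U, ∀ n, v z n - v z (n + 1) = u z (n + 1) := by
  obtain ⟨hhol, C, hC, hb⟩ := hu
  have hsum : Summable (epw (-1 - c)) := summable_epw (by linarith)
  have hle : ∀ z ∈ U, ∀ m, ‖u z m‖ ≤ C * epw (-1 - c) m := fun z hz m =>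
    (hb z hz m).trans (mul_le_mul_of_nonneg_left (epw_mono (hβ z hz) m) hC)
  have hs : ∀ z ∈ U, ∀ n, Summable fun m => u z (n + 1 + m) := by
    intro z hz n
    have h1 : Summable (u z) := Summable.of_norm_bounded (hsum.mul_left C) (hle z hz)
    simpa [add_comm] using (summable_nat_add_iff (n + 1)).2 h1
  let v : (Fin d → ℂ) → ℕ → ℂ := fun z n => ∑' m, u z (n + 1 + m)
  have hrec : ∀ z ∈ U, ∀ n, v z n - v z (n + 1) = u z (n + 1) := by
    intro z hz n
    have := (hs z hz n).tsum_eq_zero_add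
    simp only [v]
    rw [this, add_zero, sub_eq_iff_eq_add, add_right_inj]
    refine tsum_congr fun m => ?_
    congr 1
    ring
  refine ⟨v, ⟨fun n => ?_, ?_⟩, hrec⟩
  · have hs2 : Summable fun m => C * epw (-1 - c) (n + 1 + m) := by
      have := (summable_nat_add_iff (n + 1)).2 (hsum.mul_left C)
      simpa [add_comm] using this
    have := tendstoUniformlyOn_tsum_nat (f := fun m z => u z (n + 1 + m)) hs2
      (s := U) fun m z hz => hle z hz (n + 1 + m)
    exact differentiableOn_of_tendstoUniformlyOn hU
      (fun N => DifferentiableOn.fun_sum fun m _ => hhol (n + 1 + m)) this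
  · have hpos : ∀ z ∈ U, ∀ n ≠ 0, ‖v z n‖ ≤ C / c * epw ((β z).re + 1) n := by
      intro z hz n hn
      have hz1 : (β z).re < -1 := by linarith [hβ z hz]
      have hs2 : Summable fun m => C * epw (β z).re (n + 1 + m) := by
        have := (summable_nat_add_iff (n + 1)).2 ((summable_epw hz1).mul_left C)
        simpa [add_comm] using this
      have h1 : ‖v z n‖ ≤ ∑' m, C * epw (β z).re (n + 1 + m) :=
        tsum_of_norm_bounded hs2.hasSum fun m => hb z hz (n + 1 + m)
      rw [tsum_mul_left] at h1
      refine h1.trans ?_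
      rw [div_mul_eq_mul_div, mul_div_assoc]
      refine mul_le_mul_of_nonneg_left ((tsum_epw_tail_le hz1 n hn).trans ?_) hC
      exact div_le_div_of_nonneg_left (epw_pos _ _).le hc (by linarith [hβ z hz])
    -- The tail estimate needs n ≠ 0. At n = 0 there is one more term, u z 1, which accounts for the
    -- summand C.
    refine ⟨C + C / c, by positivity, fun z hz n => ?_⟩
    rcases Nat.eq_zero_or_pos n with rfl | hn
    · have h1 : v z 0 = u z 1 + v z 1 := by rw [← hrec z hz 0]; ring
      rw [h1]
      have h2 := hb z hz 1
      have h3 := hpos z hz 1 one_ne_zero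
      simp only [epw_at_one, epw_at_zero, mul_one] at h2 h3 ⊢
      exact (norm_add_le _ _).trans (add_le_add h2 h3)
    · refine (hpos z hz n hn.ne').trans ?_
      simp only [Complex.add_re, Complex.one_re]
      exact mul_le_mul_of_nonneg_right (by linarith) (epw_pos _ _).le

/-- The step of the summation: the leading term `a n ^ β` is, up to lower order terms, the
difference of `b n ^ (β + 1)` if `b (β + 1) = a`. -/
theorem UnifExp.sub_diff {a b : (Fin d → ℂ) → ℂ} (hβ : HolBdd U β) (hb : HolBdd U b)
    (hab : ∀ z ∈ U, b z * (β z + 1) = a z)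
    (hu : UnifExp U L (fun z => β z - 1) (fun z n => u z n - a z * pw (β z) n)) :
    UnifExp U L (fun z => β z - 1)
      (fun z n => u z n - b z * (pw (β z + 1) n - pw (β z + 1) (n - 1))) := by
  have h1 := (UnifExp.pw_diff (L := L) (hβ.add (HolBdd.const 1))).const_mul hb
  refine (hu.sub (h1.congr (γ := fun z => β z - 1) (fun _ _ _ => rfl) fun z _ => by ring)).congr
    ?_ fun _ _ => rfl
  intro z hz n
  rw [← hab z hz]
  simp only [add_sub_cancel_right]
  ring

/-- Subtracting the difference of a n^(β+1)/(β+1) lowers the order by one. After L such steps the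
real part is at most -1 - c and `exists_tail` applies. The bound δ keeps the new coefficients
bounded, and passes to β - 1 with m + 1 in the role of m. -/
theorem exists_sum_of_nonresonant (hU : IsOpen U) (hβ : HolBdd U β) (hu : UnifExp U L β u)
    {c : ℝ} (hc : 0 < c) (hL : ∀ z ∈ U, (β z).re ≤ L - 1 - c) {δ : ℝ} (hδ : 0 < δ)
    (hres : ∀ z ∈ U, ∀ m : ℕ, δ ≤ ‖β z + 1 - m‖) :
    ∃ v, UnifExp U L (fun z => β z + 1) v ∧
      ∀ z ∈ U, ∀ n, v z n - v z (n + 1) = u z (n + 1) := by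
  induction L generalizing β u with
  | zero => exact exists_tail hU hu hc (by simpa using hL)
  | succ L ih =>
    obtain ⟨h1, a, ha, h2⟩ := hu
    have hβ1 : HolBdd U (fun z => β z + 1) := hβ.add (HolBdd.const 1)
    have hres0 : ∀ z ∈ U, δ ≤ ‖β z + 1‖ := fun z hz => by simpa using hres z hz 0
    have hb : HolBdd U (fun z => a z * (β z + 1)⁻¹) := ha.mul (HolBdd.inv hβ1.1 hδ hres0)
    have h3 := UnifExp.sub_diff hβ hb (fun z hz => by
      have : β z + 1 ≠ 0 := norm_pos_iff.1 (hδ.trans_le (hres0 z hz))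
      field_simp) h2
    obtain ⟨v, hv, hvr⟩ := ih (hβ.sub (HolBdd.const 1)) h3
      (fun z hz => by have := hL z hz; push_cast at this; simp; linarith)
      (fun z hz m => by
        have := hres z hz (m + 1)
        push_cast at this
        convert this using 2
        ring)
    refine ⟨fun z n => v z n - a z * (β z + 1)⁻¹ * pw (β z + 1) n, ⟨fun n => (hv.hol n).sub
      (hb.1.mul (differentiableOn_pw hβ1.1 n)), _, hb.neg, hv.congr ?_ ?_⟩, ?_⟩
    · intro z hz n
      ring
    · intro z hz
      ring
    · intro z hz n
      have := hvr z hz n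
      simp only [Nat.add_sub_cancel] at this
      linear_combination this

/-- Only the divisor β + 1 - J, met after J subtractions, may be small. Multiplying by it in advance
cancels that one division; all the others are by quantities bounded below. -/
theorem exists_sum_of_resonant (hU : IsOpen U) (hβ : HolBdd U β) (hu : UnifExp U L β u)
    {c : ℝ} (hc : 0 < c) (hL : ∀ z ∈ U, (β z).re ≤ L - 1 - c) {δ : ℝ} (hδ : 0 < δ) (J : ℕ)
    (hres : ∀ z ∈ U, ∀ m : ℕ, m ≠ J → δ ≤ ‖β z + 1 - m‖) :
    ∃ v, UnifExp U L (fun z => β z + 1) v ∧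
      ∀ z ∈ U, ∀ n, v z n - v z (n + 1) = (β z + 1 - J) * u z (n + 1) := by
  have hβ1 : HolBdd U (fun z => β z + 1) := hβ.add (HolBdd.const 1)
  have hH : HolBdd U (fun z => β z + 1 - J) := hβ1.sub (HolBdd.const _)
  induction L generalizing β u J with
  | zero => exact exists_tail hU (hu.const_mul hH) hc (by simpa using hL)
  | succ L ih =>
    obtain ⟨h1, a, ha, h2⟩ := hu
    have hL' : ∀ z ∈ U, (β z - 1).re ≤ L - 1 - c := fun z hz => by
      have := hL z hz; push_cast at this; simp; linarith
    rcases J with _ | J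
    -- The critical step: the prefactor is β + 1 itself, so the coefficient to subtract is a and
    -- nothing is divided. What remains is nonresonant.
    · have h3 := UnifExp.sub_diff (a := fun z => (β z + 1 - (0 : ℕ)) * a z)
        (u := fun z n => (β z + 1 - (0 : ℕ)) * u z n) hβ ha
        (fun z hz => by push_cast; ring)
        ((h2.const_mul hH).congr (fun z _ n => by ring) fun _ _ => rfl)
      obtain ⟨v, hv, hvr⟩ := exists_sum_of_nonresonant hU (hβ.sub (HolBdd.const 1)) h3 hc hL' hδ
        (fun z hz m => by
          have := hres z hz (m + 1) (Nat.succ_ne_zero m)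
          push_cast at this
          convert this using 2
          ring)
      refine ⟨fun z n => v z n - a z * pw (β z + 1) n, ⟨fun n => (hv.hol n).sub
        (ha.1.mul (differentiableOn_pw hβ1.1 n)), _, ha.neg, hv.congr ?_ ?_⟩, ?_⟩
      · intro z hz n
        ring
      · intro z hz
        ring
      · intro z hz n
        have := hvr z hz n
        simp only [Nat.add_sub_cancel] at this
        linear_combination this
    · have hres0 : ∀ z ∈ U, δ ≤ ‖β z + 1‖ := fun z hz => by
        simpa using hres z hz 0 (Nat.succ_ne_zero J).symm
      have hb : HolBdd U (fun z => a z * (β z + 1)⁻¹) := ha.mul (HolBdd.inv hβ1.1 hδ hres0)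
      have h3 := UnifExp.sub_diff hβ hb (fun z hz => by
        have : β z + 1 ≠ 0 := norm_pos_iff.1 (hδ.trans_le (hres0 z hz))
        field_simp) h2
      have hβ' := hβ.sub (HolBdd.const (U := U) 1)
      have hβ1' := hβ'.add (HolBdd.const (U := U) 1)
      obtain ⟨v, hv, hvr⟩ := ih hβ' h3 hL' J
        (fun z hz m hm => by
          have := hres z hz (m + 1) (by omega)
          push_cast at this
          convert this using 2
          ring) hβ1' (hβ1'.sub (HolBdd.const _))
      have hc' := hH.mul hb
      refine ⟨fun z n => v z n - (β z + 1 - (J + 1 : ℕ)) * (a z * (β z + 1)⁻¹) * pw (β z + 1) n,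
        ⟨fun n => (hv.hol n).sub (hc'.1.mul (differentiableOn_pw hβ1.1 n)), _, hc'.neg,
          hv.congr ?_ ?_⟩, ?_⟩
      · intro z hz n
        ring
      · intro z hz
        ring
      · intro z hz n
        have := hvr z hz n
        simp only [Nat.add_sub_cancel] at this
        push_cast
        linear_combination this

end

/-! ### Uniqueness of finite parts -/

open Polynomial in
theorem degree_taylor_sub_lt (a : ℂ) {P : ℂ[X]} (hP : P ≠ 0) :
    (taylor a P - P).degree < P.degree := by
  have h : (taylor a P).degree = P.degree := degree_taylor P a
  have h0 : taylor a P ≠ 0 := fun h0 => hP (by rw [h0, degree_zero] at h; exact degree_eq_bot.1 h.symm)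
  rw [← h]
  refine degree_sub_lt_left h h0 ?_
  rw [leadingCoeff_taylor]

/-- If n^s were 1 for all n ≥ 1, then exp (s x) would be 1 at the increments x = log (n + 2) - log
(n + 1). These are nonzero and tend to 0, whereas exp (s x) has derivative s ≠ 0 at 0. -/
theorem exists_pw_ne_one {s : ℂ} (hs : s ≠ 0) : ∃ q : ℕ, q ≠ 0 ∧ pw s q ≠ 1 := by
  by_contra! h
  have hd : HasDerivAt (fun x : ℝ => Complex.exp (s * x)) s 0 := by
    have h1 : HasDerivAt (fun x : ℂ => Complex.exp (s * x)) (Complex.exp (s * (0 : ℝ)) * (s * 1))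
        ((0 : ℝ) : ℂ) := ((hasDerivAt_id _).const_mul s).cexp
    simpa using h1.comp_ofReal
  have h1 : ∀ᶠ x : ℝ in 𝓝[≠] 0, Complex.exp (s * x) ≠ 1 := by
    simpa using hd.eventually_ne (c := 1) hs
  have h2 : Tendsto (fun n : ℕ => Real.log ((n : ℝ) + 1 + 1) - Real.log ((n : ℝ) + 1)) atTop
      (𝓝[≠] 0) := by
    rw [tendsto_nhdsWithin_iff]
    refine ⟨?_, Eventually.of_forall fun n => ?_⟩
    · have := (Real.tendsto_log_nat_add_one_sub_log).comp (tendsto_add_atTop_nat 1)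
      refine this.congr fun n => ?_
      simp
    · have : Real.log ((n : ℝ) + 1) < Real.log ((n : ℝ) + 1 + 1) :=
        Real.log_lt_log (by positivity) (by linarith)
      simp only [Set.mem_compl_iff, Set.mem_singleton_iff]
      linarith
  obtain ⟨n, hn⟩ := (h2.eventually h1).exists
  refine hn ?_
  have e1 := h (n + 1) (by omega)
  have e2 := h (n + 1 + 1) (by omega)
  simp only [pw] at e1 e2
  push_cast at e1 e2 ⊢
  rw [mul_sub, Complex.exp_sub, e1, e2, div_one]

open Polynomial in
theorem eq_zero_of_tendsto_eval_log {Q : ℂ[X]}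
    (h : Tendsto (fun N : ℕ => Q.eval (Real.log N : ℂ)) atTop (𝓝 0)) : Q = 0 := by
  have hlog : Tendsto (fun N : ℕ => ‖(Real.log N : ℂ)‖) atTop atTop := by
    simp only [Complex.norm_real]
    exact tendsto_norm_atTop_atTop.comp (Real.tendsto_log_atTop.comp tendsto_natCast_atTop_atTop)
  rcases lt_or_ge 0 Q.degree with hd | hd
  · exact absurd (Q.tendsto_norm_atTop hd hlog) (not_tendsto_atTop_of_tendsto_nhds h.norm)
  · rw [eq_C_of_degree_le_zero hd] at h ⊢
    simp only [eval_C] at h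
    rw [tendsto_nhds_unique tendsto_const_nhds h, C_0]

-- The dilation N ↦ qN turns N^s P_s(log N) into q^s N^s P_s(log N + log q). Subtracting q^s times
-- the original sum lowers the degree of P_s; once P_s is gone, the induction on the set of
-- exponents takes over. Meanwhile the coefficient of Q in its top degree is multiplied by 1 - q^s,
-- so Q is not lost when q^s ≠ 1. Growing, decaying and oscillating powers are treated alike.
open Polynomial in
theorem eq_zero_of_tendsto_sum (T : Finset ℂ) : (0 : ℂ) ∉ T → ∀ (P : ℂ → ℂ[X]) (Q : ℂ[X]),
    Tendsto (fun N : ℕ => Q.eval (Real.log N : ℂ) +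
      ∑ s ∈ T, pw s N * (P s).eval (Real.log N : ℂ)) atTop (𝓝 0) → Q = 0 := by
  classical
  induction T using Finset.induction_on with
  | empty =>
    intro _ P Q h
    exact eq_zero_of_tendsto_eval_log (by simpa using h)
  | insert s T hsT ih =>
    intro h0 P Q h
    have hs : s ≠ 0 := fun h => h0 (by simp [h])
    have hT : (0 : ℂ) ∉ T := fun h => h0 (by simp [h])
    obtain ⟨q, hq, hqs⟩ := exists_pw_ne_one hs
    suffices H : ∀ (d : ℕ) (P : ℂ → ℂ[X]) (Q : ℂ[X]), (P s).degree < d →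
        Tendsto (fun N : ℕ => Q.eval (Real.log N : ℂ) +
          ∑ s ∈ insert s T, pw s N * (P s).eval (Real.log N : ℂ)) atTop (𝓝 0) → Q = 0 by
      exact H ((P s).natDegree + 1) P Q
        (degree_le_natDegree.trans_lt (by exact_mod_cast Nat.lt_succ_self _)) h
    intro d
    induction d with
    | zero =>
      intro P Q hP h
      have : P s = 0 := by
        rw [← degree_eq_bot]
        exact Nat.WithBot.lt_zero_iff.1 (by exact_mod_cast hP)
      refine ih hT P Q ?_
      simpa [Finset.sum_insert hsT, this] using h
    | succ d ihd =>
      intro P Q hP h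
      set a : ℂ := (Real.log q : ℂ) with ha
      have h1 : Tendsto (fun N : ℕ => q * N) atTop atTop :=
        tendsto_id.const_mul_atTop' (Nat.pos_of_ne_zero hq)
      have h2 := (h.comp h1).sub (h.const_mul (pw s q))
      have key : Tendsto (fun N : ℕ => (taylor a Q - C (pw s q) * Q).eval (Real.log N : ℂ) +
          ∑ t ∈ insert s T, pw t N * (C (pw t q) * taylor a (P t) - C (pw s q) * P t).eval
            (Real.log N : ℂ)) atTop (𝓝 0) := by
        rw [mul_zero, sub_zero] at h2
        refine h2.congr' ?_
        filter_upwards [eventually_ne_atTop 0] with N hN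
        have hl : (Real.log (q * N : ℕ) : ℂ) = Real.log N + a := by
          rw [ha, ← Complex.ofReal_add, Nat.cast_mul,
            Real.log_mul (by positivity) (by positivity), add_comm]
        have hp : ∀ t, pw t (q * N) = pw t q * pw t N := by
          intro t
          rw [pw, hl, mul_add, Complex.exp_add, pw, pw, mul_comm]
        simp only [Function.comp_apply, hl, hp, eval_sub, eval_mul, eval_C, taylor_eval, mul_add,
          Finset.mul_sum, mul_sub]
        rw [add_sub_add_comm, ← Finset.sum_sub_distrib]
        congr 1
        refine Finset.sum_congr rfl fun t _ => ?_
        ring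
      have hdeg : (C (pw s q) * taylor a (P s) - C (pw s q) * P s).degree < d := by
        rw [← mul_sub, degree_C_mul (pw_ne_zero s q)]
        by_cases hPs : P s = 0
        · simp [hPs]
        · refine (degree_taylor_sub_lt a hPs).trans_le ?_
          rw [degree_eq_natDegree hPs] at hP ⊢
          exact_mod_cast Nat.lt_succ_iff.1 (by exact_mod_cast hP)
      have hQ := ihd _ _ hdeg key
      by_contra hQ0
      have hc : (taylor a Q - C (pw s q) * Q).coeff Q.natDegree = 0 := by rw [hQ, coeff_zero]
      rw [coeff_sub, coeff_C_mul] at hc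
      have h3 : (taylor a Q).coeff Q.natDegree = Q.leadingCoeff := by
        conv_lhs => rw [← natDegree_taylor Q a]
        exact leadingCoeff_taylor a Q
      rw [h3, coeff_natDegree, ← one_sub_mul] at hc
      rcases mul_eq_zero.1 hc with h4 | h4
      · exact hqs (sub_eq_zero.1 h4).symm
      · exact hQ0 (leadingCoeff_eq_zero.1 h4)

/-! ### Expansions with logarithms -/

/-- The sequence `n ^ s (log n) ^ l`. -/
def logTerm (p : ℂ × ℕ) : ℕ → ℂ := fun n => pw p.1 n * (Real.log n : ℂ) ^ p.2

/-- The span of the sequences `n ^ s (log n) ^ l` with `(s, l) ∈ A`. -/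
def logSpan (A : Set (ℂ × ℕ)) : Submodule ℂ (ℕ → ℂ) := Submodule.span ℂ (logTerm '' A)

theorem logTerm_mem {A : Set (ℂ × ℕ)} {p : ℂ × ℕ} (h : p ∈ A) : logTerm p ∈ logSpan A :=
  Submodule.subset_span ⟨p, h, rfl⟩

theorem logSpan_mono {A B : Set (ℂ × ℕ)} (h : A ⊆ B) : logSpan A ≤ logSpan B :=
  Submodule.span_mono (Set.image_mono h)

@[simp] theorem logTerm_zero : logTerm (0, 0) = 1 := by
  funext n
  simp [logTerm]

-- The logarithms at each exponent s are collected into one polynomial P s. Exclusion of (0, 0) says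
-- that P 0 has no constant term, so c is the constant term of c + P 0, which vanishes.
open Polynomial in
theorem eq_zero_of_tendsto_logSpan {w : ℕ → ℂ} (hw : w ∈ logSpan {(0, 0)}ᶜ) {c : ℂ}
    (h : Tendsto (fun N => c + w N) atTop (𝓝 0)) : c = 0 := by
  classical
  have H : ∃ P : ℂ →₀ ℂ[X], (P 0).coeff 0 = 0 ∧
      ∀ N : ℕ, w N = P.sum fun s p => pw s N * p.eval (Real.log N : ℂ) := by
    clear h
    refine Submodule.span_induction ?_ ?_ ?_ ?_ hw
    · rintro _ ⟨⟨s, l⟩, hp, rfl⟩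
      refine ⟨Finsupp.single s (X ^ l), ?_, fun N => ?_⟩
      · rw [Finsupp.single_apply]
        split_ifs with hs
        · have hl : l ≠ 0 := fun hl => hp (by simp [hs, hl])
          simp [coeff_X_pow, hl.symm]
        · simp
      · rw [Finsupp.sum_single_index (by simp)]
        simp [logTerm]
    · exact ⟨0, by simp, fun N => by simp⟩
    · rintro x y _ _ ⟨P, hP, hx⟩ ⟨Q, hQ, hy⟩
      refine ⟨P + Q, by simp [hP, hQ], fun N => ?_⟩
      rw [Finsupp.sum_add_index' (by simp) (by intro s p q; simp [mul_add]), ← hx, ← hy,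
        Pi.add_apply]
    · rintro a x _ ⟨P, hP, hx⟩
      refine ⟨a • P, by simp [hP], fun N => ?_⟩
      rw [Finsupp.sum_smul_index' (by simp), Pi.smul_apply, hx, Finsupp.smul_sum]
      refine Finsupp.sum_congr fun s _ => ?_
      simp
      ring
  obtain ⟨P, hP, hw⟩ := H
  have h1 := eq_zero_of_tendsto_sum (P.support.erase 0) (by simp) P (C c + P 0) (by
    refine h.congr fun N => ?_
    rw [hw, Finsupp.sum, eval_add, eval_C, add_assoc]
    congr 1
    by_cases h0 : (0 : ℂ) ∈ P.support
    · rw [← Finset.add_sum_erase _ _ h0]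
      simp
    · rw [Finset.erase_eq_of_notMem h0, Finsupp.notMem_support_iff.1 h0]
      simp)
  have h2 : (C c + P 0).coeff 0 = 0 := by rw [h1, coeff_zero]
  simpa [hP] using h2

/-- Membership in a span makes sums and scalar multiples immediate. The two conventions for powers
can differ only at N = 0, which the limit does not see. -/
theorem isFinitePart_iff {u : ℕ → ℂ} {c : ℂ} : IsFinitePart u c ↔
    ∃ w ∈ logSpan {(0, 0)}ᶜ, Tendsto (fun N => u N - (c + w N)) atTop (𝓝 0) := by
  have hterm : ∀ (p : ℂ × ℕ) (N : ℕ), N ≠ 0 →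
      (N : ℂ) ^ p.1 * (Real.log N : ℂ) ^ p.2 = logTerm p N := by
    intro p N hN
    rw [logTerm, pw_eq_cpow _ hN]
  constructor
  · rintro ⟨S, a, hS, h⟩
    refine ⟨∑ p ∈ S, a p • logTerm p, Submodule.sum_mem _ fun p hp =>
      Submodule.smul_mem _ _ (logTerm_mem fun h0 => hS (h0 ▸ hp)), h.congr' ?_⟩
    filter_upwards [eventually_ne_atTop 0] with N hN
    simp only [Finset.sum_apply, Pi.smul_apply, smul_eq_mul, hterm _ N hN]
  · rintro ⟨w, hw, h⟩
    rw [logSpan, Finsupp.mem_span_image_iff_linearCombination] at hw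
    obtain ⟨a, ha, rfl⟩ := hw
    refine ⟨a.support, a, fun h0 => ?_, h.congr' ?_⟩
    · exact (Finsupp.mem_supported ℂ a).1 ha h0 rfl
    · filter_upwards [eventually_ne_atTop 0] with N hN
      simp only [hterm _ N hN, Finsupp.linearCombination_apply, Finsupp.sum, Finset.sum_apply,
        Pi.smul_apply, smul_eq_mul]

theorem IsFinitePart.unique {u : ℕ → ℂ} {c d : ℂ} (hc : IsFinitePart u c) (hd : IsFinitePart u d) :
    c = d := by
  obtain ⟨w, hw, h1⟩ := isFinitePart_iff.1 hc
  obtain ⟨w', hw', h2⟩ := isFinitePart_iff.1 hd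
  refine sub_eq_zero.1 (eq_zero_of_tendsto_logSpan (Submodule.sub_mem _ hw hw') ?_)
  have := h2.sub h1
  rw [sub_zero] at this
  refine this.congr fun N => ?_
  simp only [Pi.sub_apply]
  ring

theorem IsFinitePart.finitePart_eq {u : ℕ → ℂ} {c : ℂ} (h : IsFinitePart u c) :
    finitePart u = c := by
  have hex : ∃ c, IsFinitePart u c := ⟨c, h⟩
  rw [finitePart, dif_pos hex]
  exact hex.choose_spec.unique h

theorem isFinitePart_of_tendsto {u : ℕ → ℂ} {c : ℂ} (h : Tendsto u atTop (𝓝 c)) :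
    IsFinitePart u c :=
  ⟨∅, 0, by simp, by simpa using h.sub_const c⟩

/-- `‖u n‖ = O(n ^ b)`. -/
def PowO (b : ℝ) (u : ℕ → ℂ) : Prop := ∃ C : ℝ, 0 ≤ C ∧ ∀ n, ‖u n‖ ≤ C * epw b n

section

variable {a b : ℝ} {u v : ℕ → ℂ}

theorem PowO.of_le {C : ℝ} (h : ∀ n, ‖u n‖ ≤ C * epw b n) : PowO b u :=
  ⟨|C|, abs_nonneg C, fun n => (h n).trans
    (mul_le_mul_of_nonneg_right (le_abs_self C) (epw_pos b n).le)⟩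

theorem PowO.mono (h : PowO a u) (hab : a ≤ b) : PowO b u := by
  obtain ⟨C, hC, h⟩ := h
  exact ⟨C, hC, fun n => (h n).trans (mul_le_mul_of_nonneg_left (epw_mono hab n) hC)⟩

theorem PowO.add (hu : PowO b u) (hv : PowO b v) : PowO b (u + v) := by
  obtain ⟨C, hC, hu⟩ := hu
  obtain ⟨D, hD, hv⟩ := hv
  refine ⟨C + D, add_nonneg hC hD, fun n => (norm_add_le _ _).trans ?_⟩
  rw [add_mul]
  exact add_le_add (hu n) (hv n)

theorem PowO.mul (hu : PowO a u) (hv : PowO b v) : PowO (a + b) (u * v) := by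
  obtain ⟨C, hC, hu⟩ := hu
  obtain ⟨D, hD, hv⟩ := hv
  refine ⟨C * D, mul_nonneg hC hD, fun n => ?_⟩
  rw [Pi.mul_apply, norm_mul, epw_add, mul_mul_mul_comm]
  exact mul_le_mul (hu n) (hv n) (norm_nonneg _) (mul_nonneg hC (epw_pos _ _).le)

theorem PowO.smul (c : ℂ) (hu : PowO b u) : PowO b (c • u) := by
  obtain ⟨C, hC, hu⟩ := hu
  refine ⟨‖c‖ * C, by positivity, fun n => ?_⟩
  rw [Pi.smul_apply, norm_smul, mul_assoc]
  exact mul_le_mul_of_nonneg_left (hu n) (norm_nonneg _)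

theorem PowO.zero : PowO b 0 := ⟨0, le_rfl, fun n => by simp⟩

theorem tendsto_epw_neg (hb : b < 0) : Tendsto (epw b) atTop (𝓝 0) := by
  refine Real.tendsto_exp_atBot.comp ?_
  exact (Real.tendsto_log_atTop.comp tendsto_natCast_atTop_atTop).const_mul_atTop_of_neg hb

theorem PowO.tendsto_zero (hb : b < 0) (h : PowO b u) : Tendsto u atTop (𝓝 0) := by
  obtain ⟨C, _, h⟩ := h
  exact squeeze_zero_norm h (by simpa using (tendsto_epw_neg hb).const_mul C)

end

theorem log_pow_le (l : ℕ) {ε : ℝ} (hε : 0 < ε) :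
    ∃ C : ℝ, 0 ≤ C ∧ ∀ n : ℕ, Real.log n ^ l ≤ C * epw ε n := by
  refine ⟨l.factorial / ε ^ l, by positivity, fun n => ?_⟩
  have h := Real.pow_div_factorial_le_exp (ε * Real.log n)
    (mul_nonneg hε.le (Real.log_natCast_nonneg n)) l
  rw [mul_pow] at h
  rw [epw]
  rw [div_le_iff₀ (by positivity)] at h
  rw [div_mul_eq_mul_div, le_div_iff₀ (by positivity)]
  linarith

theorem powO_logTerm (p : ℂ × ℕ) {b : ℝ} (hb : p.1.re < b) : PowO b (logTerm p) := by
  obtain ⟨C, hC, h⟩ := log_pow_le p.2 (sub_pos.2 hb)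
  refine ⟨C, hC, fun n => ?_⟩
  rw [logTerm, norm_mul, norm_pw, norm_pow, Complex.norm_real, Real.norm_eq_abs,
    abs_of_nonneg (Real.log_natCast_nonneg n)]
  calc epw p.1.re n * Real.log n ^ p.2 ≤ epw p.1.re n * (C * epw (b - p.1.re) n) :=
        mul_le_mul_of_nonneg_left (h n) (epw_pos _ _).le
    _ = C * epw (p.1.re + (b - p.1.re)) n := by rw [epw_add]; ring
    _ = C * epw b n := by rw [add_sub_cancel]

theorem exists_powO_of_mem_logSpan {A : Set (ℂ × ℕ)} {w : ℕ → ℂ} (hw : w ∈ logSpan A) :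
    ∃ G : ℕ, PowO G w := by
  refine Submodule.span_induction ?_ ?_ ?_ ?_ hw
  · rintro _ ⟨p, _, rfl⟩
    obtain ⟨G, hG⟩ := exists_nat_gt p.1.re
    exact ⟨G, powO_logTerm p hG⟩
  · exact ⟨0, PowO.zero⟩
  · rintro x y _ _ ⟨G, hG⟩ ⟨H, hH⟩
    refine ⟨max G H, PowO.add (hG.mono ?_) (hH.mono ?_)⟩
    · exact_mod_cast le_max_left G H
    · exact_mod_cast le_max_right G H
  · rintro c x _ ⟨G, hG⟩
    exact ⟨G, hG.smul c⟩

/-- `u` has an asymptotic expansion in the terms `n ^ s (log n) ^ l` with `s ∈ A`. -/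
def LogExp (A : Set ℂ) (u : ℕ → ℂ) : Prop :=
  ∀ K : ℕ, ∃ w ∈ logSpan (A ×ˢ Set.univ), PowO (-(K : ℝ)) (u - w)

section

variable {A B D : Set ℂ} {u v : ℕ → ℂ}

theorem LogExp.mono (h : LogExp A u) (hAB : A ⊆ B) : LogExp B u := fun K => by
  obtain ⟨w, hw, h⟩ := h K
  exact ⟨w, logSpan_mono (Set.prod_mono_left hAB) hw, h⟩

theorem LogExp.of_mem (h : u ∈ logSpan (A ×ˢ Set.univ)) : LogExp A u := fun K =>
  ⟨u, h, by simpa using PowO.zero⟩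

theorem LogExp.logTerm {s : ℂ} (h : s ∈ A) (l : ℕ) : LogExp A (logTerm (s, l)) :=
  LogExp.of_mem (logTerm_mem ⟨h, trivial⟩)

theorem LogExp.add (hu : LogExp A u) (hv : LogExp A v) : LogExp A (u + v) := fun K => by
  obtain ⟨w, hw, h⟩ := hu K
  obtain ⟨w', hw', h'⟩ := hv K
  refine ⟨w + w', Submodule.add_mem _ hw hw', ?_⟩
  rw [add_sub_add_comm]
  exact h.add h'

theorem LogExp.smul (c : ℂ) (hu : LogExp A u) : LogExp A (c • u) := fun K => by
  obtain ⟨w, hw, h⟩ := hu K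
  refine ⟨c • w, Submodule.smul_mem _ c hw, ?_⟩
  rw [← smul_sub]
  exact h.smul c

theorem LogExp.neg (hu : LogExp A u) : LogExp A (-u) := by simpa using hu.smul (-1)

theorem LogExp.sub (hu : LogExp A u) (hv : LogExp A v) : LogExp A (u - v) := by
  simpa [sub_eq_add_neg] using hu.add hv.neg

theorem LogExp.exists_powO (hu : LogExp A u) : ∃ G : ℕ, PowO G u := by
  obtain ⟨w, hw, h⟩ := hu 0
  obtain ⟨G, hG⟩ := exists_powO_of_mem_logSpan hw
  refine ⟨G, ?_⟩
  have := (h.mono (b := (G : ℝ)) (by simp)).add hG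
  simpa using this

open Pointwise in
theorem mul_mem_logSpan {A B D : Set (ℂ × ℕ)} {w w' : ℕ → ℂ}
    (hw : w ∈ logSpan A) (hw' : w' ∈ logSpan B) (h : ∀ p ∈ A, ∀ q ∈ B, p + q ∈ D) :
    w * w' ∈ logSpan D := by
  have h1 := Submodule.mul_mem_mul hw hw'
  rw [logSpan, logSpan, Submodule.span_mul_span] at h1
  refine Submodule.span_mono ?_ h1
  rintro _ ⟨_, ⟨p, hp, rfl⟩, _, ⟨q, hq, rfl⟩, rfl⟩
  refine ⟨p + q, h p hp q hq, ?_⟩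
  funext n
  simp only [NestedSums.logTerm, Prod.fst_add, Prod.snd_add, pw_add, pow_add, Pi.mul_apply]
  ring

theorem LogExp.mul (hu : LogExp A u) (hv : LogExp B v) (h : ∀ s ∈ A, ∀ t ∈ B, s + t ∈ D) :
    LogExp D (u * v) := fun K => by
  -- The error is u (v - w') + (u - w) w'. The order of choices matters: w' has to beat the growth
  -- of u, and then w the growth of w'.
  obtain ⟨G, hG⟩ := hu.exists_powO
  obtain ⟨w', hw', h1⟩ := hv (K + G)
  obtain ⟨G', hG'⟩ := exists_powO_of_mem_logSpan hw'
  obtain ⟨w, hw, h2⟩ := hu (K + G')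
  refine ⟨w * w', mul_mem_logSpan hw hw' fun p hp q hq => ⟨h _ hp.1 _ hq.1, trivial⟩, ?_⟩
  have e : u * v - w * w' = u * (v - w') + (u - w) * w' := by ring
  rw [e]
  refine PowO.add ((hG.mul h1).mono (le_of_eq ?_)) ((h2.mul hG').mono (le_of_eq ?_))
  · push_cast; ring
  · push_cast; ring

theorem LogExp.isFinitePart_zero (hu : LogExp A u) (h0 : (0 : ℂ) ∉ A) : IsFinitePart u 0 := by
  obtain ⟨w, hw, h⟩ := hu 1
  refine isFinitePart_iff.2 ⟨w, logSpan_mono ?_ hw, ?_⟩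
  · rintro p hp rfl
    exact h0 hp.1
  · simpa [Pi.sub_def] using h.tendsto_zero (by simp)

theorem LogExp.exists_isFinitePart (hu : LogExp A u) : ∃ c, IsFinitePart u c := by
  obtain ⟨w, hw, h⟩ := hu 1
  have h1 : ∃ c : ℂ, ∃ w' ∈ logSpan {(0, 0)}ᶜ, w = c • 1 + w' := by
    refine Submodule.span_induction ?_ ?_ ?_ ?_ hw
    · rintro _ ⟨p, _, rfl⟩
      by_cases hp : p = (0, 0)
      · exact ⟨1, 0, Submodule.zero_mem _, by simp [hp]⟩
      · exact ⟨0, _, logTerm_mem hp, by simp⟩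
    · exact ⟨0, 0, Submodule.zero_mem _, by simp⟩
    · rintro x y _ _ ⟨c, w, hw, rfl⟩ ⟨d, w', hw', rfl⟩
      exact ⟨c + d, w + w', Submodule.add_mem _ hw hw', by rw [add_smul]; abel⟩
    · rintro a x _ ⟨c, w, hw, rfl⟩
      exact ⟨a * c, a • w, Submodule.smul_mem _ a hw, by rw [smul_add, smul_smul]⟩
  obtain ⟨c, w', hw', rfl⟩ := h1
  refine ⟨c, isFinitePart_iff.2 ⟨w', hw', ?_⟩⟩
  simpa [Pi.sub_def, Pi.add_def] using h.tendsto_zero (by simp)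

/-- The exponents `s, s - 1, s - 2, …`. -/
def down (s : ℂ) : Set ℂ := {t | ∃ q : ℕ, t = s - q}

theorem self_mem_down (s : ℂ) : s ∈ down s := ⟨0, by simp⟩

theorem down_sub_natCast_subset (s : ℂ) (q : ℕ) : down (s - q) ⊆ down s := by
  rintro _ ⟨r, rfl⟩
  exact ⟨q + r, by push_cast; ring⟩

theorem add_mem_down {s t x y : ℂ} (hx : x ∈ down s) (hy : y ∈ down t) : x + y ∈ down (s + t) := by
  obtain ⟨q, rfl⟩ := hx
  obtain ⟨r, rfl⟩ := hy
  exact ⟨q + r, by push_cast; ring⟩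

theorem LogExp.of_unifExp {E : Type*} [NormedAddCommGroup E] [NormedSpace ℂ E] {U : Set E}
    {β : E → ℂ} {u : E → ℕ → ℂ} {z : E} (hz : z ∈ U) (h : ∀ L, UnifExp U L β u) :
    LogExp (down (β z)) (u z) := fun K => by
  obtain ⟨L, hL⟩ := exists_nat_ge ((β z).re + K)
  obtain ⟨c, C, hc⟩ := (h L).exists_sum hz
  refine ⟨∑ j ∈ Finset.range L, c j • NestedSums.logTerm (β z - j, 0),
    Submodule.sum_mem _ fun j _ => Submodule.smul_mem _ _ (logTerm_mem ⟨⟨j, rfl⟩, trivial⟩), ?_⟩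
  refine (PowO.of_le (C := C) (b := (β z).re - L) fun n => ?_).mono (by linarith)
  simpa [NestedSums.logTerm, Finset.sum_apply] using hc n

/-! ### Differences of terms with logarithms -/

theorem logExp_pw_diff (s : ℂ) : LogExp (down (s - 2))
    (fun n => pw s n - pw s (n - 1) - s * pw (s - 1) n) :=
  LogExp.of_unifExp (U := Set.univ) (z := (0 : ℂ)) (β := fun _ => s - 2)
    (u := fun _ n => pw s n - pw s (n - 1) - s * pw (s - 1) n) trivial
    fun _ => UnifExp.pw_diff (HolBdd.const s)

/-- The power series of log (1 - x) at x = 1/n, whose first term is cancelled by `pw (-1) n`. -/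
theorem logExp_log_diff : LogExp (down (-2))
    (fun n => (Real.log (n - 1 : ℕ) : ℂ) - Real.log n + pw (-1) n) := by
  refine LogExp.of_unifExp (U := Set.univ) (z := (0 : ℂ)) (β := fun _ => -2)
    (u := fun _ n => (Real.log (n - 1 : ℕ) : ℂ) - Real.log n + pw (-1) n) trivial fun L => ?_
  refine UnifExp.of_sum (a := fun j _ => -((j : ℂ) + 2)⁻¹) (differentiableOn_const _)
    (fun j => HolBdd.const _) (fun n => differentiableOn_const _) ?_
  set D : ℝ := ‖(1 : ℂ) - ∑ j ∈ Finset.range L, -((j : ℂ) + 2)⁻¹‖ with hD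
  refine ⟨max 2 D, by positivity, fun z _ n => ?_⟩
  rcases Nat.lt_or_ge n 2 with hn | hn
  · have e : n - 1 = 0 := by omega
    have e0 : Real.log n = 0 := by interval_cases n <;> simp
    have e1 : ∀ t, pw t n = 1 := by intro t; interval_cases n <;> simp
    have e2 : ∀ t, epw t n = 1 := by intro t; interval_cases n <;> simp
    simp only [e, e0, e1, e2, mul_one]
    refine le_trans (le_of_eq ?_) (le_max_right _ _)
    rw [hD]
    simp
  · have hn0 : n ≠ 0 := by omega
    have hnpos : (0 : ℝ) < n := by positivity
    have hx : (n : ℝ)⁻¹ ≤ 1 / 2 := by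
      rw [inv_le_comm₀ (by positivity) (by norm_num)]
      norm_num
      exact_mod_cast hn
    have hx0 : 0 < (n : ℝ)⁻¹ := by positivity
    have habs : |(n : ℝ)⁻¹| < 1 := by rw [abs_of_pos hx0]; linarith
    have h := Real.abs_log_sub_add_sum_range_le habs (L + 1)
    have e1 : epw ((-2 : ℂ).re - L) n = ((n : ℝ)⁻¹) ^ (L + 2) := by
      rw [← epw_neg_natCast _ hn0]
      congr 1
      push_cast
      simp
      ring
    have e2 : ∀ j : ℕ, pw (-2 - j : ℂ) n = ((n : ℂ)⁻¹) ^ (j + 2) := by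
      intro j
      rw [← pw_neg_natCast _ hn0]
      congr 1
      push_cast
      ring
    have e3 : pw (-1 : ℂ) n = (n : ℂ)⁻¹ := by simpa using pw_neg_natCast 1 hn0
    have e4 : Real.log (1 - (n : ℝ)⁻¹) = Real.log (n - 1 : ℕ) - Real.log n := by
      have hn1 : (0 : ℝ) < (n - 1 : ℕ) := by
        have : 0 < n - 1 := by omega
        exact_mod_cast this
      rw [← Real.log_div hn1.ne' hnpos.ne', Nat.cast_sub (by omega)]
      congr 1
      field_simp
      simp
    rw [e1]
    calc _ = |∑ i ∈ Finset.range (L + 1), (n : ℝ)⁻¹ ^ (i + 1) / (i + 1) +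
          Real.log (1 - (n : ℝ)⁻¹)| := by
          rw [← Real.norm_eq_abs, ← Complex.norm_real]
          congr 1
          simp only [e2, e3, e4, Finset.sum_range_succ' _ L, neg_mul, Finset.sum_neg_distrib]
          have e5 : ∀ x : ℕ, ((n : ℂ)⁻¹) ^ (x + 1 + 1) / ((x : ℂ) + 1 + 1) =
              ((x : ℂ) + 2)⁻¹ * ((n : ℂ)⁻¹) ^ (x + 2) := by
            intro x
            rw [div_eq_inv_mul]
            congr 2
            ring
          push_cast
          simp only [e5]
          simp
          ring
      _ ≤ |(n : ℝ)⁻¹| ^ (L + 1 + 1) / (1 - |(n : ℝ)⁻¹|) := h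
      _ ≤ 2 * (n : ℝ)⁻¹ ^ (L + 2) := by
          rw [abs_of_pos hx0, div_le_iff₀ (by linarith)]
          have : 0 ≤ (n : ℝ)⁻¹ ^ (L + 2) := by positivity
          nlinarith
      _ ≤ _ := mul_le_mul_of_nonneg_right (le_max_left _ _) (by positivity)

/-- The discrete derivative of n^s (log n)^l, by induction on l: the shifted term is multiplied by
log (n - 1), which is log n - 1/n up to order -2. The truncated l - 1 at l = 0 is harmless, as its
factor l vanishes. -/
theorem logExp_logTerm_diff (s : ℂ) (l : ℕ) : LogExp (down (s - 2))
    (fun n => logTerm (s, l) (n - 1) - logTerm (s, l) n + s * logTerm (s - 1, l) n +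
      l * logTerm (s - 1, l - 1) n) := by
  have hs1 : s - 1 ∈ down s := ⟨1, by simp⟩
  induction l with
  | zero =>
    refine (logExp_pw_diff s).neg.mono subset_rfl |> fun h => ?_
    convert h using 1
    funext n
    simp [NestedSums.logTerm]
    ring
  | succ l ih =>
    set ρ : ℕ → ℂ := fun n => NestedSums.logTerm (s, l) (n - 1) - NestedSums.logTerm (s, l) n +
      s * NestedSums.logTerm (s - 1, l) n + l * NestedSums.logTerm (s - 1, l - 1) n with hρ
    set lam : ℕ → ℂ := fun n => (Real.log (n - 1 : ℕ) : ℂ) - Real.log n + pw (-1) n with hlam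
    set T : ℂ × ℕ → ℕ → ℂ := NestedSums.logTerm with hT
    have hsub : down (s - 2) ⊆ down s := by simpa using down_sub_natCast_subset s 2
    have hg : LogExp (down s) (ρ + T (s, l) - s • T (s - 1, l) - (l : ℂ) • T (s - 1, l - 1)) :=
      (((ih.mono hsub).add (LogExp.logTerm (self_mem_down s) l)).sub
        ((LogExp.logTerm hs1 l).smul s)).sub ((LogExp.logTerm hs1 (l - 1)).smul (l : ℂ))
    have h1 : LogExp (down (s - 2)) (ρ * T (0, 1)) :=
      ih.mul (LogExp.logTerm (Set.mem_singleton (0 : ℂ)) 1) (by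
        rintro x hx y rfl; simpa using hx)
    have hm1 : LogExp ({(-1 : ℂ)} : Set ℂ) (T (-1, 0)) := LogExp.logTerm (Set.mem_singleton _) 0
    have h2 : LogExp (down (s - 2)) (T (-1, 0) * ρ) :=
      hm1.mul ih (by
        rintro x rfl y ⟨q, rfl⟩
        exact ⟨q + 1, by push_cast; ring⟩)
    have h3 : LogExp (down (s - 2)) (T (-1, 0) * (s • T (s - 1, l) + (l : ℂ) • T (s - 1, l - 1))) :=
      hm1.mul (((LogExp.logTerm (Set.mem_singleton (s - 1)) l).smul s).add
        ((LogExp.logTerm (Set.mem_singleton (s - 1)) (l - 1)).smul (l : ℂ))) (by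
          rintro x rfl y rfl
          exact ⟨0, by simp; ring⟩)
    have h4 : LogExp (down (s - 2)) ((ρ + T (s, l) - s • T (s - 1, l) -
        (l : ℂ) • T (s - 1, l - 1)) * lam) :=
      hg.mul logExp_log_diff fun x hx y hy => by
        simpa [sub_eq_add_neg] using add_mem_down hx hy
    -- The shifted term for l is ρ + T(s,l) - s T(s-1,l) - l T(s-1,l-1), and log (n - 1) is log n -
    -- 1/n + `lam`. Multiplying out and removing the main terms for l + 1 leaves exactly these four
    -- pieces.
    have h5 := ((h1.sub h2).add h3).add h4
    convert h5 using 1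
    funext n
    have e1 : T (s, l) n * T (-1, 0) n = T (s - 1, l) n := by
      simp only [hT, NestedSums.logTerm, sub_eq_add_neg s 1, pw_add]; ring
    have e2 : T (s, l) n * (Real.log n : ℂ) = T (s, l + 1) n := by
      simp only [hT, NestedSums.logTerm, pow_succ]; ring
    have e3 : T (s - 1, l) n * (Real.log n : ℂ) = T (s - 1, l + 1) n := by
      simp only [hT, NestedSums.logTerm, pow_succ]; ring
    have e4 : (l : ℂ) * T (s - 1, l - 1) n * (Real.log n : ℂ) = l * T (s - 1, l) n := by
      rcases l with _ | l
      · simp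
      · simp only [hT, NestedSums.logTerm, pow_succ, Nat.add_sub_cancel]; ring
    have e5 : T (s, l + 1) (n - 1) = T (s, l) (n - 1) * (Real.log (n - 1 : ℕ) : ℂ) := by
      simp only [hT, NestedSums.logTerm, pow_succ]; ring
    have e6 : T (0, 1) n = Real.log n := by simp [hT, NestedSums.logTerm]
    have e7 : T (-1, 0) n = pw (-1) n := by simp [hT, NestedSums.logTerm]
    have e8 : ρ n = T (s, l) (n - 1) - T (s, l) n + s * T (s - 1, l) n + l * T (s - 1, l - 1) n := rfl
    have e9 : lam n = (Real.log (n - 1 : ℕ) : ℂ) - Real.log n + pw (-1) n := rfl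
    simp only [Pi.add_apply, Pi.sub_apply, Pi.mul_apply, Pi.smul_apply, smul_eq_mul, e6, e7, e8, e9,
      Nat.add_sub_cancel, e5, Nat.cast_add, Nat.cast_one]
    rw [e7] at e1
    linear_combination e2 - s * e3 - e4 - e1

end

/-! ### Summation of expansions with logarithms -/

/-- Up to `O(n ^ (-K))`, the sequence `u` is the difference of a combination of terms
`n ^ s (log n) ^ l` with `s ∈ A`. -/
def HasPrim (A : Set ℂ) (K : ℕ) (u : ℕ → ℂ) : Prop :=
  ∃ v ∈ logSpan (A ×ˢ Set.univ), PowO (-(K : ℝ)) (fun n => u n - (v n - v (n - 1)))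

section

variable {A B : Set ℂ} {K : ℕ} {u v : ℕ → ℂ}

theorem HasPrim.mono (h : HasPrim A K u) (hAB : A ⊆ B) : HasPrim B K u := by
  obtain ⟨w, hw, h⟩ := h
  exact ⟨w, logSpan_mono (Set.prod_mono_left hAB) hw, h⟩

theorem HasPrim.of_powO (h : PowO (-(K : ℝ)) u) : HasPrim A K u :=
  ⟨0, Submodule.zero_mem _, by simpa using h⟩

theorem HasPrim.add (hu : HasPrim A K u) (hv : HasPrim A K v) : HasPrim A K (u + v) := by
  obtain ⟨w, hw, h⟩ := hu
  obtain ⟨w', hw', h'⟩ := hv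
  refine ⟨w + w', Submodule.add_mem _ hw hw', ?_⟩
  convert h.add h' using 1
  funext n
  simp only [Pi.add_apply]
  ring

theorem HasPrim.smul (c : ℂ) (hu : HasPrim A K u) : HasPrim A K (c • u) := by
  obtain ⟨w, hw, h⟩ := hu
  refine ⟨c • w, Submodule.smul_mem _ c hw, ?_⟩
  convert h.smul c using 1
  funext n
  simp only [Pi.smul_apply, smul_eq_mul]
  ring

theorem hasPrim_of_mem_logSpan {w : ℕ → ℂ} (hw : w ∈ logSpan (A ×ˢ Set.univ))
    (h : ∀ s ∈ A, ∀ l, HasPrim B K (logTerm (s, l))) : HasPrim B K w := by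
  refine Submodule.span_induction ?_ ?_ ?_ ?_ hw
  · rintro _ ⟨p, hp, rfl⟩
    exact h p.1 hp.1 p.2
  · exact HasPrim.of_powO PowO.zero
  · rintro x y _ _ hx hy
    exact hx.add hy
  · rintro c x _ hx
    exact hx.smul c

theorem hasPrim_diff (h : v ∈ logSpan (A ×ˢ Set.univ)) :
    HasPrim A K (fun n => v n - v (n - 1)) :=
  ⟨v, h, by simpa using show PowO _ (fun _ => 0) from PowO.zero (b := -(K : ℝ))⟩

/-- The difference formula for n^(s+1) (log n)^l is solved for n^s (log n)^l. Induction on D pushes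
the errors, whose exponents are lower, below n^(-K); induction on l removes the term with one
logarithm less. For s = -1 the factor s + 1 vanishes and the difference of (log n)^(l+1) is used
instead: summation creates a logarithm here. -/
theorem hasPrim_logTerm (K D : ℕ) : ∀ (s : ℂ) (l : ℕ), s.re < D - K →
    HasPrim (down (s + 1)) K (logTerm (s, l)) := by
  induction D with
  | zero =>
    intro s l hs
    exact HasPrim.of_powO (powO_logTerm _ (by simpa using hs))
  | succ D ih =>
    intro s l hs
    have low : ∀ (l : ℕ) (t : ℂ), t = s + 1 → HasPrim (down (s + 1)) K (fun n =>
        logTerm (t, l) (n - 1) - logTerm (t, l) n + t * logTerm (t - 1, l) n +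
          l * logTerm (t - 1, l - 1) n) := by
      rintro l t rfl
      obtain ⟨w, hw, h⟩ := logExp_logTerm_diff (s + 1) l K
      have h1 : HasPrim (down (s + 1)) K w := by
        refine hasPrim_of_mem_logSpan hw ?_
        rintro _ ⟨q, rfl⟩ l'
        have e : s + 1 - 2 - q = s - (q + 1 : ℕ) := by push_cast; ring
        rw [e]
        refine (ih _ l' ?_).mono ?_
        · rw [Complex.sub_re, Complex.natCast_re]
          push_cast at hs ⊢
          have : (0 : ℝ) ≤ q := q.cast_nonneg
          linarith
        · have := down_sub_natCast_subset (s + 1) (q + 1)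
          rwa [sub_add_eq_add_sub]
      have h2 := h1.add (HasPrim.of_powO h)
      convert h2 using 1
      simp
    by_cases hs1 : s = -1
    · subst hs1
      have h1 := low (l + 1) 0 (by ring)
      have h2 : HasPrim (down (-1 + 1)) K (fun n => logTerm (0, l + 1) n - logTerm (0, l + 1) (n - 1)) :=
        hasPrim_diff (logTerm_mem ⟨⟨0, by simp⟩, trivial⟩)
      have h3 := (h1.add h2).smul ((l : ℂ) + 1)⁻¹
      convert h3 using 1
      funext n
      have : (l : ℂ) + 1 ≠ 0 := by exact_mod_cast Nat.succ_ne_zero l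
      simp only [Pi.smul_apply, Pi.add_apply, smul_eq_mul, Nat.add_sub_cancel, zero_mul, add_zero,
        zero_sub]
      push_cast
      field_simp
      ring
    · have hs1' : s + 1 ≠ 0 := fun h => hs1 (eq_neg_of_add_eq_zero_left h)
      induction l using Nat.strong_induction_on with
      | _ l ihl =>
      have h1 := low l (s + 1) rfl
      have h2 : HasPrim (down (s + 1)) K (fun n => logTerm (s + 1, l) n - logTerm (s + 1, l) (n - 1)) :=
        hasPrim_diff (logTerm_mem ⟨self_mem_down _, trivial⟩)
      have h3 : HasPrim (down (s + 1)) K ((l : ℂ) • logTerm (s, l - 1)) := by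
        rcases l with _ | l
        · simpa using HasPrim.of_powO (A := down (s + 1)) (K := K) PowO.zero
        · exact (ihl l (Nat.lt_succ_self l)).smul _
      have h4 := ((h1.add h2).add (h3.smul (-1))).smul (s + 1)⁻¹
      convert h4 using 1
      funext n
      simp only [Pi.smul_apply, Pi.add_apply, smul_eq_mul, add_sub_cancel_right]
      field_simp
      ring

end

theorem sum_Icc_one {M : Type*} [AddCommMonoid M] (f : ℕ → M) (N : ℕ) :
    ∑ n ∈ Finset.Icc 1 N, f n = ∑ i ∈ Finset.range N, f (i + 1) := by
  induction N with
  | zero => simp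
  | succ N ih => rw [Finset.sum_Icc_succ_top (by omega), ih, Finset.sum_range_succ]

theorem epw_anti_right {b : ℝ} (hb : b ≤ 0) {m n : ℕ} (h : m ≤ n) : epw b n ≤ epw b m := by
  have h1 := epw_mono_right (neg_nonneg.2 hb) h
  have e : ∀ n, epw (-b) n = (epw b n)⁻¹ := fun n => by
    rw [epw, epw, neg_mul, Real.exp_neg]
  rw [e, e] at h1
  exact (inv_le_inv₀ (epw_pos _ _) (epw_pos _ _)).1 h1

/-- At n = m + N + 1 the bound n^(-K-2) is at most N^(-K) m^(-2), with 0^b read as 1. So c is the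
sum of the whole series, and its tail is O(N^(-K)). -/
theorem PowO.sum_tail {K : ℕ} {e : ℕ → ℂ} (he : PowO (-((K + 2 : ℕ) : ℝ)) e) :
    ∃ c, PowO (-(K : ℝ)) (fun N => (∑ n ∈ Finset.Icc 1 N, e n) - c) := by
  obtain ⟨C, hC, h⟩ := he
  have h2 : Summable (epw (-2)) := summable_epw (by norm_num)
  have hle : ∀ N m, ‖e (m + N + 1)‖ ≤ C * epw (-(K : ℝ)) N * epw (-2) m := by
    intro N m
    refine (h _).trans ?_
    have e1 : (-((K + 2 : ℕ) : ℝ)) = -(K : ℝ) + -2 := by push_cast; ring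
    rw [e1, epw_add, mul_assoc]
    refine mul_le_mul_of_nonneg_left ?_ hC
    exact mul_le_mul (epw_anti_right (by simp) (by omega)) (epw_anti_right (by norm_num) (by omega))
      (epw_pos _ _).le (epw_pos _ _).le
  have hs : Summable fun m => e (m + 1) := Summable.of_norm_bounded (h2.mul_left _) (hle 0)
  refine ⟨∑' m, e (m + 1), PowO.of_le (C := C * ∑' m, epw (-2) m) fun N => ?_⟩
  rw [sum_Icc_one, ← hs.sum_add_tsum_nat_add N, sub_add_cancel_left, norm_neg]
  have := tsum_of_norm_bounded (h2.mul_left (C * epw (-(K : ℝ)) N)).hasSum (hle N)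
  rw [tsum_mul_left] at this
  linarith

/-- The approximant has a primitive by `hasPrim_logTerm`, and the error is summed by
`PowO.sum_tail`. The constants so produced are the reason why 0 has to be an admissible exponent.
Two orders of precision are spent on the tail. -/
theorem LogExp.sum {A B : Set ℂ} {u : ℕ → ℂ} (hu : LogExp A u) (h0 : (0 : ℂ) ∈ B)
    (h : ∀ s ∈ A, ∀ q : ℕ, s + 1 - q ∈ B) : LogExp B (fun N => ∑ n ∈ Finset.Icc 1 N, u n) := by
  intro K
  obtain ⟨w, hw, h1⟩ := hu (K + 2)
  have h2 : HasPrim B (K + 2) w := by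
    refine hasPrim_of_mem_logSpan hw fun s hs l => ?_
    obtain ⟨D, hD⟩ := exists_nat_gt (s.re + (K + 2 : ℕ))
    refine (hasPrim_logTerm (K + 2) D s l (by linarith)).mono ?_
    rintro _ ⟨q, rfl⟩
    exact h s hs q
  obtain ⟨v, hv, h3⟩ := h2
  obtain ⟨c, hc⟩ := (h1.add h3).sum_tail
  refine ⟨v + (c - v 0) • NestedSums.logTerm (0, 0), Submodule.add_mem _ hv (Submodule.smul_mem _ _
    (logTerm_mem ⟨h0, trivial⟩)), ?_⟩
  convert hc using 1
  funext N
  have e1 : ∑ n ∈ Finset.Icc 1 N, (v n - v (n - 1)) = v N - v 0 := by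
    rw [sum_Icc_one]
    simpa using Finset.sum_range_sub v N
  simp only [Pi.add_apply, Pi.sub_apply, Finset.sum_add_distrib, Finset.sum_sub_distrib,
    Pi.smul_apply, logTerm_zero, Pi.one_apply, smul_eq_mul, mul_one] at e1 ⊢
  linear_combination e1

theorem LogExp.congr_pos {A : Set ℂ} {u v : ℕ → ℂ} (hu : LogExp A u)
    (h : ∀ n, n ≠ 0 → v n = u n) : LogExp A v := by
  intro K
  obtain ⟨w, hw, h1⟩ := hu K
  refine ⟨w, hw, ?_⟩
  have h2 : PowO (-(K : ℝ)) (v - u) := PowO.of_le (C := ‖v 0 - u 0‖) fun n => by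
    rcases Nat.eq_zero_or_pos n with rfl | hn
    · simp
    · simp only [Pi.sub_apply, h n hn.ne', sub_self, norm_zero]
      exact mul_nonneg (norm_nonneg _) (epw_pos _ _).le
  simpa using h2.add h1

/-! ### Truncated nested sums by recursion -/

/-- The bound for the next summation variable. -/
def Version.pred : Version → ℕ → ℕ
  | .strict, n => n - 1
  | .weak, n => n

/-- The argument of the regularised tail in the recursion for the next tail. -/
def Version.next : Version → ℕ → ℕ
  | .strict, n => n + 1
  | .weak, n => n

/-- The nested sum of `σ_j ⊗ ⋯ ⊗ σ_(j + m - 1)`, truncated at `N`. -/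
def nest (s : Version) (σ : ℕ → ℕ → ℂ) : ℕ → ℕ → ℕ → ℂ
  | 0, _, _ => 1
  | m + 1, j, N => ∑ n ∈ Finset.Icc 1 N, σ j n * nest s σ m (j + 1) (s.pred n)

section

variable {s : Version} {σ : ℕ → ℕ → ℂ}

theorem Version.pred_le (s : Version) (n : ℕ) : s.pred n ≤ n := by
  cases s <;> simp [Version.pred]

theorem nest_succ_right (m j N : ℕ) : nest s σ (m + 1) j (N + 1) =
    nest s σ (m + 1) j N + σ j (N + 1) * nest s σ m (j + 1) (s.pred (N + 1)) := by
  rw [nest, nest, Finset.sum_Icc_succ_top (by omega)]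

/-- The exponents in the expansion of a nested sum. -/
def nestExponents (α : ℕ → ℂ) (m j : ℕ) : Set ℂ :=
  {t | ∃ i ≤ m, ∃ q : ℕ, t = ∑ a ∈ Finset.range i, α (j + a) + i - q}

/-- The strict version evaluates the inner sum at n - 1, so the shifted sequence is carried through
the induction. Its expansion comes from removing the last summand, without expanding powers of N -
1. -/
theorem logExp_nest {α : ℕ → ℂ} (h : ∀ j, LogExp (down (α j)) (σ j)) (m : ℕ) : ∀ j,
    LogExp (nestExponents α m j) (nest s σ m j) ∧
      LogExp (nestExponents α m j) (fun N => nest s σ m j (N - 1)) := by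
  induction m with
  | zero =>
    intro j
    have h0 : (0 : ℂ) ∈ nestExponents α 0 j := ⟨0, le_rfl, 0, by simp⟩
    have := LogExp.logTerm h0 0
    rw [logTerm_zero] at this
    exact ⟨this, this⟩
  | succ m ih =>
    intro j
    have h0 : (0 : ℂ) ∈ nestExponents α (m + 1) j := ⟨0, by omega, 0, by simp⟩
    have hp : LogExp (nestExponents α m (j + 1)) (fun n => nest s σ m (j + 1) (s.pred n)) := by
      cases s
      · exact (ih (j + 1)).2
      · exact (ih (j + 1)).1
    have key : ∀ x ∈ down (α j), ∀ t ∈ nestExponents α m (j + 1), ∀ q : ℕ,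
        x + t + 1 - q ∈ nestExponents α (m + 1) j := by
      rintro _ ⟨r, rfl⟩ _ ⟨i, hi, q', rfl⟩ q
      refine ⟨i + 1, by omega, r + q' + q, ?_⟩
      rw [Finset.sum_range_succ']
      have : ∀ a, j + 1 + a = j + (a + 1) := fun a => by ring
      simp only [this, add_zero]
      push_cast
      ring
    have hu : LogExp {x | ∃ y ∈ down (α j), ∃ t ∈ nestExponents α m (j + 1), x = y + t}
        (fun n => σ j n * nest s σ m (j + 1) (s.pred n)) :=
      (h j).mul hp fun x hx t ht => ⟨x, hx, t, ht, rfl⟩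
    have h1 : LogExp (nestExponents α (m + 1) j) (nest s σ (m + 1) j) := by
      refine hu.sum h0 ?_
      rintro _ ⟨y, hy, t, ht, rfl⟩ q
      exact key y hy t ht q
    refine ⟨h1, (h1.sub (hu.mono ?_)).congr_pos ?_⟩
    · rintro _ ⟨y, hy, t, ht, rfl⟩
      have := key y hy t ht 1
      simpa using this
    · intro n hn
      obtain ⟨n, rfl⟩ := Nat.exists_eq_succ_of_ne_zero hn
      simp only [Nat.succ_eq_add_one, Nat.add_sub_cancel, Pi.sub_apply, nest_succ_right]
      ring

/-- Deconcatenation: the truncated nested sums in terms of regularised tails. -/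
theorem sum_tail_mul_nest {k : ℕ} {r : ℕ → ℕ → ℂ} (h0 : ∀ n, r 0 n = 1)
    (hr : ∀ j < k, ∀ n, r (j + 1) n - r (j + 1) (n + 1) = σ j (n + 1) * r j (s.next n)) (N : ℕ) :
    ∑ j ∈ Finset.range (k + 1), r j N * nest s σ (k - j) j N = r k 0 := by
  have hT : ∀ j < k, ∀ N, nest s σ (k - j) j (N + 1) =
      nest s σ (k - j) j N + σ j (N + 1) * nest s σ (k - (j + 1)) (j + 1) (s.pred (N + 1)) := by
    intro j hj N
    obtain ⟨m, hm⟩ : ∃ m, k - j = m + 1 := ⟨k - j - 1, by omega⟩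
    have hm' : k - (j + 1) = m := by omega
    rw [hm, hm', nest_succ_right]
  -- When everything converges, r j N is the sum over the first j indices, all exceeding N, and the
  -- claim sorts chains by the number of such indices. In general the left side does not depend on
  -- N, by a product rule for differences; at N = 0 all nested sums vanish except the empty one, j =
  -- k.
  induction N with
  | zero =>
    rw [Finset.sum_range_succ, Finset.sum_eq_zero]
    · simp [nest]
    · intro j hj
      obtain ⟨m, hm⟩ : ∃ m, k - j = m + 1 := ⟨k - j - 1, by
        have := Finset.mem_range.1 hj; omega⟩
      rw [hm]
      simp [nest]
  | succ N ih =>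
    rw [← ih]
    cases s with
    | strict =>
      have e1 : ∑ j ∈ Finset.range (k + 1), r j (N + 1) * nest .strict σ (k - j) j (N + 1) =
          ∑ j ∈ Finset.range (k + 1), r j (N + 1) * nest .strict σ (k - j) j N +
          ∑ j ∈ Finset.range k, r j (N + 1) * (σ j (N + 1) *
            nest .strict σ (k - (j + 1)) (j + 1) N) := by
        rw [Finset.sum_range_succ, Finset.sum_range_succ, add_right_comm,
          ← Finset.sum_add_distrib]
        congr 1
        · refine Finset.sum_congr rfl fun j hj => ?_
          rw [hT j (Finset.mem_range.1 hj)]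
          simp only [Version.pred, Nat.add_sub_cancel]
          ring
        · simp [nest]
      rw [e1, Finset.sum_range_succ', Finset.sum_range_succ', h0, h0, add_right_comm,
        ← Finset.sum_add_distrib]
      congr 1
      refine Finset.sum_congr rfl fun j hj => ?_
      have := hr j (Finset.mem_range.1 hj) N
      simp only [Version.next] at this
      linear_combination -this * nest .strict σ (k - (j + 1)) (j + 1) N
    | weak =>
      -- The intermediate sum has r at N and the nested sums at N + 1, opposite to the strict case,
      -- because `pred` and `next` fix their arguments here.
      have e1 : ∑ j ∈ Finset.range (k + 1), r j N * nest .weak σ (k - j) j (N + 1) =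
          ∑ j ∈ Finset.range (k + 1), r j N * nest .weak σ (k - j) j N +
          ∑ j ∈ Finset.range k, r j N * (σ j (N + 1) *
            nest .weak σ (k - (j + 1)) (j + 1) (N + 1)) := by
        rw [Finset.sum_range_succ, Finset.sum_range_succ, add_right_comm,
          ← Finset.sum_add_distrib]
        congr 1
        · refine Finset.sum_congr rfl fun j hj => ?_
          rw [hT j (Finset.mem_range.1 hj)]
          simp only [Version.pred]
          ring
        · simp [nest]
      have e2 : ∑ j ∈ Finset.range (k + 1), r j N * nest .weak σ (k - j) j (N + 1) =
          ∑ j ∈ Finset.range (k + 1), r j (N + 1) * nest .weak σ (k - j) j (N + 1) +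
          ∑ j ∈ Finset.range k, r j N * (σ j (N + 1) *
            nest .weak σ (k - (j + 1)) (j + 1) (N + 1)) := by
        rw [Finset.sum_range_succ', Finset.sum_range_succ', h0, h0, add_right_comm,
          ← Finset.sum_add_distrib]
        congr 1
        refine Finset.sum_congr rfl fun j hj => ?_
        have := hr j (Finset.mem_range.1 hj) N
        simp only [Version.next] at this
        linear_combination this * nest .weak σ (k - (j + 1)) (j + 1) (N + 1)
      exact add_right_cancel (e2.symm.trans e1)

/-- Growth of nested sums; with `M = 0` this is the criterion of absolute convergence. -/
theorem powO_nest {a : ℕ → ℝ} (h : ∀ j, PowO (a j) (σ j)) (m : ℕ) : ∀ (j : ℕ) (M : ℝ), 0 ≤ M →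
    (∀ t < m, ∑ i ∈ Finset.range (t + 1), (a (j + i) + 1) < M) → PowO M (nest s σ m j) := by
  induction m with
  | zero =>
    intro j M hM _
    refine PowO.of_le (C := 1) fun n => ?_
    simp only [nest, norm_one, one_mul]
    simpa using epw_mono hM n
  | succ m ih =>
    intro j M hM hlt
    -- A number y strictly between all the partial sums and M leaves room for convergence: the
    -- summand is O(n^(y-1)), at most N^M n^(y-1-M) for n ≤ N, and y - 1 - M < -1.
    have hev : ∀ᶠ y in 𝓝[<] M, ∀ t ∈ Finset.range (m + 1),
        ∑ i ∈ Finset.range (t + 1), (a (j + i) + 1) < y := by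
      rw [Filter.eventually_all_finset]
      intro t ht
      exact Ioo_mem_nhdsLT (hlt t (Finset.mem_range.1 ht)) |> fun h => by
        filter_upwards [h] with y hy using hy.1
    obtain ⟨y, hy, hyM⟩ := (hev.and self_mem_nhdsWithin).exists
    have hyM : y < M := hyM
    have h0 : a j + 1 < y := by simpa using hy 0 (by simp)
    have ih' : PowO (y - (a j + 1)) (nest s σ m (j + 1)) := by
      refine ih (j + 1) _ (by linarith) fun t ht => ?_
      have := hy (t + 1) (by simpa using ht)
      rw [Finset.sum_range_succ'] at this
      have e : ∀ i, j + 1 + i = j + (i + 1) := fun i => by ring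
      simp only [e, add_zero] at this ⊢
      linarith
    obtain ⟨C, hC, h1⟩ := h j
    obtain ⟨D, hD, h2⟩ := ih'
    have hs : Summable (epw (y - 1 - M)) := summable_epw (by linarith)
    refine PowO.of_le (C := C * D * ∑' n, epw (y - 1 - M) n) fun N => ?_
    rw [nest]
    calc ‖∑ n ∈ Finset.Icc 1 N, σ j n * nest s σ m (j + 1) (s.pred n)‖
        ≤ ∑ n ∈ Finset.Icc 1 N, C * D * epw M N * epw (y - 1 - M) n := by
          refine norm_sum_le_of_le _ fun n hn => ?_
          have hnN := (Finset.mem_Icc.1 hn).2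
          rw [norm_mul]
          have h3 : ‖nest s σ m (j + 1) (s.pred n)‖ ≤ D * epw (y - (a j + 1)) n :=
            (h2 _).trans (mul_le_mul_of_nonneg_left
              (epw_mono_right (by linarith) (s.pred_le n)) hD)
          calc ‖σ j n‖ * ‖nest s σ m (j + 1) (s.pred n)‖
              ≤ (C * epw (a j) n) * (D * epw (y - (a j + 1)) n) :=
                mul_le_mul (h1 n) h3 (norm_nonneg _) (mul_nonneg hC (epw_pos _ _).le)
            _ = C * D * epw (y - 1) n := by
                rw [mul_mul_mul_comm, ← epw_add]; congr 2; ring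
            _ = C * D * (epw M n * epw (y - 1 - M) n) := by
                rw [← epw_add]; congr 2; ring
            _ ≤ C * D * (epw M N * epw (y - 1 - M) n) := by
                refine mul_le_mul_of_nonneg_left ?_ (mul_nonneg hC hD)
                exact mul_le_mul_of_nonneg_right (epw_mono_right hM hnN) (epw_pos _ _).le
            _ = _ := by ring
      _ ≤ C * D * epw M N * ∑' n, epw (y - 1 - M) n := by
          rw [← Finset.mul_sum]
          exact mul_le_mul_of_nonneg_left (hs.sum_le_tsum _ fun n _ => (epw_pos _ _).le)
            (mul_nonneg (mul_nonneg hC hD) (epw_pos _ _).le)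
      _ = _ := by ring

end

/-! ### Sums over chains as iterated sums, by splitting off the largest index -/

theorem Version.chain_succ_iff {k : ℕ} (s : Version) (n : Fin (k + 1) → ℕ) (N : ℕ) :
    ((∀ i, n i ∈ Finset.Icc 1 N) ∧ s.Chain n) ↔
      n 0 ∈ Finset.Icc 1 N ∧ (∀ i, Fin.tail n i ∈ Finset.Icc 1 (s.pred (n 0))) ∧
        s.Chain (Fin.tail n) := by
  have h0 : ∀ i : Fin k, (0 : Fin (k + 1)) < i.succ := Fin.succ_pos
  simp only [Finset.mem_Icc, Fin.tail]
  cases s with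
  | strict =>
    simp only [Version.Chain, Version.pred]
    constructor
    · rintro ⟨h1, h2⟩
      refine ⟨h1 0, fun i => ⟨(h1 i.succ).1, ?_⟩, fun i j hij => h2 (Fin.succ_lt_succ_iff.2 hij)⟩
      have := h2 (h0 i)
      omega
    · rintro ⟨h1, h2, h3⟩
      have h4 : ∀ i : Fin k, n i.succ < n 0 := fun i => by have := h2 i; omega
      refine ⟨fun i => ?_, fun i j hij => ?_⟩
      · refine Fin.cases h1 (fun i => ?_) i
        exact ⟨(h2 i).1, (h4 i).le.trans h1.2⟩
      · induction j using Fin.cases with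
        | zero => exact absurd hij (Fin.not_lt_zero i)
        | succ j =>
          induction i using Fin.cases with
          | zero => exact h4 j
          | succ i => exact h3 (Fin.succ_lt_succ_iff.1 hij)
  | weak =>
    simp only [Version.Chain, Version.pred]
    constructor
    · rintro ⟨h1, h2⟩
      exact ⟨h1 0, fun i => ⟨(h1 i.succ).1, h2 (h0 i).le⟩,
        fun i j hij => h2 (Fin.succ_le_succ_iff.2 hij)⟩
    · rintro ⟨h1, h2, h3⟩
      refine ⟨fun i => ?_, fun i j hij => ?_⟩
      · refine Fin.cases h1 (fun i => ?_) i
        exact ⟨(h2 i).1, (h2 i).2.trans h1.2⟩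
      · induction i using Fin.cases with
        | zero =>
          induction j using Fin.cases with
          | zero => exact le_rfl
          | succ j => exact (h2 j).2
        | succ i =>
          induction j using Fin.cases with
          | zero => exact absurd hij (not_le.2 (h0 i))
          | succ j => exact h3 (Fin.succ_le_succ_iff.1 hij)

open Classical in
theorem truncatedNestedSum_succ (s : Version) {k : ℕ} (σ : Fin (k + 1) → ℝ → ℂ) (N : ℕ) :
    truncatedNestedSum s σ N =
      ∑ n ∈ Finset.Icc 1 N, σ 0 n * truncatedNestedSum s (fun i => σ i.succ) (s.pred n) := by
  simp only [truncatedNestedSum, Finset.mul_sum]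
  rw [Finset.sum_sigma']
  refine Finset.sum_bij' (fun n _ => ⟨n 0, Fin.tail n⟩) (fun p _ => Fin.cons p.1 p.2) ?_ ?_ ?_ ?_ ?_
  · intro n hn
    simp only [Finset.mem_filter, Fintype.mem_piFinset, Finset.mem_sigma] at hn ⊢
    exact (s.chain_succ_iff n N).1 hn
  · rintro ⟨a, m⟩ hp
    simp only [Finset.mem_filter, Fintype.mem_piFinset, Finset.mem_sigma] at hp ⊢
    refine (s.chain_succ_iff _ N).2 ?_
    simpa using hp
  · intro n _
    simp
  · rintro ⟨a, m⟩ _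
    simp
  · intro n _
    rw [Fin.prod_univ_succ]
    rfl

@[simp] theorem truncatedNestedSum_zero (s : Version) (σ : Fin 0 → ℝ → ℂ) (N : ℕ) :
    truncatedNestedSum s σ N = 1 := by
  classical
  have : s.Chain (default : Fin 0 → ℕ) := by
    cases s <;> intro i <;> exact i.elim0
  rw [truncatedNestedSum, Finset.filter_true_of_mem]
  · simp
  · intro n _
    rwa [Subsingleton.elim n default]

theorem truncatedNestedSum_eq_nest (s : Version) {k : ℕ} : ∀ (σ : Fin k → ℝ → ℂ) (τ : ℕ → ℕ → ℂ)
    (j : ℕ), (∀ (i : Fin k) (n : ℕ), τ (j + i) n = σ i n) →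
    truncatedNestedSum s σ = nest s τ k j := by
  induction k with
  | zero =>
    intro σ τ j _
    funext N
    simp [nest]
  | succ k ih =>
    intro σ τ j h
    funext N
    rw [truncatedNestedSum_succ, nest]
    refine Finset.sum_congr rfl fun n _ => ?_
    rw [ih (fun i => σ i.succ) τ (j + 1) fun i n => by
      rw [← h i.succ n, Fin.val_succ, add_assoc, add_comm 1]]
    rw [← h 0 n]
    rfl

/-- Extension by zero of a finite sequence. -/
def extend {M : Type*} [Zero M] {k : ℕ} (f : Fin k → M) (j : ℕ) : M :=
  if h : j < k then f ⟨j, h⟩ else 0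

@[simp] theorem extend_val {M : Type*} [Zero M] {k : ℕ} (f : Fin k → M) (j : Fin k) :
    extend f j = f j := by simp [extend]

theorem sum_Iic_eq_sum_range {M : Type*} [AddCommMonoid M] {k : ℕ} (f : Fin k → M) (j : Fin k) :
    ∑ i ∈ Finset.Iic j, f i = ∑ i ∈ Finset.range (j + 1), extend f i := by
  rw [Nat.range_succ_eq_Iic, ← Fin.map_valEmbedding_Iic, Finset.sum_map]
  simp

theorem truncatedNestedSum_eq_nest_extend (s : Version) {k : ℕ} (σ : Fin k → ℝ → ℂ) :
    truncatedNestedSum s σ = nest s (extend fun i n => σ i n) k 0 :=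
  truncatedNestedSum_eq_nest s σ _ 0 fun i n => by rw [zero_add, extend_val]

/-! ### Symbols at the integers -/

theorem PowO.of_pos {b C : ℝ} {u : ℕ → ℂ} (h : ∀ n, n ≠ 0 → ‖u n‖ ≤ C * epw b n) : PowO b u :=
  PowO.of_le (C := max C ‖u 0‖) fun n => by
    rcases Nat.eq_zero_or_pos n with rfl | hn
    · simp
    · exact (h n hn.ne').trans (mul_le_mul_of_nonneg_right (le_max_left _ _) (epw_pos _ _).le)

variable {α : ℂ} {σ : ℝ → ℂ}

theorem IsClassicalSymbol.exists_powO (h : IsClassicalSymbol α σ) : ∃ a : ℕ → ℂ, ∀ J : ℕ,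
    PowO (α.re - J) ((fun n : ℕ => σ n) - ∑ j ∈ Finset.range J, a j • logTerm (α - j, 0)) := by
  obtain ⟨a, ha⟩ := h.expansion
  refine ⟨a, fun J => ?_⟩
  obtain ⟨C, hC⟩ := ha J 0
  refine PowO.of_pos (C := C) fun n hn => ?_
  have := hC n (by exact_mod_cast Nat.one_le_iff_ne_zero.2 hn)
  simpa [epw_eq_rpow _ hn, logTerm, pw_eq_cpow _ hn] using this

theorem IsClassicalSymbol.powO (h : IsClassicalSymbol α σ) : PowO α.re (fun n : ℕ => σ n) := by
  obtain ⟨a, ha⟩ := h.exists_powO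
  simpa using ha 0

theorem IsClassicalSymbol.logExp (h : IsClassicalSymbol α σ) :
    LogExp (down α) (fun n : ℕ => σ n) := by
  obtain ⟨a, ha⟩ := h.exists_powO
  intro K
  obtain ⟨J, hJ⟩ := exists_nat_ge (α.re + K)
  exact ⟨_, Submodule.sum_mem _ fun j _ => Submodule.smul_mem _ _ (logTerm_mem ⟨⟨j, rfl⟩, trivial⟩),
    (ha J).mono (by linarith)⟩

theorem logExp_zero {A : Set ℂ} : LogExp A 0 := LogExp.of_mem (Submodule.zero_mem _)

theorem logExp_extend {k : ℕ} {α : Fin k → ℂ} {σ : Fin k → ℝ → ℂ}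
    (h : ∀ i, IsClassicalSymbol (α i) (σ i)) (j : ℕ) :
    LogExp (down (extend α j)) (extend (fun i (n : ℕ) => σ i n) j) := by
  by_cases hj : j < k
  · simp only [extend, hj, dif_pos]
    exact (h ⟨j, hj⟩).logExp
  · simp only [extend, hj, dif_neg, not_false_iff]
    exact logExp_zero

theorem existsUnique_isFinitePart (s : Version) {k : ℕ} {α : Fin k → ℂ} {σ : Fin k → ℝ → ℂ}
    (h : ∀ i, IsClassicalSymbol (α i) (σ i)) :
    ∃! c : ℂ, IsFinitePart (truncatedNestedSum s σ) c := by
  rw [truncatedNestedSum_eq_nest_extend]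
  obtain ⟨c, hc⟩ := (logExp_nest (s := s) (logExp_extend h) k 0).1.exists_isFinitePart
  exact ⟨c, hc, fun d hd => hd.unique hc⟩

/-! ### Convergent nested sums -/

section

variable {k : ℕ} {a : Fin k → ℝ} {σ : Fin k → ℝ → ℂ}

theorem powO_extend (h : ∀ i, PowO (a i) (fun n : ℕ => σ i n)) (j : ℕ) :
    PowO (extend a j) (extend (fun i (n : ℕ) => σ i n) j) := by
  by_cases hj : j < k
  · simp only [extend, hj, dif_pos]
    exact h ⟨j, hj⟩
  · simp only [extend, hj, dif_neg, not_false_iff]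
    exact PowO.zero

theorem bounded_truncatedNestedSum (s : Version) (h : ∀ i, PowO (a i) (fun n : ℕ => σ i n))
    (ha : ∀ j : Fin k, ∑ i ∈ Finset.Iic j, a i < -((j : ℝ) + 1)) :
    ∃ C : ℝ, ∀ N, ‖truncatedNestedSum s σ N‖ ≤ C := by
  rw [truncatedNestedSum_eq_nest_extend]
  obtain ⟨C, _, hC⟩ := powO_nest (s := s) (powO_extend h) k 0 0 le_rfl fun t ht => by
    have := ha ⟨t, ht⟩
    rw [sum_Iic_eq_sum_range] at this
    simp only [zero_add, Finset.sum_add_distrib, Finset.sum_const, Finset.card_range,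
      nsmul_eq_mul, mul_one]
    push_cast
    linarith
  exact ⟨C, fun N => by simpa using hC N⟩

-- The truncated sums of absolute values are bounded, and the boxes n_i ≤ N exhaust the index set.
-- Only growth bounds enter, so the lemma also serves the products of symbols in stuffle words.
open Classical in
theorem nestedSumConverges_of_powO (s : Version) (h : ∀ i, PowO (a i) (fun n : ℕ => σ i n))
    (ha : ∀ j : Fin k, ∑ i ∈ Finset.Iic j, a i < -((j : ℝ) + 1)) : NestedSumConverges s σ := by
  let T : ℕ → Finset {n : Fin k → ℕ // (∀ i, 0 < n i) ∧ s.Chain n} := fun N =>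
    (Fintype.piFinset fun _ : Fin k => Finset.Icc 1 N).subtype
      (fun n : Fin k → ℕ => (∀ i, 0 < n i) ∧ s.Chain n)
  have hTmem : ∀ N (n : {n : Fin k → ℕ // (∀ i, 0 < n i) ∧ s.Chain n}), n ∈ T N ↔ ∀ i, n.1 i ≤ N := by
    intro N n
    have h1 : n ∈ T N ↔ n.1 ∈ Fintype.piFinset fun _ : Fin k => Finset.Icc 1 N :=
      Finset.mem_subtype
    rw [h1, Fintype.mem_piFinset]
    refine forall_congr' fun i => ?_
    have := n.2.1 i
    rw [Finset.mem_Icc]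
    omega
  have hTsum : ∀ (τ : Fin k → ℝ → ℂ) N, truncatedNestedSum s τ N = ∑ n ∈ T N, ∏ i, τ i (n.1 i) := by
    intro τ N
    have h1 := Finset.sum_subtype_eq_sum_filter
      (s := Fintype.piFinset fun _ : Fin k => Finset.Icc 1 N)
      (p := fun n : Fin k → ℕ => (∀ i, 0 < n i) ∧ s.Chain n) (fun n : Fin k → ℕ => ∏ i, τ i (n i))
    rw [truncatedNestedSum]
    refine Eq.trans ?_ h1.symm
    refine Finset.sum_congr (Finset.filter_congr fun n hn => ?_) fun _ _ => rfl
    rw [Fintype.mem_piFinset] at hn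
    exact ⟨fun hs => ⟨fun i => (Finset.mem_Icc.1 (hn i)).1, hs⟩, fun hs => hs.2⟩
  have hmono : Monotone T := fun M N hMN n hn => by
    rw [hTmem] at hn ⊢
    exact fun i => (hn i).trans hMN
  have hex : ∀ n : {n : Fin k → ℕ // (∀ i, 0 < n i) ∧ s.Chain n}, ∃ N, n ∈ T N := fun n =>
    ⟨∑ i, n.1 i, (hTmem _ _).2 fun i => Finset.single_le_sum (fun _ _ => Nat.zero_le _)
      (Finset.mem_univ i)⟩
  have hTtop : Tendsto T atTop atTop := tendsto_atTop_finset_of_monotone hmono hex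
  have hsum : Summable (fun n : {n : Fin k → ℕ // (∀ i, 0 < n i) ∧ s.Chain n} => ∏ i, σ i (n.1 i)) := by
    obtain ⟨C, hC⟩ := bounded_truncatedNestedSum (σ := fun i x => (‖σ i x‖ : ℂ)) s
      (fun i => by
        obtain ⟨C, hC, h⟩ := h i
        exact ⟨C, hC, fun n => by simpa using h n⟩) ha
    refine Summable.of_norm (summable_of_sum_le (c := C) (fun _ => norm_nonneg _) fun F => ?_)
    obtain ⟨N, hN⟩ := (tendsto_atTop.1 hTtop F).exists
    calc ∑ n ∈ F, ‖∏ i, σ i (n.1 i)‖ ≤ ∑ n ∈ T N, ‖∏ i, σ i (n.1 i)‖ :=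
          Finset.sum_le_sum_of_subset_of_nonneg hN fun _ _ _ => norm_nonneg _
      _ ≤ ‖((∑ n ∈ T N, ‖∏ i, σ i (n.1 i)‖ : ℝ) : ℂ)‖ := by
          rw [Complex.norm_real]; exact le_abs_self _
      _ = ‖truncatedNestedSum s (fun i x => (‖σ i x‖ : ℂ)) N‖ := by
          rw [hTsum]
          push_cast [norm_prod]
          rfl
      _ ≤ C := hC N
  refine ⟨hsum, ?_⟩
  have := hsum.hasSum.comp hTtop
  exact this.congr fun N => (hTsum σ N).symm

theorem nestedSumConverges_of_convergentOrders (s : Version) {α : Fin k → ℂ}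
    (h : ∀ i, IsClassicalSymbol (α i) (σ i)) (ha : ConvergentOrders α) :
    NestedSumConverges s σ :=
  nestedSumConverges_of_powO s (fun i => (h i).powO) fun j => by
    have := ha j
    rwa [Complex.re_sum] at this

theorem NestedSumConverges.cutoff_eq {s : Version} (h : NestedSumConverges s σ) :
    cutoffNestedSum s σ = nestedSum s σ :=
  (isFinitePart_of_tendsto h.2).finitePart_eq

end

/-! ### Regularised tails -/

/-- The naturals other than w form a closed set missing w. Half the radius of a disc about w free of
them serves both as the size of the neighbourhood and as the distance kept. -/
theorem exists_natCast_separation (w : ℂ) : ∃ δ : ℝ, 0 < δ ∧ ∀ w' : ℂ, ‖w' - w‖ ≤ δ →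
    ∀ m : ℕ, (m : ℂ) ≠ w → δ ≤ ‖w' - m‖ := by
  have hemb : Topology.IsClosedEmbedding (fun m : ℕ => ((m : ℝ) : ℂ)) :=
    Complex.isometry_ofReal.isClosedEmbedding.comp Nat.isClosedEmbedding_coe_real
  have hcl : IsClosed ((fun m : ℕ => ((m : ℝ) : ℂ)) '' {m | (m : ℂ) ≠ w}) :=
    hemb.isClosedMap _ (isClosed_discrete _)
  have hw : ((fun m : ℕ => ((m : ℝ) : ℂ)) '' {m | (m : ℂ) ≠ w})ᶜ ∈ 𝓝 w := by
    refine hcl.isOpen_compl.mem_nhds ?_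
    rintro ⟨m, hm, hmw⟩
    exact hm (by simpa using hmw)
  obtain ⟨ε, hε, hball⟩ := Metric.mem_nhds_iff.1 hw
  refine ⟨ε / 2, half_pos hε, fun w' hw' m hm => ?_⟩
  by_contra! hlt
  have h1 : (m : ℂ) ∈ Metric.ball w ε := by
    rw [Metric.mem_ball, dist_eq_norm]
    calc ‖(m : ℂ) - w‖ = ‖(w' - w) - (w' - m)‖ := by congr 1; ring
      _ ≤ ‖w' - w‖ + ‖w' - m‖ := norm_sub_le _ _
      _ < ε := by linarith
  exact hball h1 ⟨m, hm, by simp⟩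

section

variable {d : ℕ} {U : Set (Fin d → ℂ)} {L : ℕ}

/-- The sequence q is the preceding tail, shifted so that the next summand is σ q at the same
argument. In the weak version the new shifted sequence, v (n - 1) for n ≥ 1, is v plus the summand
at n, so its expansion needs no expansion of powers of n - 1. The factor H is 1, or the divisor that
may vanish. -/
theorem exists_tail_step (s : Version) (hU : IsOpen U) {a B H : (Fin d → ℂ) → ℂ}
    {σ q : (Fin d → ℂ) → ℕ → ℂ} (ha : HolBdd U a) (hB : HolBdd U B) (hσ : UnifExp U L a σ)
    (hq : UnifExp U L B q) (hL : ∀ z ∈ U, (a z + B z).re ≤ L - 2) {δ : ℝ} (hδ : 0 < δ)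
    (hH : ((∀ z ∈ U, ∀ m : ℕ, δ ≤ ‖a z + B z + 1 - m‖) ∧ H = fun _ => 1) ∨
      ∃ J : ℕ, (∀ z ∈ U, ∀ m : ℕ, m ≠ J → δ ≤ ‖a z + B z + 1 - m‖) ∧
        H = fun z => a z + B z + 1 - J) :
    ∃ v q', UnifExp U L (fun z => a z + B z + 1) v ∧ UnifExp U L (fun z => a z + B z + 1) q' ∧
      (∀ z ∈ U, ∀ n, v z n - v z (n + 1) = H z * (σ z (n + 1) * q z (n + 1))) ∧
      ∀ z ∈ U, ∀ n, q' z (n + 1) = v z (s.next n) := by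
  have hu := hσ.mul ha.1 hB.1 hq
  have hL' : ∀ z ∈ U, (a z + B z).re ≤ L - 1 - 1 := fun z hz => by linarith [hL z hz]
  have key : ∃ v, UnifExp U L (fun z => a z + B z + 1) v ∧
      (∀ z ∈ U, ∀ n, v z n - v z (n + 1) = H z * (σ z (n + 1) * q z (n + 1))) ∧ HolBdd U H := by
    rcases hH with ⟨hres, rfl⟩ | ⟨J, hres, rfl⟩
    · obtain ⟨v, hv, hvr⟩ := exists_sum_of_nonresonant hU (ha.add hB) hu one_pos hL' hδ hres
      exact ⟨v, hv, fun z hz n => by rw [one_mul]; exact hvr z hz n, HolBdd.const 1⟩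
    · obtain ⟨v, hv, hvr⟩ := exists_sum_of_resonant hU (ha.add hB) hu one_pos hL' hδ J hres
      exact ⟨v, hv, hvr, ((ha.add hB).add (HolBdd.const 1)).sub (HolBdd.const _)⟩
  obtain ⟨v, hv, hvr, hHb⟩ := key
  cases s with
  | strict => exact ⟨v, v, hv, hv, hvr, fun z _ n => rfl⟩
  | weak =>
    refine ⟨v, fun z n => v z n + H z * (σ z n * q z n), hv, hv.add (hu.raise.trunc.const_mul hHb),
      hvr, fun z hz n => ?_⟩
    simp only [Version.next]
    linear_combination -hvr z hz n

/-- A factor H enters with each letter, so v j is the regularised tail multiplied by H 0 ⋯ H (j -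
1). It is therefore holomorphic even where the tail itself has a pole. -/
theorem exists_tails (s : Version) (hU : IsOpen U) {a B H : ℕ → (Fin d → ℂ) → ℂ}
    {σ : ℕ → (Fin d → ℂ) → ℕ → ℂ} (ha : ∀ j, HolBdd U (a j)) (hσ : ∀ j, UnifExp U L (a j) (σ j))
    (hB : ∀ j z, B j z = ∑ i ∈ Finset.range j, a i z + j) {k : ℕ}
    (hL : ∀ j < k, ∀ z ∈ U, (B (j + 1) z).re ≤ L - 1)
    (hH : ∀ j < k, ∃ δ : ℝ, 0 < δ ∧
      (((∀ z ∈ U, ∀ m : ℕ, δ ≤ ‖B (j + 1) z - m‖) ∧ H j = fun _ => 1) ∨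
      ∃ J : ℕ, (∀ z ∈ U, ∀ m : ℕ, m ≠ J → δ ≤ ‖B (j + 1) z - m‖) ∧
        H j = fun z => B (j + 1) z - J)) :
    ∃ v : ℕ → (Fin d → ℂ) → ℕ → ℂ, (∀ z n, v 0 z n = 1) ∧
      (∀ j ≤ k, UnifExp U L (B j) (v j)) ∧
      ∀ j < k, ∀ z ∈ U, ∀ n, v (j + 1) z n - v (j + 1) z (n + 1) =
        H j z * (σ j z (n + 1) * v j z (s.next n)) := by
  have hBb : ∀ j, HolBdd U (B j) := fun j => by
    rw [show B j = fun z => ∑ i ∈ Finset.range j, a i z + j from funext (hB j)]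
    exact (HolBdd.sum fun i _ => ha i).add (HolBdd.const _)
  have hBs : ∀ j z, B (j + 1) z = a j z + B j z + 1 := fun j z => by
    rw [hB, hB, Finset.sum_range_succ]
    push_cast
    ring
  suffices h : ∀ j ≤ k, ∃ (v : ℕ → (Fin d → ℂ) → ℕ → ℂ) (q : (Fin d → ℂ) → ℕ → ℂ),
      (∀ z n, v 0 z n = 1) ∧ (∀ i ≤ j, UnifExp U L (B i) (v i)) ∧ UnifExp U L (B j) q ∧
      (∀ z ∈ U, ∀ n, q z (n + 1) = v j z (s.next n)) ∧
      ∀ i < j, ∀ z ∈ U, ∀ n, v (i + 1) z n - v (i + 1) z (n + 1) =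
        H i z * (σ i z (n + 1) * v i z (s.next n)) by
    obtain ⟨v, _, h1, h2, _, _, h3⟩ := h k le_rfl
    exact ⟨v, h1, h2, h3⟩
  intro j
  induction j with
  | zero =>
    intro _
    have h1 : UnifExp U L (B 0) (fun _ _ => 1) :=
      (UnifExp.of_pw (differentiableOn_const 0) (HolBdd.const 1)).congr (fun _ _ _ => by simp)
        (fun z _ => by rw [hB]; simp)
    refine ⟨fun _ _ _ => 1, fun _ _ => 1, fun _ _ => rfl, fun i hi => ?_, h1, fun _ _ _ => rfl,
      fun i hi => absurd hi (Nat.not_lt_zero i)⟩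
    obtain rfl := Nat.le_zero.1 hi
    exact h1
  | succ j ih =>
    intro hj
    obtain ⟨v, q, h0, hv, hq, hqv, hr⟩ := ih (by omega)
    obtain ⟨δ, hδ, hHj⟩ := hH j (by omega)
    obtain ⟨v', q', hv', hq', hr', hqv'⟩ := exists_tail_step (H := H j) s hU (ha j) (hBb j) (hσ j) hq
      (fun z hz => by
        have := hL j (by omega) z hz
        rw [hBs] at this
        simp only [Complex.add_re, Complex.one_re] at this ⊢
        linarith) hδ (by simpa only [hBs] using hHj)
    refine ⟨Function.update v (j + 1) v', q', fun z n => ?_, fun i hi => ?_, ?_, fun z hz n => ?_,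
      fun i hi z hz n => ?_⟩
    · rw [Function.update_of_ne (by omega)]
      exact h0 z n
    · rcases Nat.lt_or_ge i (j + 1) with h | h
      · rw [Function.update_of_ne (by omega)]
        exact hv i (by omega)
      · obtain rfl : i = j + 1 := by omega
        rw [Function.update_self]
        exact hv'.congr (fun _ _ _ => rfl) fun z _ => hBs j z
    · exact hq'.congr (fun _ _ _ => rfl) fun z _ => hBs j z
    · rw [Function.update_self]
      exact hqv' z hz n
    · rcases Nat.lt_or_ge i j with h | h
      · rw [Function.update_of_ne (by omega), Function.update_of_ne (by omega)]
        exact hr i h z hz n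
      · obtain rfl : i = j := by omega
        rw [Function.update_self, Function.update_of_ne (by omega), hr' z hz n, hqv z hz n]

end

/-! ### Finite parts from regularised tails -/

theorem IsFinitePart.add {u v : ℕ → ℂ} {c e : ℂ} (hu : IsFinitePart u c) (hv : IsFinitePart v e) :
    IsFinitePart (fun N => u N + v N) (c + e) := by
  obtain ⟨w, hw, h1⟩ := isFinitePart_iff.1 hu
  obtain ⟨w', hw', h2⟩ := isFinitePart_iff.1 hv
  refine isFinitePart_iff.2 ⟨w + w', Submodule.add_mem _ hw hw', ?_⟩
  have := h1.add h2
  rw [add_zero] at this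
  refine this.congr fun N => ?_
  simp only [Pi.add_apply]
  ring

theorem isFinitePart_sum_zero {ι : Type*} {S : Finset ι} {u : ι → ℕ → ℂ}
    (h : ∀ i ∈ S, IsFinitePart (u i) 0) : IsFinitePart (fun N => ∑ i ∈ S, u i N) 0 := by
  classical
  induction S using Finset.induction_on with
  | empty => simpa using isFinitePart_of_tendsto (tendsto_const_nhds (x := (0 : ℂ)))
  | insert i S hi ih =>
    simp only [Finset.sum_insert hi]
    simpa using (h i (by simp)).add (ih fun j hj => h j (by simp [hj]))

theorem IsFinitePart.const_sub {u : ℕ → ℂ} (c : ℂ) (hu : IsFinitePart u 0) :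
    IsFinitePart (fun N => c - u N) c := by
  obtain ⟨w, hw, h1⟩ := isFinitePart_iff.1 hu
  refine isFinitePart_iff.2 ⟨-w, Submodule.neg_mem _ hw, ?_⟩
  have := h1.neg
  rw [neg_zero] at this
  refine this.congr fun N => ?_
  simp only [Pi.neg_apply]
  ring

/-- The finite part of a nested sum whose exponents are not resonant is the value at `0` of the
regularised tail. -/
theorem isFinitePart_nest {s : Version} {σ : ℕ → ℕ → ℂ} {α : ℕ → ℂ} {k L G : ℕ}
    (hσ : ∀ j, LogExp (down (α j)) (σ j)) (hσO : ∀ j, PowO (α j).re (σ j))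
    (hG : ∀ j, ∀ t < k, ∑ i ∈ Finset.range (t + 1), ((α (j + i)).re + 1) < G)
    {B : ℕ → ℂ} (hB : ∀ j, B j = ∑ i ∈ Finset.range j, α i + j)
    (hL : ∀ j ≤ k, (B j).re + G < L) {r : ℕ → ℕ → ℂ} (h0 : ∀ n, r 0 n = 1)
    (hr : ∀ j < k, ∀ n, r (j + 1) n - r (j + 1) (n + 1) = σ j (n + 1) * r j (s.next n))
    (hrexp : ∀ j ≤ k, ∃ c : ℕ → ℂ,
      PowO ((B j).re - L) (r j - ∑ m ∈ Finset.range L, c m • logTerm (B j - m, 0)))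
    (hres : ∀ j < k, ∀ m : ℕ, B (j + 1) ≠ m) :
    IsFinitePart (nest s σ k 0) (r k 0) := by
  have hterm : ∀ j ∈ Finset.range k,
      IsFinitePart (fun N => r (j + 1) N * nest s σ (k - (j + 1)) (j + 1) N) 0 := by
    intro j hj
    have hj := Finset.mem_range.1 hj
    obtain ⟨c, hc⟩ := hrexp (j + 1) (by omega)
    have hn := (logExp_nest (s := s) hσ (k - (j + 1)) (j + 1)).1
    have hg : PowO G (nest s σ (k - (j + 1)) (j + 1)) :=
      powO_nest hσO _ _ _ (Nat.cast_nonneg G) fun t ht => hG (j + 1) t (by omega)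
    set w := ∑ m ∈ Finset.range L, c m • logTerm (B (j + 1) - m, 0) with hw
    have h1 : LogExp (down (B (j + 1))) w :=
      LogExp.of_mem (Submodule.sum_mem _ fun m _ => Submodule.smul_mem _ _
        (logTerm_mem ⟨⟨m, rfl⟩, trivial⟩))
    have h2 : LogExp {x | ∃ y ∈ down (B (j + 1)), ∃ t ∈ nestExponents α (k - (j + 1)) (j + 1),
        x = y + t} (w * nest s σ (k - (j + 1)) (j + 1)) :=
      h1.mul hn fun x hx t ht => ⟨x, hx, t, ht, rfl⟩
    -- Every exponent of this product is B (j + 1 + i) minus a natural number, so the exponent 0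
    -- would make B (j + 1 + i) a natural number, which `hres` excludes.
    have h3 := h2.isFinitePart_zero (by
      rintro ⟨_, ⟨m, rfl⟩, _, ⟨i, hi, q, rfl⟩, h⟩
      refine hres (j + i) (by omega) (m + q) ?_
      rw [hB] at h
      rw [hB, show j + i + 1 = j + 1 + i by ring, Finset.sum_range_add]
      push_cast at h ⊢
      linear_combination -h)
    -- The remainder of the tail, of order Re B - L, tends to 0 even after multiplication by a
    -- nested sum of growth N^G.
    have h4 := isFinitePart_of_tendsto ((hc.mul hg).tendsto_zero (by
      have := hL (j + 1) (by omega)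
      linarith))
    have h5 := h3.add h4
    rw [add_zero] at h5
    convert h5 using 1
    funext N
    simp only [Pi.mul_apply, Pi.sub_apply]
    ring
  have h6 := (isFinitePart_sum_zero hterm).const_sub (r k 0)
  convert h6 using 1
  funext N
  rw [← sum_tail_mul_nest (s := s) h0 hr N, Finset.sum_range_succ', h0]
  simp

/-! ### Simple holomorphic families at the integers -/

section

variable {W : Set ℂ} {d : ℕ} {U : Set (Fin d → ℂ)}

theorem HolBdd.comp_apply {a : ℂ → ℂ} (ha : DifferentiableOn ℂ a W) {K : Set ℂ} (hK : IsCompact K)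
    (hKW : K ⊆ W) {i : Fin d} (hU : ∀ z ∈ U, z i ∈ K) : HolBdd U (fun z => a (z i)) := by
  refine ⟨ha.comp (differentiable_apply i).differentiableOn fun z hz => hKW (hU z hz), ?_⟩
  obtain ⟨C, hC⟩ := hK.exists_bound_of_continuousOn (ha.continuousOn.mono hKW)
  exact ⟨C, fun z hz => hC _ (hU z hz)⟩

theorem IsSimpleHolomorphicFamily.unifExp {α : ℂ → ℂ} {f : ℂ → ℝ → ℂ}
    (h : IsSimpleHolomorphicFamily W α f) {K : Set ℂ} (hK : IsCompact K) (hKW : K ⊆ W) {i : Fin d}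
    (hU : ∀ z ∈ U, z i ∈ K) (L : ℕ) :
    UnifExp U L (fun z => α (z i)) (fun z n => f (z i) n) := by
  obtain ⟨a, ha, hexp⟩ := h.expansion
  obtain ⟨C, hC⟩ := hexp L 0 K hKW hK
  have hab : ∀ j, HolBdd U (fun z => a j (z i)) := fun j => HolBdd.comp_apply (ha j) hK hKW hU
  have hfd : ∀ n : ℕ, DifferentiableOn ℂ (fun z : Fin d → ℂ => f (z i) n) U := by
    intro n
    have h1 := h.hol 0 n
    simp only [iteratedDeriv_zero] at h1
    exact h1.comp (differentiable_apply i).differentiableOn fun z hz => hKW (hU z hz)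
  refine UnifExp.of_sum (a := fun j z => a j (z i)) (HolBdd.comp_apply h.order_hol hK hKW hU).1 hab
    hfd ?_
  obtain ⟨D, hD⟩ := (HolBdd.sum (s := Finset.range L) fun j _ => hab j).2
  refine ⟨max |C| |D|, by positivity, fun z hz n => ?_⟩
  -- Symbol estimates say nothing at n = 0. There the symbol vanishes by its support and all powers
  -- are 1, so the remainder is minus a sum of bounded coefficients.
  rcases Nat.eq_zero_or_pos n with rfl | hn
  · have h0 : f (z i) 0 = 0 := by
      refine image_eq_zero_of_notMem_tsupport fun h1 => ?_
      exact lt_irrefl _ (Set.mem_Ioi.1 ((h.symbol _ (hKW (hU z hz))).support_pos h1))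
    simp only [Nat.cast_zero, h0, pw_at_zero, mul_one, zero_sub, norm_neg, epw_at_zero]
    exact (hD z hz).trans ((le_abs_self D).trans (le_max_right _ _))
  · have h1 := hC (z i) (hU z hz) n (by exact_mod_cast hn)
    have hn0 : n ≠ 0 := hn.ne'
    have h2 : ‖f (z i) n - ∑ j ∈ Finset.range L, a j (z i) * pw (α (z i) - j) n‖ ≤
        C * epw ((α (z i)).re - L) n := by
      simpa [epw_eq_rpow _ hn0, pw_eq_cpow _ hn0] using h1
    refine h2.trans (mul_le_mul_of_nonneg_right ?_ (epw_pos _ _).le)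
    exact (le_abs_self C).trans (le_max_left _ _)

end

/-! ### Local form of the cut-off nested sum near a point -/

section

variable {W : Set ℂ} {k : ℕ} {α : Fin k → ℂ → ℂ} {f : Fin k → ℂ → ℝ → ℂ}

theorem partialOrderSum_eq (α : Fin k → ℂ → ℂ) (j : Fin k) (z : Fin k → ℂ) :
    partialOrderSum α j z = ∑ i ∈ Finset.range (j + 1), extend (fun i => α i (z i)) i :=
  sum_Iic_eq_sum_range _ j

theorem mem_polarHypersurface_iff {j : Fin k} {m : ℕ} {z : Fin k → ℂ} :
    z ∈ polarHypersurface α j m ↔ partialOrderSum α j z + ((j : ℕ) + 1 : ℕ) = m := by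
  change partialOrderSum α j z = -((j : ℂ) + 1) + m ↔ _
  push_cast
  constructor <;> intro h
  · rw [h]; ring
  · rw [← h]; ring

theorem continuousAt_partialOrderSum (hW : IsOpen W) (hα : ∀ i, DifferentiableOn ℂ (α i) W)
    {p : Fin k → ℂ} (hp : ∀ i, p i ∈ W) (j : Fin k) : ContinuousAt (partialOrderSum α j) p := by
  refine tendsto_finsetSum _ fun i _ => ?_
  have h1 : ContinuousAt (α i) (p i) := ((hα i).differentiableAt (hW.mem_nhds (hp i))).continuousAt
  exact ContinuousAt.comp (g := α i) (f := fun z : Fin k → ℂ => z i) h1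
    (continuous_apply i).continuousAt

open Classical in
/-- The multiplicity at `p` of the hypersurfaces of index `j`. -/
def polarMult (α : Fin k → ℂ → ℂ) (p : Fin k → ℂ) (j : Fin k) : ℕ :=
  if ∃ m : ℕ, p ∈ polarHypersurface α j m then 1 else 0

theorem exists_polydisc (hW : IsOpen W) (hα : ∀ i, DifferentiableOn ℂ (α i) W)
    {p : Fin k → ℂ} (hp : ∀ i, p i ∈ W) {δ : Fin k → ℝ} (hδ : ∀ j, 0 < δ j) :
    ∃ r > 0, (∀ i, Metric.closedBall (p i) r ⊆ W) ∧ ∀ z ∈ Metric.ball p r, ∀ j,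
      ‖partialOrderSum α j z - partialOrderSum α j p‖ ≤ δ j := by
  have h1 : ∀ᶠ z in 𝓝 p, ∀ i, z i ∈ W := by
    rw [eventually_all]
    exact fun i => (continuous_apply i).continuousAt.eventually_mem (hW.mem_nhds (hp i))
  have h2 : ∀ᶠ z in 𝓝 p, ∀ j, ‖partialOrderSum α j z - partialOrderSum α j p‖ ≤ δ j := by
    rw [eventually_all]
    intro j
    have := (continuousAt_partialOrderSum hW hα hp j).eventually_mem
      (Metric.closedBall_mem_nhds _ (hδ j))
    filter_upwards [this] with z hz
    simpa [dist_eq_norm] using hz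
  obtain ⟨r, hr, hball⟩ := Metric.eventually_nhds_iff_ball.1 (h1.and h2)
  refine ⟨r / 2, half_pos hr, fun i t ht => ?_, fun z hz => ?_⟩
  · have := (hball (Function.update p i t) (update_mem_ball hr (Metric.mem_ball_self hr)
      (Metric.closedBall_subset_ball (half_lt_self hr) ht))).1 i
    simpa using this
  · exact (hball z (Metric.ball_subset_ball (half_le_self hr.le) hz)).2

/-- The numerator is the value at n = 0 of the last normalised tail, and the denominator is the
product of the factors H accumulated on the way, each occurring at most once. -/
theorem cutoffNestedSum_local (hW : IsOpen W) (hf : ∀ i, IsSimpleHolomorphicFamily W (α i) (f i))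
    (s : Version) {p : Fin k → ℂ} (hp : ∀ i, p i ∈ W) :
    ∃ g : (Fin k → ℂ) → ℂ, AnalyticAt ℂ g p ∧ ∀ᶠ z in 𝓝 p, z ∉ polarSet α →
      cutoffNestedSum s (fun i => f i (z i)) =
        g z / ∏ j, (partialOrderSum α j z - partialOrderSum α j p) ^ polarMult α p j := by
  classical
  -- On a small polydisc the only natural number that the j-th resonance quantity can approach is
  -- its value at p, if that value is natural.
  choose δ hδ hsep using fun j : Fin k =>
    exists_natCast_separation (partialOrderSum α j p + ((j : ℕ) + 1 : ℕ))
  obtain ⟨r, hr, hrW, hrδ⟩ := exists_polydisc hW (fun i => (hf i).order_hol) hp hδ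
  set U := Metric.ball p r with hU
  have hUK : ∀ z ∈ U, ∀ i, z i ∈ Metric.closedBall (p i) r := fun z hz i =>
    Metric.closedBall_subset_closedBall le_rfl ((dist_le_pi_dist z p i).trans (Metric.mem_ball.1 hz).le)
  have hUW : ∀ z ∈ U, ∀ i, z i ∈ W := fun z hz i => hrW i (hUK z hz i)
  set a : ℕ → (Fin k → ℂ) → ℂ := fun j z => extend (fun i => α i (z i)) j with ha
  set σ : ℕ → (Fin k → ℂ) → ℕ → ℂ := fun j z => extend (fun i (n : ℕ) => f i (z i) n) j with hσ
  set B : ℕ → (Fin k → ℂ) → ℂ := fun j z => ∑ i ∈ Finset.range j, a i z + j with hB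
  have hBA : ∀ (j : Fin k) z, B (j + 1) z = partialOrderSum α j z + ((j : ℕ) + 1 : ℕ) := fun j z => by
    rw [partialOrderSum_eq]
  have hab : ∀ j, HolBdd U (a j) := fun j => by
    by_cases hj : j < k
    · simp only [ha, extend, hj, dif_pos]
      exact HolBdd.comp_apply (hf _).order_hol (isCompact_closedBall _ _) (hrW _)
        fun z hz => hUK z hz _
    · simp only [ha, extend, hj, dif_neg, not_false_iff]
      exact HolBdd.const 0
  have hσe : ∀ L j, UnifExp U L (a j) (σ j) := fun L j => by
    by_cases hj : j < k
    · simp only [ha, hσ, extend, hj, dif_pos]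
      exact (hf _).unifExp (isCompact_closedBall _ _) (hrW _) (fun z hz => hUK z hz _) L
    · simp only [ha, hσ, extend, hj, dif_neg, not_false_iff]
      exact UnifExp.zero _
  obtain ⟨R, hR⟩ : ∃ R : ℕ, ∀ z ∈ U, ∀ j, (a j z).re ≤ R := by
    choose C hC using fun j : Fin k => (hab j).2
    obtain ⟨R, hR⟩ := exists_nat_ge (∑ j, |C j|)
    refine ⟨R, fun z hz j => ?_⟩
    by_cases hj : j < k
    · calc (a j z).re ≤ ‖a j z‖ := Complex.re_le_norm _
        _ ≤ C ⟨j, hj⟩ := hC ⟨j, hj⟩ z hz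
        _ ≤ |C ⟨j, hj⟩| := le_abs_self _
        _ ≤ ∑ j, |C j| := Finset.single_le_sum (f := fun j => |C j|) (fun _ _ => abs_nonneg _)
            (Finset.mem_univ _)
        _ ≤ R := hR
    · simp [ha, extend, hj]
  have hre : ∀ z ∈ U, ∀ j t : ℕ, t ≤ k →
      ∑ i ∈ Finset.range t, ((a (j + i) z).re + 1) ≤ k * (R + 1) := by
    intro z hz j t ht
    calc ∑ i ∈ Finset.range t, ((a (j + i) z).re + 1) ≤ ∑ i ∈ Finset.range t, ((R : ℝ) + 1) :=
          Finset.sum_le_sum fun i _ => by linarith [hR z hz (j + i)]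
      _ = t * (R + 1) := by rw [Finset.sum_const, Finset.card_range, nsmul_eq_mul]
      _ ≤ k * (R + 1) := by
          have : (t : ℝ) ≤ k := by exact_mod_cast ht
          nlinarith [(Nat.cast_nonneg R : (0 : ℝ) ≤ R)]
  have hBre : ∀ z ∈ U, ∀ j ≤ k, (B j z).re ≤ k * (R + 1) := by
    intro z hz j hj
    refine le_trans (le_of_eq ?_) (hre z hz 0 j hj)
    simp [hB, Finset.sum_add_distrib]
  -- G exceeds the growth exponents of all inner nested sums and the real parts of all B j. With 2 G
  -- + 1 terms the tails exist, and their remainders still beat the nested sums.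
  set G : ℕ := k * (R + 1) + 1 with hG
  set L : ℕ := 2 * G + 1 with hL
  have hLr : (L : ℝ) = 2 * (k * (R + 1) + 1) + 1 := by rw [hL, hG]; push_cast; ring
  have hkR : (0 : ℝ) ≤ k * (R + 1) := by positivity
  set H : ℕ → (Fin k → ℂ) → ℂ := fun j =>
    if ∃ m : ℕ, B (j + 1) p = m then fun z => B (j + 1) z - B (j + 1) p else fun _ => 1 with hH
  obtain ⟨v, hv0, hv, hvr⟩ := exists_tails (H := H) (k := k) (L := L) s Metric.isOpen_ball hab (hσe L)
    (fun _ _ => rfl) (fun j hj z hz => by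
      have := hBre z hz (j + 1) (by omega)
      rw [hLr]
      linarith)
    (fun j hj => by
      refine ⟨δ ⟨j, hj⟩, hδ _, ?_⟩
      have hs : ∀ z ∈ U, ∀ m : ℕ, (m : ℂ) ≠ B (j + 1) p → δ ⟨j, hj⟩ ≤ ‖B (j + 1) z - m‖ := by
        intro z hz m hm
        refine hsep ⟨j, hj⟩ (B (j + 1) z) ?_ m (by rwa [← hBA ⟨j, hj⟩])
        rw [← hBA ⟨j, hj⟩]
        have := hrδ z hz ⟨j, hj⟩
        have e1 := hBA ⟨j, hj⟩ z
        have e2 := hBA ⟨j, hj⟩ p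
        simp only at e1 e2
        rw [e1, e2, add_sub_add_right_eq_sub]
        exact this
      by_cases hres : ∃ m : ℕ, B (j + 1) p = m
      · obtain ⟨J, hJ⟩ := hres
        refine Or.inr ⟨J, fun z hz m hm => hs z hz m ?_, ?_⟩
        · rw [hJ]
          exact_mod_cast hm
        · simp only [hH]
          rw [if_pos ⟨J, hJ⟩, hJ]
      · refine Or.inl ⟨fun z hz m => hs z hz m fun h => hres ⟨m, h.symm⟩, ?_⟩
        simp only [hH]
        rw [if_neg hres])
  refine ⟨fun z => v k z 0, analyticAt_of_differentiableOn Metric.isOpen_ball ((hv k le_rfl).hol 0)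
    (Metric.mem_ball_self hr), ?_⟩
  filter_upwards [Metric.ball_mem_nhds p hr] with z hz hzp
  have hnres : ∀ j < k, ∀ m : ℕ, B (j + 1) z ≠ m := by
    intro j hj m h
    refine hzp ?_
    simp only [polarSet, Set.mem_iUnion]
    refine ⟨⟨j, hj⟩, m, mem_polarHypersurface_iff.2 ?_⟩
    rw [← hBA ⟨j, hj⟩]
    exact h
  have hH0 : ∀ j < k, H j z ≠ 0 := by
    intro j hj
    simp only [hH]
    split_ifs with h
    · obtain ⟨m, hm⟩ := h
      rw [hm]
      exact sub_ne_zero.2 (hnres j hj m)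
    · exact one_ne_zero
  -- Off the polar set the accumulated factors are nonzero, and dividing by them restores the
  -- recursion satisfied by the regularised tails.
  set P : ℕ → ℂ := fun j => ∏ i ∈ Finset.range j, H i z with hP
  have hP0 : ∀ j ≤ k, P j ≠ 0 := fun j hj =>
    Finset.prod_ne_zero_iff.2 fun i hi => hH0 i (by have := Finset.mem_range.1 hi; omega)
  have hsym : ∀ i, IsClassicalSymbol (α i (z i)) (f i (z i)) := fun i =>
    (hf i).symbol _ (hUW z hz i)
  have hfp := isFinitePart_nest (s := s) (σ := fun j => σ j z) (α := fun j => a j z) (k := k)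
    (L := L) (G := G) (B := fun j => B j z) (r := fun j n => v j z n / P j)
    (fun j => logExp_extend hsym j) (fun j => by
      obtain ⟨C, hC, h⟩ := (hσe 0 j).bound
      exact ⟨C, hC, h z hz⟩)
    (fun j t ht => by
      refine (hre z hz j (t + 1) (by omega)).trans_lt ?_
      rw [hG]
      push_cast
      linarith) (fun _ => rfl)
    (fun j hj => by
      have := hBre z hz j hj
      rw [hLr, hG]
      push_cast
      linarith)
    (fun n => by simp [hv0, hP])
    (fun j hj n => by
      have h1 := hvr j hj z hz n
      have h2 := hP0 j hj.le
      have h3 := hH0 j hj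
      have h4 : P (j + 1) = P j * H j z := Finset.prod_range_succ _ _
      simp only [h4]
      field_simp
      linear_combination h1)
    (fun j hj => by
      obtain ⟨c, C, hc⟩ := (hv j hj).exists_sum hz
      refine ⟨fun m => (P j)⁻¹ * c m, ?_⟩
      have h1 : PowO ((B j z).re - L)
          ((fun n => v j z n) - ∑ m ∈ Finset.range L, c m • logTerm (B j z - m, 0)) :=
        PowO.of_le (C := C) fun n => by simpa [logTerm, hB] using hc n
      convert h1.smul (P j)⁻¹ using 1
      funext n
      simp only [Pi.sub_apply, Pi.smul_apply, Finset.sum_apply, smul_eq_mul, mul_sub,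
        Finset.mul_sum, div_eq_inv_mul, mul_assoc])
    hnres
  rw [cutoffNestedSum, truncatedNestedSum_eq_nest_extend, hfp.finitePart_eq]
  congr 1
  rw [hP]
  simp only
  rw [Finset.prod_range]
  refine Finset.prod_congr rfl fun j _ => ?_
  simp only [hH, polarMult]
  have hiff : (∃ m : ℕ, B (j + 1) p = m) ↔ ∃ m : ℕ, p ∈ polarHypersurface α j m :=
    exists_congr fun m => by rw [mem_polarHypersurface_iff, ← hBA]
  by_cases h : ∃ m : ℕ, B (j + 1) p = m
  · rw [if_pos h, if_pos (hiff.1 h), pow_one, hBA, hBA, add_sub_add_right_eq_sub]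
  · rw [if_neg h, if_neg (fun h' => h (hiff.2 h')), pow_zero]

theorem polarMult_le_one (α : Fin k → ℂ → ℂ) (p : Fin k → ℂ) (j : Fin k) : polarMult α p j ≤ 1 := by
  unfold polarMult
  split_ifs <;> simp

theorem polarMult_eq_zero {p : Fin k → ℂ} {j : Fin k} (h : ∀ m : ℕ, p ∉ polarHypersurface α j m) :
    polarMult α p j = 0 := by
  rw [polarMult, if_neg]
  rintro ⟨m, hm⟩
  exact h m hm

theorem sum_polarMult_le {p : Fin k → ℂ} {M : ℕ}
    (h : ∀ j, polarMult α p j ≠ 0 → (j : ℕ) + 1 ≤ M) : ∑ j, polarMult α p j ≤ M := by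
  classical
  calc ∑ j, polarMult α p j = ∑ j ∈ Finset.univ.filter (fun j => polarMult α p j ≠ 0),
        polarMult α p j := (Finset.sum_filter_ne_zero _).symm
    _ ≤ ∑ j ∈ Finset.univ.filter (fun j => polarMult α p j ≠ 0), 1 :=
        Finset.sum_le_sum fun j _ => polarMult_le_one α p j
    _ = ((Finset.univ.filter (fun j => polarMult α p j ≠ 0)).map Fin.valEmbedding).card := by simp
    _ ≤ (Finset.range M).card := by
        refine Finset.card_le_card fun x hx => ?_
        simp only [Finset.mem_map, Finset.mem_filter, Finset.mem_univ, true_and] at hx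
        obtain ⟨j, hj, rfl⟩ := hx
        have := h j hj
        simp only [Fin.valEmbedding_apply, Finset.mem_range]
        omega
    _ = M := Finset.card_range M

end

/-! ### The polar set -/

/-- Near t₀ the only natural number within reach of h is h t₀, and the nonzero derivative keeps h
off its own value at t₀. -/
theorem eventually_ne_natCast {h : ℂ → ℂ} {h' t₀ : ℂ} (hd : HasDerivAt h h' t₀) (hh : h' ≠ 0) :
    ∀ᶠ t in 𝓝[≠] t₀, ∀ m : ℕ, h t ≠ m := by
  obtain ⟨δ, hδ, hsep⟩ := exists_natCast_separation (h t₀)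
  have h1 : ∀ᶠ t in 𝓝[≠] t₀, h t ∈ Metric.closedBall (h t₀) δ :=
    (hd.continuousAt.eventually_mem (Metric.closedBall_mem_nhds _ hδ)).filter_mono nhdsWithin_le_nhds
  filter_upwards [h1, hd.eventually_ne (c := h t₀) hh] with t ht hne m hm
  rw [Metric.mem_closedBall, dist_eq_norm] at ht
  have := hsep (h t) ht m (by rw [← hm]; exact hne)
  rw [hm, sub_self, norm_zero] at this
  linarith

section

variable {W : Set ℂ} {k : ℕ} {α : Fin k → ℂ → ℂ} {f : Fin k → ℂ → ℝ → ℂ}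

/-- A curve along which all the partial sums of the orders have nonzero derivative meets the polar
set at most at isolated points. -/
theorem eventually_notMem_polarSet {c : ℂ → Fin k → ℂ} {t₀ : ℂ}
    (h : ∀ j, ∃ h' ≠ 0, HasDerivAt (fun t => partialOrderSum α j (c t)) h' t₀) :
    ∀ᶠ t in 𝓝[≠] t₀, c t ∉ polarSet α := by
  have h1 : ∀ᶠ t in 𝓝[≠] t₀, ∀ (j : Fin k) (m : ℕ),
      partialOrderSum α j (c t) + ((j : ℕ) + 1 : ℕ) ≠ m := by
    rw [eventually_all]
    intro j
    obtain ⟨h', h0, hd⟩ := h j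
    exact eventually_ne_natCast (hd.add_const _) h0
  filter_upwards [h1] with t ht hmem
  simp only [polarSet, Set.mem_iUnion] at hmem
  obtain ⟨j, m, hm⟩ := hmem
  exact ht j m (mem_polarHypersurface_iff.1 hm)

/-- It suffices to move the first variable: α_1 occurs in every partial sum, so each of them has the
nonzero derivative α_1'(p_1) along this line. -/
theorem subset_closure_compl_polarSet (hW : IsOpen W) (hd : ∀ i, DifferentiableOn ℂ (α i) W)
    (hα : ∀ j : Fin k, ∀ z ∈ W, (∑ i ∈ Finset.Iic j, deriv (α i) z).re < 0) :
    {z : Fin k → ℂ | ∀ i, z i ∈ W} ⊆ closure ({z | ∀ i, z i ∈ W} \ polarSet α) := by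
  intro p hp
  rcases k with _ | k
  · refine subset_closure ⟨hp, ?_⟩
    simp [polarSet]
  · have hda : ∀ i, HasDerivAt (α i) (deriv (α i) (p i)) (p i) := fun i =>
      ((hd i).differentiableAt (hW.mem_nhds (hp i))).hasDerivAt
    have h0 : deriv (α 0) (p 0) ≠ 0 := by
      intro h
      have := hα 0 (p 0) (hp 0)
      rw [show Finset.Iic (0 : Fin (k + 1)) = {0} from by ext i; simp, Finset.sum_singleton, h] at this
      simp at this
    have h1 : ∀ᶠ t in 𝓝[≠] (p 0), Function.update p 0 t ∉ polarSet α := by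
      refine eventually_notMem_polarSet fun j => ⟨deriv (α 0) (p 0), h0, ?_⟩
      have h2 : HasDerivAt (fun t => ∑ i ∈ Finset.Iic j, α i (Function.update p 0 t i))
          (∑ i ∈ Finset.Iic j, if i = 0 then deriv (α 0) (p 0) else 0) (p 0) := by
        refine HasDerivAt.fun_sum fun i _ => ?_
        by_cases hi : i = 0
        · subst hi
          simpa using hda 0
        · simpa [hi] using hasDerivAt_const (p 0) (α i (p i))
      rw [Finset.sum_ite_eq' (Finset.Iic j) 0 fun _ => deriv (α 0) (p 0),
        if_pos (Finset.mem_Iic.2 (Fin.zero_le j))] at h2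
      exact h2
    have h2 : ∀ᶠ t in 𝓝[≠] (p 0), ∀ i, Function.update p 0 t i ∈ W := by
      have : ∀ᶠ t in 𝓝[≠] (p 0), t ∈ W :=
        (hW.eventually_mem (hp 0)).filter_mono nhdsWithin_le_nhds
      filter_upwards [this] with t ht i
      by_cases hi : i = 0
      · subst hi
        simpa using ht
      · simpa [hi] using hp i
    have h3 : Tendsto (fun t => Function.update p 0 t) (𝓝[≠] (p 0)) (𝓝 p) := by
      have : Tendsto (fun t => Function.update p 0 t) (𝓝 (p 0)) (𝓝 (Function.update p 0 (p 0))) :=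
        (hasDerivAt_update p 0 (p 0)).continuousAt
      rw [Function.update_eq_self] at this
      exact this.mono_left nhdsWithin_le_nhds
    exact mem_closure_of_tendsto h3 (by
      filter_upwards [h1, h2] with t ht1 ht2 using ⟨ht2, ht1⟩)

theorem isMeromorphicWithPoles_cutoffNestedSum (hW : IsOpen W)
    (hf : ∀ i, IsSimpleHolomorphicFamily W (α i) (f i))
    (hα : ∀ j : Fin k, ∀ z ∈ W, (∑ i ∈ Finset.Iic j, deriv (α i) z).re < 0) (s : Version) :
    IsMeromorphicWithPoles α {z | ∀ i, z i ∈ W}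
      (fun z => cutoffNestedSum s (fun i => f i (z i))) := by
  refine ⟨subset_closure_compl_polarSet hW (fun i => (hf i).order_hol) hα, fun p hp => ?_⟩
  exact ⟨polarMult α p, fun j => (polarMult_le_one α p j).trans (by omega),
    fun j hj => polarMult_eq_zero hj, fun M hM => sum_polarMult_le hM,
    cutoffNestedSum_local hW hf s hp⟩

/-! ### The diagonal -/

theorem tendsto_diagonal (z₀ : ℂ) :
    Tendsto (fun z : ℂ => (fun _ : Fin k => z)) (𝓝 z₀) (𝓝 fun _ => z₀) :=
  (continuous_pi fun _ => continuous_id).tendsto z₀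

/-- On the diagonal each divisor is z - z₀ times `dslope`, whose value at z₀ is the derivative of
the partial sum and has negative real part. The divisors thus combine to (z - z₀)^N times a unit, N
being the number of resonant indices. -/
theorem meromorphicAt_diagonal (hW : IsOpen W)
    (hf : ∀ i, IsSimpleHolomorphicFamily W (α i) (f i))
    (hα : ∀ j : Fin k, ∀ z ∈ W, (∑ i ∈ Finset.Iic j, deriv (α i) z).re < 0) (s : Version) {z₀ : ℂ}
    (hz₀ : z₀ ∈ W) :
    MeromorphicAt (fun z => cutoffNestedSum s (fun i => f i z)) z₀ ∧
      ((-(k : ℤ) : ℤ) : WithTop ℤ) ≤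
        meromorphicOrderAt (fun z => cutoffNestedSum s (fun i => f i z)) z₀ := by
  set p : Fin k → ℂ := fun _ => z₀ with hp
  obtain ⟨g, hg, hev⟩ := cutoffNestedSum_local hW hf s (p := p) fun _ => hz₀
  have hda : ∀ i, AnalyticAt ℂ (α i) z₀ := fun i =>
    (hf i).order_hol.analyticAt (hW.mem_nhds hz₀)
  set h : Fin k → ℂ → ℂ := fun j z => partialOrderSum α j fun _ => z with hh
  have hhan : ∀ j, AnalyticAt ℂ (h j) z₀ := fun j =>
    Finset.analyticAt_fun_sum _ fun i _ => hda i
  have hhd : ∀ j, HasDerivAt (h j) (∑ i ∈ Finset.Iic j, deriv (α i) z₀) z₀ := fun j =>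
    HasDerivAt.fun_sum fun i _ => (hda i).differentiableAt.hasDerivAt
  have hne : ∀ j : Fin k, ∑ i ∈ Finset.Iic j, deriv (α i) z₀ ≠ 0 := fun j h0 => by
    have := hα j z₀ hz₀
    rw [h0] at this
    simp at this
  have hq : ∀ j, AnalyticAt ℂ (dslope (h j) z₀) z₀ := fun j => by
    obtain ⟨q, hq⟩ := hhan j
    exact hq.has_fpower_series_dslope_fslope.analyticAt
  have hq0 : ∀ j, dslope (h j) z₀ z₀ ≠ 0 := fun j => by
    rw [dslope_same, (hhd j).deriv]
    exact hne j
  set N : ℕ := ∑ j, polarMult α p j with hN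
  have hNk : N ≤ k := sum_polarMult_le fun j _ => j.2
  set G : ℂ → ℂ := fun z => g (fun _ => z) / ∏ j, dslope (h j) z₀ z ^ polarMult α p j with hG
  have hGan : AnalyticAt ℂ G z₀ := by
    refine AnalyticAt.div ?_ (Finset.analyticAt_fun_prod _ fun j _ => (hq j).pow _)
      (Finset.prod_ne_zero_iff.2 fun j _ => pow_ne_zero _ (hq0 j))
    have hdiag : AnalyticAt ℂ (fun z : ℂ => (fun _ : Fin k => z)) z₀ :=
      AnalyticAt.pi fun _ => analyticAt_id
    exact AnalyticAt.fun_comp (g := g) (f := fun z : ℂ => (fun _ : Fin k => z)) hg hdiag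
  have heq : (fun z => cutoffNestedSum s (fun i => f i z)) =ᶠ[𝓝[≠] z₀]
      fun z => (z - z₀) ^ (-(N : ℤ)) * G z := by
    have h1 := eventually_notMem_polarSet (α := α) (c := fun z => fun _ => z) (t₀ := z₀)
      fun j => ⟨_, hne j, hhd j⟩
    have hdiag : Tendsto (fun z : ℂ => (fun _ : Fin k => z)) (𝓝[≠] z₀) (𝓝 p) :=
      (tendsto_diagonal z₀).mono_left nhdsWithin_le_nhds
    have h2 := hdiag.eventually hev
    filter_upwards [h1, h2, self_mem_nhdsWithin] with z hz1 hz2 hz3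
    have hz : z - z₀ ≠ 0 := sub_ne_zero.2 hz3
    rw [hz2 hz1, hG]
    have e1 : ∀ j, partialOrderSum α j (fun _ => z) - partialOrderSum α j p =
        (z - z₀) * dslope (h j) z₀ z := fun j => by
      have := sub_smul_dslope (h j) z₀ z
      rw [smul_eq_mul] at this
      rw [this]
    simp only [e1, mul_pow, Finset.prod_mul_distrib, Finset.prod_pow_eq_pow_sum, ← hN, zpow_neg,
      zpow_natCast]
    rw [div_mul_eq_div_div, div_right_comm, div_eq_inv_mul]
  have hpow : MeromorphicAt (fun z : ℂ => (z - z₀) ^ (-(N : ℤ))) z₀ :=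
    ((MeromorphicAt.id z₀).sub (MeromorphicAt.const z₀ z₀)).zpow _
  have hmer : MeromorphicAt (fun z => (z - z₀) ^ (-(N : ℤ)) * G z) z₀ := hpow.mul hGan.meromorphicAt
  refine ⟨hmer.congr heq.symm, ?_⟩
  rw [meromorphicOrderAt_congr heq]
  have h3 := meromorphicOrderAt_mul hpow hGan.meromorphicAt
  have h4 : meromorphicOrderAt (fun z : ℂ => (z - z₀) ^ (-(N : ℤ))) z₀ = ((-(N : ℤ) : ℤ) : WithTop ℤ) := by
    rw [meromorphicOrderAt_eq_int_iff hpow]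
    exact ⟨fun _ => 1, analyticAt_const, one_ne_zero, by simp⟩
  have h5 := hGan.meromorphicOrderAt_nonneg
  calc ((-(k : ℤ) : ℤ) : WithTop ℤ) ≤ ((-(N : ℤ) : ℤ) : WithTop ℤ) := by
        exact_mod_cast neg_le_neg (by exact_mod_cast hNk)
    _ = ((-(N : ℤ) : ℤ) : WithTop ℤ) + 0 := (add_zero _).symm
    _ ≤ ((-(N : ℤ) : ℤ) : WithTop ℤ) + meromorphicOrderAt G z₀ := by gcongr
    _ = _ := by rw [← h4]; exact h3.symm

/-! ### The convergent case -/

/-- The hypersurface of index j lies in the region where the real part of the partial sum is at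
least -j, so a full neighbourhood avoids the polar set. The local form then has no denominator and
no exceptional points, z₀ included. -/
theorem analyticAt_cutoffNestedSum (hW : IsOpen W)
    (hf : ∀ i, IsSimpleHolomorphicFamily W (α i) (f i)) (s : Version) {z₀ : ℂ} (hz₀ : z₀ ∈ W)
    (hconv : ConvergentOrders fun i => α i z₀) :
    AnalyticAt ℂ (fun z => cutoffNestedSum s (fun i => f i z)) z₀ := by
  set p : Fin k → ℂ := fun _ => z₀ with hp
  obtain ⟨g, hg, hev⟩ := cutoffNestedSum_local hW hf s (p := p) fun _ => hz₀
  have hnot : ∀ (j : Fin k) (z : Fin k → ℂ), (partialOrderSum α j z).re < -((j : ℝ) + 1) →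
      ∀ m : ℕ, z ∉ polarHypersurface α j m := by
    intro j z hz m hm
    have h1 : partialOrderSum α j z = -((j : ℂ) + 1) + m := hm
    rw [h1] at hz
    simp at hz
    have : (0 : ℝ) ≤ m := m.cast_nonneg
    linarith
  have hmult : ∀ j, polarMult α p j = 0 := fun j => polarMult_eq_zero (hnot j p (hconv j))
  have hpol : ∀ᶠ z in 𝓝 p, z ∉ polarSet α := by
    have h1 : ∀ᶠ z in 𝓝 p, ∀ j : Fin k, (partialOrderSum α j z).re < -((j : ℝ) + 1) := by
      rw [eventually_all]
      intro j
      have h2 := Complex.continuous_re.continuousAt.comp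
        (continuousAt_partialOrderSum hW (fun i => (hf i).order_hol) (p := p) (fun _ => hz₀) j)
      exact h2.eventually_lt continuousAt_const (hconv j)
    filter_upwards [h1] with z hz hmem
    simp only [polarSet, Set.mem_iUnion] at hmem
    obtain ⟨j, m, hm⟩ := hmem
    exact hnot j z (hz j) m hm
  have hdiag : AnalyticAt ℂ (fun z : ℂ => (fun _ : Fin k => z)) z₀ :=
    AnalyticAt.pi fun _ => analyticAt_id
  refine (AnalyticAt.fun_comp (g := g) (f := fun z : ℂ => (fun _ : Fin k => z)) hg hdiag).congr ?_
  filter_upwards [(tendsto_diagonal (k := k) z₀).eventually hpol,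
    (tendsto_diagonal (k := k) z₀).eventually hev] with z h1 h2
  rw [h2 h1]
  simp [hmult]

end

/-! ### Uniqueness of the constant Laurent coefficient -/

theorem eq_zero_of_principalPart (n : ℕ) : ∀ (b : ℕ → ℂ) (h : ℂ → ℂ) (z₀ : ℂ), ContinuousAt h z₀ →
    (∀ᶠ z in 𝓝[≠] z₀, ∑ i ∈ Finset.range n, b i / (z - z₀) ^ (i + 1) = h z) → h z₀ = 0 := by
  induction n with
  | zero =>
    intro b h z₀ hc hev
    have h1 : Tendsto h (𝓝[≠] z₀) (𝓝 (h z₀)) := hc.mono_left nhdsWithin_le_nhds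
    refine tendsto_nhds_unique h1 (tendsto_const_nhds.congr' ?_)
    filter_upwards [hev] with z hz
    simpa using hz
  | succ n ih =>
    intro b h z₀ hc hev
    refine ih b h z₀ hc ?_
    have hsub : Tendsto (fun z => z - z₀) (𝓝[≠] z₀) (𝓝 0) := by
      have : Tendsto (fun z => z - z₀) (𝓝 z₀) (𝓝 (z₀ - z₀)) := (continuous_sub_right z₀).tendsto z₀
      rw [sub_self] at this
      exact this.mono_left nhdsWithin_le_nhds
    -- Multiplication by (z - z₀)^(n+1) isolates the top coefficient b n in the limit; it is 0
    -- because h stays bounded near z₀.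
    have h1 : Tendsto (fun z => (z - z₀) ^ (n + 1) * h z -
        ∑ i ∈ Finset.range n, b i * (z - z₀) ^ (n - i)) (𝓝[≠] z₀)
        (𝓝 (0 ^ (n + 1) * h z₀ - ∑ i ∈ Finset.range n, b i * 0 ^ (n - i))) :=
      ((hsub.pow _).mul (hc.mono_left nhdsWithin_le_nhds)).sub
        (tendsto_finsetSum _ fun i _ => (hsub.pow _).const_mul _)
    have h2 : (0 : ℂ) ^ (n + 1) * h z₀ - ∑ i ∈ Finset.range n, b i * 0 ^ (n - i) = 0 := by
      rw [Finset.sum_eq_zero fun i hi => by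
        rw [zero_pow (by have := Finset.mem_range.1 hi; omega), mul_zero]]
      simp
    rw [h2] at h1
    have hb : b n = 0 := by
      refine tendsto_nhds_unique (tendsto_const_nhds.congr' ?_) h1
      filter_upwards [hev, self_mem_nhdsWithin] with z hz hz0
      have hz0 : z - z₀ ≠ 0 := sub_ne_zero.2 hz0
      rw [← hz, Finset.sum_range_succ, mul_add, mul_div_cancel₀ _ (pow_ne_zero _ hz0),
        Finset.mul_sum, add_sub_right_comm, ← Finset.sum_sub_distrib, Finset.sum_eq_zero, zero_add]
      intro i hi
      have e : n + 1 = (n - i) + (i + 1) := by have := Finset.mem_range.1 hi; omega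
      rw [e, pow_add]
      field_simp
      simp
    filter_upwards [hev] with z hz
    rw [← hz, Finset.sum_range_succ, hb, zero_div, add_zero]

theorem IsLaurentFinitePart.unique {f : ℂ → ℂ} {z₀ c e : ℂ} (hc : IsLaurentFinitePart f z₀ c)
    (he : IsLaurentFinitePart f z₀ e) : c = e := by
  obtain ⟨n, b, g, hg, rfl, h1⟩ := hc
  obtain ⟨n', b', g', hg', rfl, h2⟩ := he
  have key : ∀ (n N : ℕ) (b : ℕ → ℂ) (z : ℂ), n ≤ N →
      ∑ i ∈ Finset.range n, b i / (z - z₀) ^ (i + 1) =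
        ∑ i ∈ Finset.range N, (if i < n then b i else 0) / (z - z₀) ^ (i + 1) := by
    intro n N b z hnN
    rw [← Finset.sum_subset (Finset.range_mono hnN)]
    · refine Finset.sum_congr rfl fun i hi => ?_
      rw [if_pos (Finset.mem_range.1 hi)]
    · intro i _ hi
      rw [if_neg (by simpa using hi), zero_div]
  have := eq_zero_of_principalPart (max n n')
    (fun i => (if i < n' then b' i else 0) - (if i < n then b i else 0)) (fun z => g z - g' z) z₀
    (hg.continuousAt.sub hg'.continuousAt) (by
      filter_upwards [h1, h2] with z e1 e2
      rw [key n _ b z (le_max_left _ _)] at e1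
      rw [key n' _ b' z (le_max_right _ _)] at e2
      simp only [sub_div, Finset.sum_sub_distrib]
      linear_combination e1 - e2)
  exact sub_eq_zero.1 this

theorem laurentFinitePart_of_analyticAt {f : ℂ → ℂ} {z₀ : ℂ} (hf : AnalyticAt ℂ f z₀) :
    laurentFinitePart f z₀ = f z₀ := by
  have h : IsLaurentFinitePart f z₀ (f z₀) := ⟨0, 0, f, hf, rfl, by simp⟩
  have hex : ∃ c, IsLaurentFinitePart f z₀ c := ⟨_, h⟩
  rw [laurentFinitePart, dif_pos hex]
  exact hex.choose_spec.unique h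

/-! ### Quasi-shuffles -/

section

variable {k l m : ℕ}

theorem mem_quasiShuffles {π : Fin k ⊕ Fin l → Fin m} : π ∈ quasiShuffles k l m ↔
    Function.Surjective π ∧ StrictMono (fun i => π (Sum.inl i)) ∧
      StrictMono (fun i => π (Sum.inr i)) := by
  simp [quasiShuffles]

/-- The quasi-shuffle putting the first letter of the first word in front. -/
def consLeft (π : Fin k ⊕ Fin l → Fin m) : Fin (k + 1) ⊕ Fin l → Fin (m + 1) :=
  Sum.elim (Fin.cons 0 fun i => (π (Sum.inl i)).succ) fun i => (π (Sum.inr i)).succ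

/-- The quasi-shuffle putting the first letter of the second word in front. -/
def consRight (π : Fin k ⊕ Fin l → Fin m) : Fin k ⊕ Fin (l + 1) → Fin (m + 1) :=
  Sum.elim (fun i => (π (Sum.inl i)).succ) (Fin.cons 0 fun i => (π (Sum.inr i)).succ)

/-- The quasi-shuffle putting the product of the first letters of both words in front. -/
def consBoth (π : Fin k ⊕ Fin l → Fin m) : Fin (k + 1) ⊕ Fin (l + 1) → Fin (m + 1) :=
  Sum.elim (Fin.cons 0 fun i => (π (Sum.inl i)).succ) (Fin.cons 0 fun i => (π (Sum.inr i)).succ)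

theorem strictMono_succ_comp {f : Fin k → Fin m} :
    StrictMono (fun i => (f i).succ) ↔ StrictMono f := by
  simp [StrictMono, Fin.succ_lt_succ_iff]

theorem strictMono_cons_zero {f : Fin k → Fin m} :
    StrictMono (Fin.cons (α := fun _ => Fin (m + 1)) 0 fun i => (f i).succ) ↔ StrictMono f := by
  simp [StrictMono, Fin.forall_fin_succ, Fin.succ_lt_succ_iff]

theorem consLeft_mem {π : Fin k ⊕ Fin l → Fin m} :
    consLeft π ∈ quasiShuffles (k + 1) l (m + 1) ↔ π ∈ quasiShuffles k l m := by
  simp only [mem_quasiShuffles, consLeft, Sum.elim_inl, Sum.elim_inr]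
  refine and_congr ?_ (and_congr strictMono_cons_zero strictMono_succ_comp)
  simp [Function.Surjective, Fin.forall_fin_succ, Fin.exists_fin_succ,
    fun i : Fin m => (Fin.succ_ne_zero i).symm]

theorem consRight_mem {π : Fin k ⊕ Fin l → Fin m} :
    consRight π ∈ quasiShuffles k (l + 1) (m + 1) ↔ π ∈ quasiShuffles k l m := by
  simp only [mem_quasiShuffles, consRight, Sum.elim_inl, Sum.elim_inr]
  refine and_congr ?_ (and_congr strictMono_succ_comp strictMono_cons_zero)
  simp [Function.Surjective, Fin.forall_fin_succ, Fin.exists_fin_succ,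
    fun i : Fin m => (Fin.succ_ne_zero i).symm]

theorem consBoth_mem {π : Fin k ⊕ Fin l → Fin m} :
    consBoth π ∈ quasiShuffles (k + 1) (l + 1) (m + 1) ↔ π ∈ quasiShuffles k l m := by
  simp only [mem_quasiShuffles, consBoth, Sum.elim_inl, Sum.elim_inr]
  refine and_congr ?_ (and_congr strictMono_cons_zero strictMono_cons_zero)
  simp [Function.Surjective, Fin.forall_fin_succ, Fin.exists_fin_succ,
    fun i : Fin m => (Fin.succ_ne_zero i).symm]

theorem consLeft_injective : Function.Injective (consLeft (k := k) (l := l) (m := m)) := by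
  intro π ρ h
  funext x
  rcases x with i | i
  · simpa [consLeft] using congrFun h (Sum.inl i.succ)
  · simpa [consLeft] using congrFun h (Sum.inr i)

theorem consRight_injective : Function.Injective (consRight (k := k) (l := l) (m := m)) := by
  intro π ρ h
  funext x
  rcases x with i | i
  · simpa [consRight] using congrFun h (Sum.inl i)
  · simpa [consRight] using congrFun h (Sum.inr i.succ)

theorem consBoth_injective : Function.Injective (consBoth (k := k) (l := l) (m := m)) := by
  intro π ρ h
  funext x
  rcases x with i | i
  · simpa [consBoth] using congrFun h (Sum.inl i.succ)
  · simpa [consBoth] using congrFun h (Sum.inr i.succ)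

theorem exists_succ_of_strictMono {f : Fin (k + 1) → Fin (m + 1)} (hf : StrictMono f) :
    ∃ g : Fin k → Fin m, ∀ i, f i.succ = (g i).succ := by
  have : ∀ i : Fin k, ∃ j : Fin m, f i.succ = j.succ := fun i => by
    obtain ⟨j, hj⟩ := Fin.exists_succ_eq.2 ((Fin.zero_le _).trans_lt (hf (Fin.succ_pos i))).ne'
    exact ⟨j, hj.symm⟩
  exact ⟨fun i => (this i).choose, fun i => (this i).choose_spec⟩

theorem exists_succ_of_strictMono_of_ne {f : Fin (k + 1) → Fin (m + 1)} (hf : StrictMono f)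
    (h0 : f 0 ≠ 0) : ∃ g : Fin (k + 1) → Fin m, ∀ i, f i = (g i).succ := by
  have : ∀ i, ∃ j : Fin m, f i = j.succ := fun i => by
    obtain ⟨j, hj⟩ := Fin.exists_succ_eq.2
      ((Fin.pos_of_ne_zero h0).trans_le (hf.monotone (Fin.zero_le i))).ne'
    exact ⟨j, hj.symm⟩
  exact ⟨fun i => (this i).choose, fun i => (this i).choose_spec⟩

-- Surjectivity and monotonicity force the first letter of at least one of the words into position
-- 0. The three parts are the cases of the first word only, the second only, and both.
open Classical in
theorem quasiShuffles_succ (k l m : ℕ) : quasiShuffles (k + 1) (l + 1) (m + 1) =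
    ((quasiShuffles k (l + 1) m).image consLeft ∪ (quasiShuffles (k + 1) l m).image consRight) ∪
      (quasiShuffles k l m).image consBoth := by
  ext ρ
  simp only [Finset.mem_union, Finset.mem_image]
  constructor
  · intro h
    have ⟨hs, hl, hr⟩ := mem_quasiShuffles.1 h
    obtain ⟨f, hf⟩ := exists_succ_of_strictMono hl
    obtain ⟨g, hg⟩ := exists_succ_of_strictMono hr
    by_cases hl0 : ρ (Sum.inl 0) = 0
    · by_cases hr0 : ρ (Sum.inr 0) = 0
      · have e : consBoth (Sum.elim f g) = ρ := by
          funext x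
          rcases x with i | i <;> refine Fin.cases ?_ (fun i => ?_) i <;>
            simp [consBoth, hl0, hr0, hf, hg]
        exact Or.inr ⟨_, consBoth_mem.1 (e ▸ h), e⟩
      · obtain ⟨g', hg'⟩ := exists_succ_of_strictMono_of_ne hr hr0
        have e : consLeft (Sum.elim f g') = ρ := by
          funext x
          rcases x with i | i
          · refine Fin.cases ?_ (fun i => ?_) i <;> simp [consLeft, hl0, hf]
          · simp [consLeft, hg']
        exact Or.inl (Or.inl ⟨_, consLeft_mem.1 (e ▸ h), e⟩)
    · obtain ⟨f', hf'⟩ := exists_succ_of_strictMono_of_ne hl hl0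
      have hr0 : ρ (Sum.inr 0) = 0 := by
        obtain ⟨x, hx⟩ := hs 0
        rcases x with i | i
        · rw [hf'] at hx
          exact absurd hx (Fin.succ_ne_zero _)
        · exact le_antisymm (hx ▸ hr.monotone (Fin.zero_le i)) (Fin.zero_le _)
      have e : consRight (Sum.elim f' g) = ρ := by
        funext x
        rcases x with i | i
        · simp [consRight, hf']
        · refine Fin.cases ?_ (fun i => ?_) i <;> simp [consRight, hr0, hg]
      exact Or.inl (Or.inr ⟨_, consRight_mem.1 (e ▸ h), e⟩)
  · rintro ((⟨π, h, rfl⟩ | ⟨π, h, rfl⟩) | ⟨π, h, rfl⟩)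
    · exact consLeft_mem.2 h
    · exact consRight_mem.2 h
    · exact consBoth_mem.2 h

theorem sum_quasiShuffles_succ {M : Type*} [AddCommMonoid M] (k l m : ℕ)
    (g : (Fin (k + 1) ⊕ Fin (l + 1) → Fin (m + 1)) → M) :
    ∑ π ∈ quasiShuffles (k + 1) (l + 1) (m + 1), g π =
      ∑ π ∈ quasiShuffles k (l + 1) m, g (consLeft π) +
        ∑ π ∈ quasiShuffles (k + 1) l m, g (consRight π) +
          ∑ π ∈ quasiShuffles k l m, g (consBoth π) := by
  classical
  rw [quasiShuffles_succ, Finset.sum_union, Finset.sum_union,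
    Finset.sum_image consLeft_injective.injOn, Finset.sum_image consRight_injective.injOn,
    Finset.sum_image consBoth_injective.injOn]
  · rw [Finset.disjoint_left]
    intro ρ h1 h2
    obtain ⟨π, -, rfl⟩ := Finset.mem_image.1 h1
    obtain ⟨π', -, h⟩ := Finset.mem_image.1 h2
    have := congrFun h (Sum.inl 0)
    simp [consLeft, consRight] at this
  · rw [Finset.disjoint_left]
    intro ρ h1 h2
    obtain ⟨π', -, rfl⟩ := Finset.mem_image.1 h2
    rcases Finset.mem_union.1 h1 with h1 | h1
    · obtain ⟨π, -, h⟩ := Finset.mem_image.1 h1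
      have := congrFun h (Sum.inr 0)
      simp [consLeft, consBoth] at this
    · obtain ⟨π, -, h⟩ := Finset.mem_image.1 h1
      have := congrFun h (Sum.inl 0)
      simp [consRight, consBoth] at this

theorem quasiShuffles_succ_zero (k l : ℕ) : quasiShuffles (k + 1) l 0 = ∅ :=
  Finset.eq_empty_of_forall_notMem fun π _ => (π (Sum.inl 0)).elim0

theorem quasiShuffles_eq_empty (h : k + l < m) : quasiShuffles k l m = ∅ := by
  refine Finset.eq_empty_of_forall_notMem fun π hπ => ?_
  have := Fintype.card_le_of_surjective π (mem_quasiShuffles.1 hπ).1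
  simp only [Fintype.card_fin, Fintype.card_sum] at this
  omega

theorem eq_of_strictMono_surjective {f : Fin k → Fin m} (h : StrictMono f)
    (hs : Function.Surjective f) : k = m := by
  simpa using Fintype.card_of_bijective ⟨h.injective, hs⟩

theorem eq_id_of_strictMono_surjective {f : Fin k → Fin k} (h : StrictMono f)
    (hs : Function.Surjective f) : f = id :=
  (h.range_inj strictMono_id).1 (by rw [hs.range_eq, Set.range_id])

theorem sum_quasiShuffles_zero_left {M : Type*} [AddCommMonoid M] (l : ℕ)
    (g : ∀ m, (Fin 0 ⊕ Fin l → Fin m) → M) :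
    ∑ m ∈ Finset.range (0 + l + 1), ∑ π ∈ quasiShuffles 0 l m, g m π =
      g l (Sum.elim Fin.elim0 fun i => i) := by
  have hs : ∀ m, ∀ π ∈ quasiShuffles 0 l m, Function.Surjective fun i => π (Sum.inr i) :=
    fun m π hπ j => by
      obtain ⟨i | i, hx⟩ := (mem_quasiShuffles.1 hπ).1 j
      · exact i.elim0
      · exact ⟨i, hx⟩
  rw [Finset.sum_eq_single l]
  · rw [Finset.sum_eq_single (Sum.elim Fin.elim0 fun i => i)]
    · intro π hπ hne
      refine absurd ?_ hne
      have := eq_id_of_strictMono_surjective (mem_quasiShuffles.1 hπ).2.2 (hs _ _ hπ)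
      funext x
      rcases x with i | i
      · exact i.elim0
      · exact congrFun this i
    · intro h
      refine absurd (mem_quasiShuffles.2 ⟨fun j => ⟨Sum.inr j, rfl⟩, fun i => i.elim0, ?_⟩) h
      exact strictMono_id
  · intro m _ hm
    refine Finset.sum_eq_zero fun π hπ => absurd ?_ hm
    exact (eq_of_strictMono_surjective (mem_quasiShuffles.1 hπ).2.2 (hs _ _ hπ)).symm
  · intro h
    exact absurd (Finset.mem_range.2 (by omega)) h

theorem sum_quasiShuffles_zero_right {M : Type*} [AddCommMonoid M] (k : ℕ)
    (g : ∀ m, (Fin k ⊕ Fin 0 → Fin m) → M) :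
    ∑ m ∈ Finset.range (k + 0 + 1), ∑ π ∈ quasiShuffles k 0 m, g m π =
      g k (Sum.elim (fun i => i) Fin.elim0) := by
  have hs : ∀ m, ∀ π ∈ quasiShuffles k 0 m, Function.Surjective fun i => π (Sum.inl i) :=
    fun m π hπ j => by
      obtain ⟨i | i, hx⟩ := (mem_quasiShuffles.1 hπ).1 j
      · exact ⟨i, hx⟩
      · exact i.elim0
  rw [Finset.sum_eq_single k]
  · rw [Finset.sum_eq_single (Sum.elim (fun i => i) Fin.elim0)]
    · intro π hπ hne
      refine absurd ?_ hne
      have := eq_id_of_strictMono_surjective (mem_quasiShuffles.1 hπ).2.1 (hs _ _ hπ)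
      funext x
      rcases x with i | i
      · exact congrFun this i
      · exact i.elim0
    · intro h
      refine absurd (mem_quasiShuffles.2 ⟨fun j => ⟨Sum.inl j, rfl⟩, ?_, fun i => i.elim0⟩) h
      exact strictMono_id
  · intro m _ hm
    refine Finset.sum_eq_zero fun π hπ => absurd ?_ hm
    exact (eq_of_strictMono_surjective (mem_quasiShuffles.1 hπ).2.1 (hs _ _ hπ)).symm
  · intro h
    exact absurd (Finset.mem_range.2 (by omega)) h

/-! ### The words of the stuffle product -/

/-- With the two words separated and filters replaced by indicators, the first letters split off by
the rules for sums and products over `Fin (n + 1)`. -/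
theorem stuffleWord_apply (s : Version) (σ : Fin k → ℝ → ℂ) (τ : Fin l → ℝ → ℂ)
    (π : Fin k ⊕ Fin l → Fin m) (j : Fin m) (x : ℝ) : stuffleWord s σ τ π j x =
      s.sign ^ ((∑ i, if π (Sum.inl i) = j then 1 else 0) +
        (∑ i, if π (Sum.inr i) = j then 1 else 0) - 1) *
      ((∏ i, if π (Sum.inl i) = j then σ i x else 1) *
        ∏ i, if π (Sum.inr i) = j then τ i x else 1) := by
  simp only [stuffleWord, Finset.card_filter, Finset.prod_filter, Fintype.sum_sum_type,
    Fintype.prod_sum_type, Sum.elim_inl, Sum.elim_inr]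

theorem stuffleWord_consLeft (s : Version) (σ : Fin (k + 1) → ℝ → ℂ) (τ : Fin l → ℝ → ℂ)
    (π : Fin k ⊕ Fin l → Fin m) : stuffleWord s σ τ (consLeft π) =
      Fin.cons (σ 0) (stuffleWord s (fun i => σ i.succ) τ π) := by
  funext j x
  refine Fin.cases ?_ (fun j => ?_) j
  · simp [stuffleWord_apply, Fin.sum_univ_succ, Fin.prod_univ_succ, consLeft]
  · simp [stuffleWord_apply, Fin.sum_univ_succ, Fin.prod_univ_succ, consLeft,
      (Fin.succ_ne_zero j).symm]

theorem stuffleWord_consRight (s : Version) (σ : Fin k → ℝ → ℂ) (τ : Fin (l + 1) → ℝ → ℂ)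
    (π : Fin k ⊕ Fin l → Fin m) : stuffleWord s σ τ (consRight π) =
      Fin.cons (τ 0) (stuffleWord s σ (fun i => τ i.succ) π) := by
  funext j x
  refine Fin.cases ?_ (fun j => ?_) j
  · simp [stuffleWord_apply, Fin.sum_univ_succ, Fin.prod_univ_succ, consRight]
  · simp [stuffleWord_apply, Fin.sum_univ_succ, Fin.prod_univ_succ, consRight,
      (Fin.succ_ne_zero j).symm]

theorem stuffleWord_consBoth (s : Version) (σ : Fin (k + 1) → ℝ → ℂ) (τ : Fin (l + 1) → ℝ → ℂ)
    (π : Fin k ⊕ Fin l → Fin m) : stuffleWord s σ τ (consBoth π) =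
      Fin.cons (fun x => s.sign * (σ 0 x * τ 0 x))
        (stuffleWord s (fun i => σ i.succ) (fun i => τ i.succ) π) := by
  funext j x
  refine Fin.cases ?_ (fun j => ?_) j
  · simp [stuffleWord_apply, Fin.sum_univ_succ, Fin.prod_univ_succ, consBoth]
  · simp [stuffleWord_apply, Fin.sum_univ_succ, Fin.prod_univ_succ, consBoth,
      (Fin.succ_ne_zero j).symm]

theorem stuffleWord_id_right (s : Version) (σ : Fin 0 → ℝ → ℂ) (τ : Fin l → ℝ → ℂ) :
    stuffleWord s σ τ (Sum.elim Fin.elim0 fun i => i) = τ := by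
  funext j x
  simp only [stuffleWord_apply, Sum.elim_inl, Sum.elim_inr]
  rw [Finset.sum_eq_single j, Finset.prod_eq_single j] <;> simp +contextual

theorem stuffleWord_id_left (s : Version) (σ : Fin k → ℝ → ℂ) (τ : Fin 0 → ℝ → ℂ) :
    stuffleWord s σ τ (Sum.elim (fun i => i) Fin.elim0) = σ := by
  funext j x
  simp only [stuffleWord_apply, Sum.elim_inl, Sum.elim_inr]
  rw [Finset.sum_eq_single j, Finset.prod_eq_single j] <;> simp +contextual

/-! ### The stuffle relation for truncated sums -/

/-- A square is two triangles and a diagonal. Strict triangles miss the diagonal, which has to be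
added; weak triangles both contain it, so it is subtracted once. This is the origin of the sign in
the weak stuffle product. -/
theorem sum_mul_sum_recursion (s : Version) (u v : ℕ → ℂ) (N : ℕ) :
    (∑ n ∈ Finset.Icc 1 N, u n) * ∑ n ∈ Finset.Icc 1 N, v n =
      ∑ n ∈ Finset.Icc 1 N, u n * ∑ i ∈ Finset.Icc 1 (s.pred n), v i +
        ∑ n ∈ Finset.Icc 1 N, v n * ∑ i ∈ Finset.Icc 1 (s.pred n), u i +
          ∑ n ∈ Finset.Icc 1 N, s.sign * (u n * v n) := by
  induction N with
  | zero => simp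
  | succ N ih =>
    simp only [Finset.sum_Icc_succ_top (Nat.succ_le_succ (Nat.zero_le N))]
    rw [add_mul, mul_add, ih]
    cases s
    · simp only [Version.pred, Version.sign, Nat.add_sub_cancel]
      ring
    · simp only [Version.pred, Version.sign,
        Finset.sum_Icc_succ_top (Nat.succ_le_succ (Nat.zero_le N))]
      ring

end

theorem truncatedNestedSum_cons (s : Version) {k : ℕ} (a : ℝ → ℂ) (w : Fin k → ℝ → ℂ) (N : ℕ) :
    truncatedNestedSum s (Fin.cons a w : Fin (k + 1) → ℝ → ℂ) N =
      ∑ n ∈ Finset.Icc 1 N, a n * truncatedNestedSum s w (s.pred n) := by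
  rw [truncatedNestedSum_succ]
  rfl

theorem mul_sum_sum_comm {ι κ : Type*} {B : ι → Type*} (I : Finset κ) (A : Finset ι)
    (S : ∀ m, Finset (B m)) (c : κ → ℂ) (T : ∀ m, B m → κ → ℂ) :
    ∑ n ∈ I, c n * ∑ m ∈ A, ∑ π ∈ S m, T m π n =
      ∑ m ∈ A, ∑ π ∈ S m, ∑ n ∈ I, c n * T m π n := by
  simp only [Finset.mul_sum]
  rw [Finset.sum_comm]
  exact Finset.sum_congr rfl fun m _ => Finset.sum_comm

/-- Induction on both lengths, comparing the largest indices of the two chains. The three terms of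
`sum_mul_sum_recursion` match the three types of quasi-shuffles. -/
theorem truncatedNestedSum_mul (s : Version) {k l : ℕ} (σ : Fin k → ℝ → ℂ) (τ : Fin l → ℝ → ℂ)
    (N : ℕ) : truncatedNestedSum s σ N * truncatedNestedSum s τ N =
      ∑ m ∈ Finset.range (k + l + 1), ∑ π ∈ quasiShuffles k l m,
        truncatedNestedSum s (stuffleWord s σ τ π) N := by
  induction k generalizing l N with
  | zero =>
    rw [sum_quasiShuffles_zero_left l fun m π => truncatedNestedSum s (stuffleWord s σ τ π) N,
      stuffleWord_id_right, truncatedNestedSum_zero, one_mul]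
  | succ k ihk =>
    induction l generalizing N with
    | zero =>
      rw [sum_quasiShuffles_zero_right (k + 1) fun m π =>
        truncatedNestedSum s (stuffleWord s σ τ π) N, stuffleWord_id_left,
        truncatedNestedSum_zero, mul_one]
    | succ l ihl =>
      have hR : ∑ m ∈ Finset.range (k + 1 + (l + 1) + 1), ∑ π ∈ quasiShuffles (k + 1) (l + 1) m,
          truncatedNestedSum s (stuffleWord s σ τ π) N =
          ∑ n ∈ Finset.Icc 1 N, (σ 0 n * ∑ m ∈ Finset.range (k + (l + 1) + 1),
            ∑ π ∈ quasiShuffles k (l + 1) m,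
              truncatedNestedSum s (stuffleWord s (fun i => σ i.succ) τ π) (s.pred n)) +
          ∑ n ∈ Finset.Icc 1 N, (τ 0 n * ∑ m ∈ Finset.range (k + 1 + l + 1),
            ∑ π ∈ quasiShuffles (k + 1) l m,
              truncatedNestedSum s (stuffleWord s σ (fun i => τ i.succ) π) (s.pred n)) +
          ∑ n ∈ Finset.Icc 1 N, (s.sign * (σ 0 n * τ 0 n) * ∑ m ∈ Finset.range (k + l + 1),
            ∑ π ∈ quasiShuffles k l m, truncatedNestedSum s
              (stuffleWord s (fun i => σ i.succ) (fun i => τ i.succ) π) (s.pred n)) := by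
        rw [Finset.sum_range_succ', quasiShuffles_succ_zero, Finset.sum_empty, add_zero]
        simp only [sum_quasiShuffles_succ, stuffleWord_consLeft, stuffleWord_consRight,
          stuffleWord_consBoth, truncatedNestedSum_cons, Finset.sum_add_distrib, mul_sum_sum_comm]
        rw [show k + 1 + (l + 1) = k + l + 1 + 1 by ring, show k + (l + 1) + 1 = k + l + 1 + 1 by ring,
          show k + 1 + l + 1 = k + l + 1 + 1 by ring]
        congr 1
        -- For merged first letters the common range of m is one too long; the superfluous term is
        -- empty by cardinality.
        rw [Finset.sum_range_succ _ (k + l + 1), quasiShuffles_eq_empty (Nat.lt_succ_self (k + l)),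
          Finset.sum_empty, add_zero]
      rw [hR, truncatedNestedSum_succ s σ, truncatedNestedSum_succ s τ, sum_mul_sum_recursion]
      simp only [← truncatedNestedSum_succ, ← ihk, ← ihl]
      congr 1
      · congr 1
        · exact Finset.sum_congr rfl fun n _ => by ring
        · exact Finset.sum_congr rfl fun n _ => by ring
      · exact Finset.sum_congr rfl fun n _ => by ring

/-! ### Convergence of the words -/

theorem PowO.prod {ι : Type*} {a : ι → ℝ} {u : ι → ℕ → ℂ} (h : ∀ i, PowO (a i) (u i))
    (S : Finset ι) : PowO (∑ i ∈ S, a i) (fun n => ∏ i ∈ S, u i n) := by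
  classical
  induction S using Finset.induction_on with
  | empty => exact PowO.of_le (C := 1) fun n => by simp
  | insert i S hi ih =>
    simp only [Finset.prod_insert hi, Finset.sum_insert hi]
    exact (h i).mul ih

/-- The letters placed at or before j form an initial segment of their word, so the hypothesis
applies at the last of them. -/
theorem sum_filter_le_neg_card {k m : ℕ} {a : Fin k → ℝ}
    (ha : ∀ j : Fin k, ∑ i ∈ Finset.Iic j, a i < -((j : ℝ) + 1)) {f : Fin k → Fin m}
    (hf : StrictMono f) (j : Fin m) (h : (Finset.univ.filter fun i => f i ≤ j).Nonempty) :
    ∑ i with f i ≤ j, a i < -((Finset.univ.filter fun i => f i ≤ j).card : ℝ) := by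
  set S := Finset.univ.filter fun i => f i ≤ j with hS
  have hI : S = Finset.Iic (S.max' h) := by
    ext i
    rw [Finset.mem_Iic]
    refine ⟨fun hi => S.le_max' i hi, fun hi => ?_⟩
    have h1 : f (S.max' h) ≤ j := (Finset.mem_filter.1 (S.max'_mem h)).2
    exact Finset.mem_filter.2 ⟨Finset.mem_univ _, (hf.monotone hi).trans h1⟩
  rw [hI, Fin.card_Iic]
  push_cast
  exact ha _

/-- An initial part of the new word absorbs initial segments of lengths p and q of the two words.
Their orders sum to less than -p - q, and p + q is at least the number of positions since each
position is hit. -/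
theorem nestedSumConverges_stuffleWord (s : Version) {k l m : ℕ} {a : Fin k → ℝ} {b : Fin l → ℝ}
    {σ : Fin k → ℝ → ℂ} {τ : Fin l → ℝ → ℂ}
    (hσ : ∀ i, PowO (a i) (fun n : ℕ => σ i n)) (hτ : ∀ i, PowO (b i) (fun n : ℕ => τ i n))
    (ha : ∀ j : Fin k, ∑ i ∈ Finset.Iic j, a i < -((j : ℝ) + 1))
    (hb : ∀ j : Fin l, ∑ i ∈ Finset.Iic j, b i < -((j : ℝ) + 1))
    {π : Fin k ⊕ Fin l → Fin m} (hπ : π ∈ quasiShuffles k l m) :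
    NestedSumConverges s (stuffleWord s σ τ π) := by
  classical
  obtain ⟨hs, hl, hr⟩ := mem_quasiShuffles.1 hπ
  have hc : ∀ i, PowO (Sum.elim a b i) (fun n : ℕ => Sum.elim σ τ i n) := by
    rintro (i | i)
    exacts [hσ i, hτ i]
  refine nestedSumConverges_of_powO (a := fun j => ∑ i with π i = j, Sum.elim a b i) s
    (fun j => ?_) fun j => ?_
  · have := (PowO.prod hc (Finset.univ.filter fun i => π i = j)).smul
      (s.sign ^ ((Finset.univ.filter fun i => π i = j).card - 1))
    convert this using 1
    funext n
    simp only [stuffleWord, Pi.smul_apply, smul_eq_mul]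
  · have hsum : ∑ j' ∈ Finset.Iic j, ∑ i with π i = j', Sum.elim a b i =
        ∑ i with π i ≤ j, Sum.elim a b i := by
      rw [← Finset.sum_fiberwise_of_maps_to (s := Finset.univ.filter fun i => π i ≤ j)
        (t := Finset.Iic j) (g := π) fun i hi => by simpa using hi]
      refine Finset.sum_congr rfl fun j' hj' => Finset.sum_congr ?_ fun _ _ => rfl
      ext i
      have := Finset.mem_Iic.1 hj'
      simp only [Finset.mem_filter, Finset.mem_univ, true_and]
      exact ⟨fun h => ⟨h ▸ this, h⟩, fun h => h.2⟩
    have hcard : (j : ℕ) + 1 ≤ (Finset.univ.filter fun i => π (Sum.inl i) ≤ j).card +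
        (Finset.univ.filter fun i => π (Sum.inr i) ≤ j).card := by
      have h1 : (Finset.Iic j).card ≤ (Finset.univ.filter fun i => π i ≤ j).card := by
        refine Finset.card_le_card_of_surjOn π fun i hi => ?_
        obtain ⟨x, rfl⟩ := hs i
        exact ⟨x, by simpa using hi, rfl⟩
      rw [Fin.card_Iic, Finset.card_filter, Fintype.sum_sum_type, ← Finset.card_filter,
        ← Finset.card_filter] at h1
      exact h1
    have hcard' : (j : ℝ) + 1 ≤ ((Finset.univ.filter fun i => π (Sum.inl i) ≤ j).card : ℝ) +
        ((Finset.univ.filter fun i => π (Sum.inr i) ≤ j).card : ℝ) := by exact_mod_cast hcard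
    rw [hsum, Finset.sum_filter, Fintype.sum_sum_type, ← Finset.sum_filter, ← Finset.sum_filter]
    simp only [Sum.elim_inl, Sum.elim_inr]
    -- An empty segment gives the sum 0 and no strict inequality, but the two segments cannot both
    -- be empty.
    rcases Finset.eq_empty_or_nonempty (Finset.univ.filter fun i => π (Sum.inl i) ≤ j) with h1 | h1 <;>
    rcases Finset.eq_empty_or_nonempty (Finset.univ.filter fun i => π (Sum.inr i) ≤ j) with h2 | h2
    · rw [h1, h2] at hcard
      simp at hcard
    · have h3 := sum_filter_le_neg_card hb hr j h2
      rw [h1] at hcard' ⊢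
      simp only [Finset.card_empty, Nat.cast_zero, zero_add, Finset.sum_empty] at hcard' ⊢
      linarith
    · have h3 := sum_filter_le_neg_card ha hl j h1
      rw [h2] at hcard' ⊢
      simp only [Finset.card_empty, Nat.cast_zero, add_zero, Finset.sum_empty] at hcard' ⊢
      linarith
    · have h3 := sum_filter_le_neg_card hb hr j h2
      have h4 := sum_filter_le_neg_card ha hl j h1
      linarith

/-! ### The stuffle relation for nested sums -/

/-- Equal words are merged in the formal sum; linearity makes this invisible after evaluation. -/
theorem nestedSumLinear_stuffle (s : Version) {k l : ℕ} (σ : Fin k → ℝ → ℂ) (τ : Fin l → ℝ → ℂ) :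
    nestedSumLinear s (stuffle s σ τ) = ∑ m ∈ Finset.range (k + l + 1),
      ∑ π ∈ quasiShuffles k l m, nestedSum s (stuffleWord s σ τ π) := by
  have hlin : ∀ x, nestedSumLinear s x =
      Finsupp.linearCombination ℂ (fun w : PureTensor => nestedSum s w.2) x := fun x => rfl
  simp only [hlin, stuffle, map_sum, Finsupp.linearCombination_single, one_smul]

theorem exists_of_mem_support_stuffle (s : Version) {k l : ℕ} {σ : Fin k → ℝ → ℂ}
    {τ : Fin l → ℝ → ℂ} {w : PureTensor} (hw : w ∈ (stuffle s σ τ).support) :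
    ∃ m, ∃ π ∈ quasiShuffles k l m, w = ⟨m, stuffleWord s σ τ π⟩ := by
  by_contra! h
  refine Finsupp.mem_support_iff.1 hw ?_
  rw [stuffle, Finsupp.finsetSum_apply]
  refine Finset.sum_eq_zero fun m _ => ?_
  rw [Finsupp.finsetSum_apply]
  exact Finset.sum_eq_zero fun π hπ => Finsupp.single_eq_of_ne (h m π hπ)

theorem nestedSumLinear_stuffle_eq_mul (s : Version) {k l : ℕ} {σ : Fin k → ℝ → ℂ}
    {τ : Fin l → ℝ → ℂ} (hσ : NestedSumConverges s σ) (hτ : NestedSumConverges s τ)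
    (hw : ∀ m, ∀ π ∈ quasiShuffles k l m, NestedSumConverges s (stuffleWord s σ τ π)) :
    nestedSumLinear s (stuffle s σ τ) = nestedSum s σ * nestedSum s τ := by
  rw [nestedSumLinear_stuffle]
  refine tendsto_nhds_unique (f := fun N => truncatedNestedSum s σ N * truncatedNestedSum s τ N)
    (l := atTop) ?_ (hσ.2.mul hτ.2)
  simp only [truncatedNestedSum_mul]
  exact tendsto_finsetSum _ fun m _ => tendsto_finsetSum _ fun π hπ => (hw m π hπ).2

end NestedSums

end

theorem mainTheorem5
    (W : Set ℂ) (hW : IsOpen W) (h0 : (0 : ℂ) ∈ W)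
    (k : ℕ) (α : Fin k → ℂ → ℂ) (f : Fin k → ℂ → ℝ → ℂ)
    (hf : ∀ i, IsSimpleHolomorphicFamily W (α i) (f i))
    (hα : ∀ j : Fin k, ∀ z ∈ W, (∑ i ∈ Finset.Iic j, deriv (α i) z).re < 0)
    (s : Version) :
    -- the cut-off nested sums are well defined
    (∀ z : Fin k → ℂ, (∀ i, z i ∈ W) →
      ∃! c : ℂ, IsFinitePart (truncatedNestedSum s (fun i => f i (z i))) c) ∧
    -- meromorphy in several variables
    IsMeromorphicWithPoles α {z | ∀ i, z i ∈ W}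
      (fun z => cutoffNestedSum s (fun i => f i (z i))) ∧
    -- meromorphy on the diagonal, with poles of order at most `k`
    (∀ z ∈ W, MeromorphicAt (fun z => cutoffNestedSum s (fun i => f i z)) z ∧
      ((-(k : ℤ) : ℤ) : WithTop ℤ) ≤
        meromorphicOrderAt (fun z => cutoffNestedSum s (fun i => f i z)) z) ∧
    -- the convergent case, and the stuffle relations
    (ConvergentOrders (fun i => α i 0) →
      NestedSumConverges s (fun i => f i 0) ∧
      cutoffNestedSum s (fun i => f i 0) = nestedSum s (fun i => f i 0) ∧
      regularisedNestedSum s f = nestedSum s (fun i => f i 0) ∧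
      Tendsto (fun z => cutoffNestedSum s (fun i => f i z)) (𝓝 0)
        (𝓝 (nestedSum s (fun i => f i 0))) ∧
      ∀ (l : ℕ) (β : Fin l → ℂ) (τ : Fin l → ℝ → ℂ),
        (∀ i, IsClassicalSymbol (β i) (τ i)) → ConvergentOrders β →
        NestedSumConverges s τ ∧
        (∀ w ∈ (stuffle s (fun i => f i 0) τ).support, NestedSumConverges s w.2) ∧
        nestedSumLinear s (stuffle s (fun i => f i 0) τ) =
          nestedSum s (fun i => f i 0) * nestedSum s τ) := by
  refine ⟨fun z hz => existsUnique_isFinitePart s fun i => (hf i).symbol (z i) (hz i),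
    isMeromorphicWithPoles_cutoffNestedSum hW hf hα s,
    fun z hz => meromorphicAt_diagonal hW hf hα s hz, fun hconv => ?_⟩
  have hsym : ∀ i, IsClassicalSymbol (α i 0) (f i 0) := fun i => (hf i).symbol 0 h0
  have hσ : NestedSumConverges s (fun i => f i 0) :=
    nestedSumConverges_of_convergentOrders s hsym hconv
  -- Analyticity at 0 identifies both the Laurent finite part and the limit with the value at 0,
  -- which is the ordinary nested sum.
  have han := analyticAt_cutoffNestedSum hW hf s h0 hconv
  refine ⟨hσ, hσ.cutoff_eq, ?_, ?_, fun l β τ hβ hβconv => ?_⟩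
  · exact (laurentFinitePart_of_analyticAt han).trans hσ.cutoff_eq
  · have := han.continuousAt.tendsto
    rwa [hσ.cutoff_eq] at this
  · have hτ : NestedSumConverges s τ := nestedSumConverges_of_convergentOrders s hβ hβconv
    have hw : ∀ m, ∀ π ∈ quasiShuffles k l m,
        NestedSumConverges s (stuffleWord s (fun i => f i 0) τ π) := fun m π hπ =>
      nestedSumConverges_stuffleWord s (fun i => (hsym i).powO) (fun i => (hβ i).powO)
        (fun j => by simpa only [Complex.re_sum] using hconv j)
        (fun j => by simpa only [Complex.re_sum] using hβconv j) hπ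
    refine ⟨hτ, fun w hws => ?_, nestedSumLinear_stuffle_eq_mul s hσ hτ hw⟩
    obtain ⟨m, π, hπ, rfl⟩ := exists_of_mem_support_stuffle s hws
    exact hw m π hπ
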